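/- Let $\mathbb K$ be $\mathbb R$ or $\mathbb C$, let ${}^{\mathfrak t}$ denote the transpose ($\mathbb K=\mathbb R$) or conjugate transpose ($\mathbb K=\mathbb C$), let $\mathrm{Tr}_{\mathbb R}$ be the real part of the trace, and let $0<d<n$. Let $\mathcal E=\mathbb K^{n\times d}$, regarded as a real inner product space with $\langle a,b\rangle_{\mathcal E}=\mathrm{Tr}_{\mathbb R}(ab^{\mathfrak t})$, and let $\mathrm{St}=\{Y\in\mathcal E: Y^{\mathfrak t}Y=I_d\}$ be the Stiefel manifold. Let $\alpha_0,\alpha_1>0$ and, for $Y\in\mathrm{St}$, let $\mathsf g=\mathsf g(Y)$ be the operator $\mathsf g\omega=\alpha_0\omega+(\alpha_1-\alpha_0)YY^{\mathfrak t}\omega$ on $\mathcal E$; it is invertible with $\mathsf g^{-1}\omega=\alpha_0^{-1}(I_n-YY^{\mathfrak t})\omega+\alpha_1^{-1}YY^{\mathfrak t}\omega$. Equip $\mathrm{St}$ with the Riemannian metric $\langle v,w\rangle_{\mathsf g}=\langle v,\mathsf g w\rangle_{\mathcal E}$. Let $q\ge 0$, let $\hat d=(d_1,\dots,d_q)$ be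 positive integers with $\sum_{i\le q}d_i\le d$, and put $d_{q+1}=d-\sum_{i\le q} d_i\geq 0$. Write $A\in\mathbb K^{d\times d}$ in blocks $A_{[ij]}\in\mathbb K^{d_i\times d_j}$, $1\le i,j\le q+1$. Let $G=U(\hat d)$ be the group of block-diagonal matrices $\mathrm{diag}(U_1,\dots,U_q,I_{d_{q+1}})$ with $U_i^{\mathfrak t}U_i=I_{d_i}$; it acts on $\mathrm{St}$ isometrically by right multiplication. Let $\mathcal B=\mathrm{St}/G$ have the smooth structure and the metric for which $\pi:\mathrm{St}\to\mathcal B$ is a Riemannian submersion (for $q=0$, $\mathcal B$ is the Stiefel manifold; for $\hat d=(d)$ a Grassmann manifold; for $d_{q+1}=0$ a flag manifold). Let $\mathcal H_Y\subset T_Y\mathrm{St}$ be the horizontal space, i.e. the $\mathsf g$-orthogonal complement in $T_Y\mathrm{St}$ of the tangent space of the orbit $YG$, and let $\Pi_{\mathcal H}:\mathcal E\to\mathcal H_Y$ be the $\langle\cdot,\mathsf g\,\cdot\rangle_{\mathcal E}$-orthogonal projection. Define $A_{\mathrm{symf}}$ by $(A_{\mathrm{symf}})_{[ii]}=A_{[ii]}$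 for $1\le i\le q$, and $(A_{\mathrm{symf}})_{[ij]}=\frac12(A_{[ij]}+A_{[ji]}^{\mathfrak t})$ if $i\ne j$ or $i=j=q+1$. Let $\Pi_0=I_n-YY^{\mathfrak t}$, and let $\mathrm D_v$ denote the directional derivative along $v\in T_Y\mathrm{St}$ of a function or $\mathcal E$-valued map on $\mathrm{St}$. For a smooth function $f$ on $\mathrm{St}$, an ambient gradient is a map $\hat f_Y:\mathrm{St}\to\mathcal E$ with $\langle v,\hat f_Y\rangle_{\mathcal E}=\mathrm D_vf$ for all tangent $v$; when it is $C^1$, put $\hat f_{YY}\xi=\mathrm D_\xi\hat f_Y$ and $\hat f_{YY}(\xi,\eta)=\langle\hat f_{YY}\xi,\eta\rangle_{\mathcal E}$. The horizontal Riemannian gradient $\mathsf{rgrad}_f$ is the unique horizontal vector field with $\langle\mathsf{rgrad}_f,\xi\rangle_{\mathsf g}=\mathrm D_\xi f$ for all horizontal $\xi$. Let $\nabla$ be the Levi-Civita connection of $\mathrm{St}$, and put $\mathsf{rhess}^{11}_f\xi=\Pi_{\mathcal H}\nabla_\xi\mathsf{rgrad}_f$ and $\mathsf{rhess}^{02}_f(\xi,\eta)=\langle\mathsf{rhess}^{11}_f\xi,\eta\rangle_{\mathsf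 g}$ for horizontal vector fields $\xi,\eta$. Then, at every $Y\in\mathrm{St}$: 1. $\mathcal H_Y=\{\omega\in\mathcal E:(Y^{\mathfrak t}\omega)_{\mathrm{symf}}=0\}$; equivalently, $\mathcal H_Y$ consists of the $\omega$ such that $Y^{\mathfrak t}\omega$ is $\mathfrak t$-antisymmetric and its diagonal blocks $(Y^{\mathfrak t}\omega)_{[ii]}$, $1\le i\le q$, vanish. 2. $\Pi_{\mathcal H}\omega=\omega-Y(Y^{\mathfrak t}\omega)_{\mathrm{symf}}$ for all $\omega\in\mathcal E$. 3. For every smooth $f$ on $\mathrm{St}$ and every ambient gradient $\hat f_Y$ of $f$, $$\mathsf{rgrad}_f=\Pi_{\mathcal H}\mathsf g^{-1}\hat f_Y=\alpha_0^{-1}\hat f_Y+(\alpha_1^{-1}-\alpha_0^{-1})YY^{\mathfrak t}\hat f_Y-\alpha_1^{-1}Y(Y^{\mathfrak t}\hat f_Y)_{\mathrm{symf}}.$$ 4. For smooth horizontal vector fields $\xi,\eta$ on $\mathrm{St}$, $$\Pi_{\mathcal H}\nabla_\xi\eta=\mathrm D_\xi\eta+Y(\xi^{\mathfrak t}\eta)_{\mathrm{symf}}+\frac{\alpha_0-\alpha_1}{\alpha_0}\Pi_0(\xi\eta^{\mathfrak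 t}+\eta\xi^{\mathfrak t})Y,$$ and, for every smooth $f$ on $\mathrm{St}$ with a $C^1$ ambient gradient $\hat f_Y$, $$\mathsf{rhess}^{02}_f(\xi,\eta)=\hat f_{YY}(\xi,\eta)-\mathrm{Tr}_{\mathbb R}\Big(\hat f_Y^{\mathfrak t}\Big\{Y(\xi^{\mathfrak t}\eta)_{\mathrm{symf}}+\frac{\alpha_0-\alpha_1}{\alpha_0}\Pi_0(\xi\eta^{\mathfrak t}+\eta\xi^{\mathfrak t})Y\Big\}\Big),$$ $$\mathsf{rhess}^{11}_f\xi=\Pi_{\mathcal H}\mathsf g^{-1}\Big(\hat f_{YY}\xi-\xi(Y^{\mathfrak t}\hat f_Y)_{\mathrm{symf}}-\frac{\alpha_0-\alpha_1}{\alpha_0}\big(\Pi_0\hat f_YY^{\mathfrak t}+Y\hat f_Y^{\mathfrak t}\Pi_0\big)\xi\Big).$$ 5. Each smooth vector field on $\mathcal B$ has a unique smooth horizontal lift to $\mathrm{St}$, and the quotient metric on $\mathcal B$, its Levi-Civita connection $\nabla^{\mathcal B}$ and the gradients on $\mathcal B$ exist and are unique. If $X,Z$ are vector fields on $\mathcal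 B$ with horizontal lifts $\xi,\eta$, and $f$ is a smooth function on $\mathcal B$ with $\hat f_Y$ an ambient gradient of $f\circ\pi$ ($C^1$ in the last two cases), then: the horizontal lift of $\nabla^{\mathcal B}_XZ$ is the right-hand side of the first formula in 4; the horizontal lift of the Riemannian gradient $\mathrm{grad}^{\mathcal B}f$ is given by the formula in 3; and, at $\pi(Y)$, the inner product of $\nabla^{\mathcal B}_X\mathrm{grad}^{\mathcal B}f$ with $Z$, and, at $Y$, the horizontal lift of $\nabla^{\mathcal B}_X\mathrm{grad}^{\mathcal B}f$, are given by the right-hand sides of the formulas in 4 for $\mathsf{rhess}^{02}_f(\xi,\eta)$ and $\mathsf{rhess}^{11}_f\xi$. -/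

import Mathlib

open scoped Matrix Matrix.Norms.Frobenius

/-! ## Calculus on an embedded submanifold `M` of a real normed space -/

section Embedded

variable {E : Type*} [NormedAddCommGroup E] [NormedSpace ℝ E]
variable {F : Type*} [NormedAddCommGroup F] [NormedSpace ℝ F]

/-- A map on `M` is of class `C^k` if it is the restriction of a `C^k` map defined on an open
neighbourhood of `M` in the ambient space. -/
def IsCkOn (k : ℕ∞) {M : Set E} (φ : M → F) : Prop :=
  ∃ (U : Set E) (Φ : E → F), IsOpen U ∧ M ⊆ U ∧ ContDiffOn ℝ k Φ U ∧ ∀ Y : M, φ Y = Φ Y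

/-- The tangent space: velocities at `Y` of smooth curves lying in `M`. -/
def tangentVectors (M : Set E) (Y : E) : Set E :=
  {v | ∃ γ : ℝ → E, ContDiff ℝ (⊤ : ℕ∞) γ ∧ (∀ t, γ t ∈ M) ∧ γ 0 = Y ∧ deriv γ 0 = v}

/-- The directional derivative `D_v φ (Y)` of a map on `M`. For `v` tangent to `M` all derivatives
of `φ` within `M` take the same value at `v`, so the value does not depend on any choice. -/
noncomputable def dirDeriv {M : Set E} (φ : M → F) (Y : M) (v : E) : F :=
  fderivWithin ℝ (Function.extend Subtype.val φ 0) M (Y : E) v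

/-- Smooth tangent vector fields on `M`, as maps into the ambient space. -/
@[ext]
structure VField (M : Set E) where
  toFun : M → E
  tangent : ∀ Y : M, toFun Y ∈ tangentVectors M (Y : E)
  smooth : IsCkOn ⊤ toFun

instance (M : Set E) : CoeFun (VField M) (fun _ => M → E) := ⟨VField.toFun⟩

/-- `conn` is the Levi-Civita connection of the Riemannian metric `m` (at `Y`, the inner product
of `v` and `w` is `m Y v w`): it is a connection, it is torsion-free (the bracket of two tangent
fields being `D_ξ η - D_η ξ`), and it is compatible with the metric. -/
structure IsLeviCivita {M : Set E} (m : M → E → E → ℝ)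
    (conn : VField M → VField M → VField M) : Prop where
  add_left : ∀ ξ₁ ξ₂ ξ η : VField M, (∀ Y, ξ Y = ξ₁ Y + ξ₂ Y) →
    ∀ Y, conn ξ η Y = conn ξ₁ η Y + conn ξ₂ η Y
  smul_left : ∀ (φ : M → ℝ) (ξ₁ ξ η : VField M), IsCkOn ⊤ φ → (∀ Y, ξ Y = φ Y • ξ₁ Y) →
    ∀ Y, conn ξ η Y = φ Y • conn ξ₁ η Y
  add_right : ∀ ξ η₁ η₂ η : VField M, (∀ Y, η Y = η₁ Y + η₂ Y) →
    ∀ Y, conn ξ η Y = conn ξ η₁ Y + conn ξ η₂ Y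
  leibniz : ∀ (φ : M → ℝ) (ξ η₁ η : VField M), IsCkOn ⊤ φ → (∀ Y, η Y = φ Y • η₁ Y) →
    ∀ Y, conn ξ η Y = φ Y • conn ξ η₁ Y + dirDeriv φ Y (ξ Y) • η₁ Y
  torsion_free : ∀ (ξ η : VField M) (Y : M),
    conn ξ η Y - conn η ξ Y = dirDeriv η Y (ξ Y) - dirDeriv ξ Y (η Y)
  metric : ∀ (ξ η ζ : VField M) (Y : M),
    dirDeriv (fun Z => m Z (η Z) (ζ Z)) Y (ξ Y)
      = m Y (conn ξ η Y) (ζ Y) + m Y (η Y) (conn ξ ζ Y)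

/-! ## Calculus on the quotient of `M` by an equivalence relation

The quotient manifold structure on the orbit space is the one that makes the projection a
submersion: a function is smooth if and only if its pullback to `M` is, and every tangent
vector is the velocity of the image of a smooth curve in `M`. -/

/-- Smooth functions on the quotient. -/
def QFun {M : Set E} (s : Setoid M) : Type _ :=
  {f : Quotient s → ℝ // IsCkOn ⊤ (fun Y : M => f (Quotient.mk s Y))}

instance {M : Set E} (s : Setoid M) : CoeFun (QFun s) (fun _ => Quotient s → ℝ) :=
  ⟨Subtype.val⟩

/-- The pullback to `M` of a smooth function on the quotient. -/
def QFun.pullback {M : Set E} {s : Setoid M} (f : QFun s) : M → ℝ :=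
  fun Y => f (Quotient.mk s Y)

/-- Smooth vector fields on the quotient, as operators on smooth functions which at each point
differentiate along the image of a smooth curve of `M`. -/
@[ext]
structure QVField {M : Set E} (s : Setoid M) where
  toFun : QFun s → QFun s
  kinematic : ∀ b : Quotient s, ∃ (γ : ℝ → E) (hγ : ∀ t, γ t ∈ M), ContDiff ℝ (⊤ : ℕ∞) γ ∧
    Quotient.mk s ⟨γ 0, hγ 0⟩ = b ∧
    ∀ f : QFun s, toFun f b = deriv (fun t => f (Quotient.mk s ⟨γ t, hγ t⟩)) 0

instance {M : Set E} (s : Setoid M) : CoeFun (QVField s) (fun _ => QFun s → QFun s) :=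
  ⟨QVField.toFun⟩

/-- `conn` is the Levi-Civita connection on the quotient of the metric `h` (the smooth function
`h X Z` being the pointwise inner product of the vector fields `X` and `Z`). -/
structure IsQLeviCivita {M : Set E} {s : Setoid M} (h : QVField s → QVField s → QFun s)
    (conn : QVField s → QVField s → QVField s) : Prop where
  add_left : ∀ X₁ X₂ X Z : QVField s, (∀ f b, X f b = X₁ f b + X₂ f b) →
    ∀ f b, conn X Z f b = conn X₁ Z f b + conn X₂ Z f b
  smul_left : ∀ (φ : QFun s) (X₁ X Z : QVField s), (∀ f b, X f b = φ b * X₁ f b) →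
    ∀ f b, conn X Z f b = φ b * conn X₁ Z f b
  add_right : ∀ X Z₁ Z₂ Z : QVField s, (∀ f b, Z f b = Z₁ f b + Z₂ f b) →
    ∀ f b, conn X Z f b = conn X Z₁ f b + conn X Z₂ f b
  leibniz : ∀ (φ : QFun s) (X Z₁ Z : QVField s), (∀ f b, Z f b = φ b * Z₁ f b) →
    ∀ f b, conn X Z f b = φ b * conn X Z₁ f b + X φ b * Z₁ f b
  torsion_free : ∀ (X Z : QVField s) (f : QFun s) (b : Quotient s),
    conn X Z f b - conn Z X f b = X (Z f) b - Z (X f) b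
  metric : ∀ (X Z W : QVField s) (b : Quotient s),
    X (h Z W) b = h (conn X Z) W b + h Z (conn X W) b

/-- `R` is the Riemannian gradient on the quotient of the function `f`. -/
def IsQGradient {M : Set E} {s : Setoid M} (h : QVField s → QVField s → QFun s)
    (f : QFun s) (R : QVField s) : Prop :=
  ∀ (X : QVField s) (b : Quotient s), h R X b = X f b

end Embedded

/-! ## The Stiefel manifold and its metrics -/

section Stiefel

variable {𝕜 : Type*} [RCLike 𝕜] {n d q : ℕ}

/-- The real part of the trace. -/
def trR {m : ℕ} (A : Matrix (Fin m) (Fin m) 𝕜) : ℝ := RCLike.re A.trace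

/-- The real trace (Frobenius) inner product `Re Tr (A Bᴴ)`. -/
def frobInner (A B : Matrix (Fin n) (Fin d) 𝕜) : ℝ := trR (A * Bᴴ)

variable (𝕜 n d) in
/-- The Stiefel manifold. -/
def stiefel : Set (Matrix (Fin n) (Fin d) 𝕜) := {Y | Yᴴ * Y = 1}

/-- The metric operator at `Y`. -/
def metricOp (α₀ α₁ : ℝ) (Y ω : Matrix (Fin n) (Fin d) 𝕜) : Matrix (Fin n) (Fin d) 𝕜 :=
  α₀ • ω + (α₁ - α₀) • (Y * Yᴴ * ω)

/-- The inverse of the metric operator at a point `Y` of the Stiefel manifold. -/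
noncomputable def metricOpInv (α₀ α₁ : ℝ) (Y ω : Matrix (Fin n) (Fin d) 𝕜) :
    Matrix (Fin n) (Fin d) 𝕜 :=
  α₀⁻¹ • ((1 - Y * Yᴴ) * ω) + α₁⁻¹ • (Y * Yᴴ * ω)

/-- The inner product of `v` and `w` at `Y`. -/
def stMetric (α₀ α₁ : ℝ) (Y v w : Matrix (Fin n) (Fin d) 𝕜) : ℝ :=
  frobInner v (metricOp α₀ α₁ Y w)

/-- `fY` is an ambient gradient of the function `f` on the Stiefel manifold. -/
def IsAmbientGradient (f : stiefel 𝕜 n d → ℝ)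
    (fY : stiefel 𝕜 n d → Matrix (Fin n) (Fin d) 𝕜) : Prop :=
  ∀ Y : stiefel 𝕜 n d, ∀ v ∈ tangentVectors (stiefel 𝕜 n d) (Y : Matrix (Fin n) (Fin d) 𝕜),
    frobInner v (fY Y) = dirDeriv f Y v

/-! ## The block-diagonal group -/

/-- The block that the index `j` belongs to, in the partition of the `d` indices into consecutive
blocks of lengths `dhat 0, …, dhat (q - 1)` and `d - ∑ i, dhat i`; blocks are numbered `0, …, q`,
so that the last (possibly empty) one has number `q`. -/
def blk (dhat : Fin q → ℕ) (j : Fin d) : ℕ :=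
  (Finset.univ.filter (fun k : Fin q => ∑ i ∈ Finset.Iic k, dhat i ≤ (j : ℕ))).card

/-- The operator `symf`: it keeps the diagonal blocks other than the last one and symmetrizes
everything else. -/
noncomputable def symf (dhat : Fin q → ℕ) (A : Matrix (Fin d) (Fin d) 𝕜) :
    Matrix (Fin d) (Fin d) 𝕜 :=
  fun a b => if blk dhat a = blk dhat b ∧ blk dhat a < q then A a b
    else (1 / 2 : ℝ) • (A a b + Aᴴ a b)

variable (𝕜 d) in
/-- The group of matrices `diag(U₁, …, U_q, I)` with each `U_i` orthogonal (unitary). -/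
def blockGroup (dhat : Fin q → ℕ) : Set (Matrix (Fin d) (Fin d) 𝕜) :=
  {U | Uᴴ * U = 1 ∧ (∀ a b, blk dhat a ≠ blk dhat b → U a b = 0) ∧
    ∀ a b, blk dhat a = q → blk dhat b = q → U a b = if a = b then 1 else 0}

theorem one_mem_blockGroup (dhat : Fin q → ℕ) : (1 : Matrix (Fin d) (Fin d) 𝕜) ∈
    blockGroup 𝕜 d dhat := by
  refine ⟨by simp, fun a b h => ?_, fun a b _ _ => Matrix.one_apply⟩
  rw [Matrix.one_apply_ne]
  rintro rfl
  exact h rfl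

theorem mul_mem_blockGroup (dhat : Fin q → ℕ) {U V : Matrix (Fin d) (Fin d) 𝕜}
    (hU : U ∈ blockGroup 𝕜 d dhat) (hV : V ∈ blockGroup 𝕜 d dhat) :
    U * V ∈ blockGroup 𝕜 d dhat := by
  obtain ⟨u1, u2, u3⟩ := hU
  obtain ⟨v1, v2, v3⟩ := hV
  refine ⟨?_, fun a b h => ?_, fun a b ha hb => ?_⟩
  · rw [Matrix.conjTranspose_mul, Matrix.mul_assoc, ← Matrix.mul_assoc Uᴴ, u1, Matrix.one_mul, v1]
  · rw [Matrix.mul_apply]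
    refine Finset.sum_eq_zero fun c _ => ?_
    by_cases hc : blk dhat a = blk dhat c
    · rw [v2 c b (by rw [← hc]; exact h), mul_zero]
    · rw [u2 a c hc, zero_mul]
  · rw [Matrix.mul_apply, Finset.sum_eq_single a]
    · rw [u3 a a ha ha, v3 a b ha hb]; simp
    · intro c _ hca
      by_cases hc : blk dhat c = q
      · rw [u3 a c ha hc, if_neg (Ne.symm hca), zero_mul]
      · rw [u2 a c (by rw [ha]; exact Ne.symm hc), zero_mul]
    · simp

theorem conjTranspose_mem_blockGroup (dhat : Fin q → ℕ) {U : Matrix (Fin d) (Fin d) 𝕜}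
    (hU : U ∈ blockGroup 𝕜 d dhat) : Uᴴ ∈ blockGroup 𝕜 d dhat := by
  obtain ⟨u1, u2, u3⟩ := hU
  refine ⟨?_, fun a b h => ?_, fun a b ha hb => ?_⟩
  · rw [Matrix.conjTranspose_conjTranspose]; exact mul_eq_one_comm.mp u1
  · rw [Matrix.conjTranspose_apply, u2 b a (Ne.symm h), star_zero]
  · rw [Matrix.conjTranspose_apply, u3 b a hb ha]
    by_cases h : a = b
    · subst h; simp
    · rw [if_neg h, if_neg (Ne.symm h), star_zero]

variable (𝕜 n d) in
/-- Two points of the Stiefel manifold are equivalent if they lie in the same orbit of the group,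
acting by right multiplication. -/
def orbitRel (dhat : Fin q → ℕ) : Setoid (stiefel 𝕜 n d) where
  r Y Z := ∃ U ∈ blockGroup 𝕜 d dhat,
    (Z : Matrix (Fin n) (Fin d) 𝕜) = (Y : Matrix (Fin n) (Fin d) 𝕜) * U
  iseqv := by
    refine ⟨fun Y => ⟨1, one_mem_blockGroup dhat, by simp⟩, ?_, ?_⟩
    · rintro Y Z ⟨U, hU, h⟩
      refine ⟨Uᴴ, conjTranspose_mem_blockGroup dhat hU, ?_⟩
      rw [h, Matrix.mul_assoc, mul_eq_one_comm.mp hU.1, Matrix.mul_one]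
    · rintro Y Z W ⟨U, hU, h⟩ ⟨V, hV, h2⟩
      exact ⟨U * V, mul_mem_blockGroup dhat hU hV, by rw [h2, h, Matrix.mul_assoc]⟩

/-! ## Vertical and horizontal spaces, lifts, and horizontal gradients -/

/-- The vertical space: the tangent space at `Y` of the orbit of `Y`. -/
def verticalSpace (dhat : Fin q → ℕ) (Y : Matrix (Fin n) (Fin d) 𝕜) :
    Set (Matrix (Fin n) (Fin d) 𝕜) :=
  tangentVectors {Z | ∃ U ∈ blockGroup 𝕜 d dhat, Z = Y * U} Y

/-- The horizontal space: the tangent vectors orthogonal to the vertical space. -/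
def horizontalSpace (α₀ α₁ : ℝ) (dhat : Fin q → ℕ) (Y : Matrix (Fin n) (Fin d) 𝕜) :
    Set (Matrix (Fin n) (Fin d) 𝕜) :=
  {ω | ω ∈ tangentVectors (stiefel 𝕜 n d) Y ∧
    ∀ v ∈ verticalSpace dhat Y, stMetric α₀ α₁ Y ω v = 0}

/-- `p` is the orthogonal projection of `ω` to the horizontal space at `Y`, for the inner product
on the whole ambient space given by the metric operator at `Y`. -/
def IsHorizProj (α₀ α₁ : ℝ) (dhat : Fin q → ℕ) (Y ω p : Matrix (Fin n) (Fin d) 𝕜) : Prop :=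
  p ∈ horizontalSpace α₀ α₁ dhat Y ∧
    ∀ w ∈ horizontalSpace α₀ α₁ dhat Y, stMetric α₀ α₁ Y p w = stMetric α₀ α₁ Y ω w

/-- The orthogonal projection of `ω` to the horizontal space at `Y`. -/
noncomputable def horizProj (α₀ α₁ : ℝ) (dhat : Fin q → ℕ) (Y ω : Matrix (Fin n) (Fin d) 𝕜) :
    Matrix (Fin n) (Fin d) 𝕜 :=
  Classical.epsilon (IsHorizProj α₀ α₁ dhat Y ω)

/-- A vector field with values in the horizontal spaces. -/
def IsHorizontal (α₀ α₁ : ℝ) (dhat : Fin q → ℕ) (ξ : VField (stiefel 𝕜 n d)) : Prop :=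
  ∀ Y : stiefel 𝕜 n d, ξ Y ∈ horizontalSpace α₀ α₁ dhat (Y : Matrix (Fin n) (Fin d) 𝕜)

/-- `R` is the horizontal Riemannian gradient of `f`: it is horizontal, and its inner product with
a horizontal field is the derivative of `f` along that field. -/
def IsHorizGradient (α₀ α₁ : ℝ) (dhat : Fin q → ℕ) (f : stiefel 𝕜 n d → ℝ)
    (R : VField (stiefel 𝕜 n d)) : Prop :=
  IsHorizontal α₀ α₁ dhat R ∧
    ∀ ξ : VField (stiefel 𝕜 n d), IsHorizontal α₀ α₁ dhat ξ →
      ∀ Y : stiefel 𝕜 n d, stMetric α₀ α₁ (Y : Matrix (Fin n) (Fin d) 𝕜) (R Y) (ξ Y)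
        = dirDeriv f Y (ξ Y)

/-- `ξ` is the horizontal lift of the vector field `X` on the quotient. -/
def IsHorizLift (α₀ α₁ : ℝ) (dhat : Fin q → ℕ) (X : QVField (orbitRel 𝕜 n d dhat))
    (ξ : VField (stiefel 𝕜 n d)) : Prop :=
  IsHorizontal α₀ α₁ dhat ξ ∧
    ∀ (f : QFun (orbitRel 𝕜 n d dhat)) (Y : stiefel 𝕜 n d),
      dirDeriv f.pullback Y (ξ Y) = X f (Quotient.mk _ Y)

/-- `h` is the quotient metric, for which the horizontal lift is isometric. -/
def IsQuotientMetric (α₀ α₁ : ℝ) (dhat : Fin q → ℕ)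
    (h : QVField (orbitRel 𝕜 n d dhat) → QVField (orbitRel 𝕜 n d dhat) →
      QFun (orbitRel 𝕜 n d dhat)) : Prop :=
  ∀ (X Z : QVField (orbitRel 𝕜 n d dhat)) (ξ ζ : VField (stiefel 𝕜 n d)),
    IsHorizLift α₀ α₁ dhat X ξ → IsHorizLift α₀ α₁ dhat Z ζ →
      ∀ Y : stiefel 𝕜 n d, h X Z (Quotient.mk _ Y)
        = stMetric α₀ α₁ (Y : Matrix (Fin n) (Fin d) 𝕜) (ξ Y) (ζ Y)

end Stiefel

/-! ## Calculus on embedded submanifolds -/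

section EmbeddedCalculus

variable {E : Type*} [NormedAddCommGroup E] [NormedSpace ℝ E]
variable {F : Type*} [NormedAddCommGroup F] [NormedSpace ℝ F]
variable {G : Type*} [NormedAddCommGroup G] [NormedSpace ℝ G]
variable {H : Type*} [NormedAddCommGroup H] [NormedSpace ℝ H]
variable {M : Set E}

/-! Once derivatives are under control the theorem is matrix algebra. On vectors tangent to `M` the
chain rule along curves forces the value of `dirDeriv`, so the usual rules hold there and any
identity valid on `M` may be differentiated.

For the real trace form, `symf` is a self-adjoint idempotent (`frobInner_symf`, `symf_symf`). Its
range is spanned by the Hermitian matrices and the skew ones supported on the first `q` diagonal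
blocks; its kernel consists of the skew matrices vanishing on those blocks. Tangent vectors `v` at
`Y` are those with `Yᴴ * v` skew, and vertical ones are `Y * A` with `A` skew and fixed by `symf`.
The metric pairs `ω` with `Y * A` to `α₁` times the trace pairing of `Yᴴ * ω` with `A`. Hence
horizontality means `symf dhat (Yᴴ * ω) = 0`, and subtracting `Y * symf dhat (Yᴴ * ω)` is the
orthogonal projection. The gradient formula follows because the inverse metric operator turns the
trace form into the metric, while projecting does not change pairings with horizontal vectors.

The Levi-Civita connection is the flat derivative plus `lcChristoffel`, which is symmetric and whose
pairings make up for the variation of the metric with `Y` (`stMetric_lcChristoffel_add`). Uniqueness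
is the Koszul argument: the difference of two such connections is symmetric in two slots and skew in
two. Differentiating the horizontality of `η` computes the horizontal part (`horizProj_lcConn`). The
Hessian form comes from differentiating the pairing of the gradient with `η`, which equals that of
the ambient gradient; the operator form then comes from taking adjoints.

For the quotient, the decisive fact is `horizontal_eq_sum`: a horizontal vector can be recovered
from the derivatives of the invariant maps `Z * P_k * Zᴴ`, `k < q`, and `Z * P_q`, where `P_k` is
the projection on block `k`. It gives uniqueness, equivariance and smoothness of horizontal lifts.
Conversely equivariant fields descend, and so does the horizontal part of the connection.
Antisymmetrizing it yields the bracket plus a vertical vector, which invariant functions do not see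
(`horizConn_torsion`), so the descended connection is torsion-free. -/

theorem IsCkOn.mono {k l : ℕ∞} {φ : M → F} (h : IsCkOn k φ) (hl : l ≤ k) : IsCkOn l φ := by
  obtain ⟨U, Φ, hU, hM, hΦ, he⟩ := h
  exact ⟨U, Φ, hU, hM, hΦ.of_le (by exact_mod_cast hl), he⟩

theorem IsCkOn.congr {k : ℕ∞} {φ ψ : M → F} (h : IsCkOn k φ) (he : ∀ Y, ψ Y = φ Y) :
    IsCkOn k ψ := by
  rw [funext he]; exact h

theorem isCkOn_const (k : ℕ∞) (c : F) : IsCkOn k (fun _ : M => c) :=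
  ⟨Set.univ, fun _ => c, isOpen_univ, Set.subset_univ _, contDiffOn_const, fun _ => rfl⟩

theorem isCkOn_val (k : ℕ∞) : IsCkOn k (fun Y : M => (Y : E)) :=
  ⟨Set.univ, id, isOpen_univ, Set.subset_univ _, contDiffOn_id, fun _ => rfl⟩

theorem IsCkOn.clm {k : ℕ∞} {φ : M → F} (h : IsCkOn k φ) (L : F →L[ℝ] G) :
    IsCkOn k (fun Y => L (φ Y)) := by
  obtain ⟨U, Φ, hU, hM, hΦ, he⟩ := h
  exact ⟨U, fun x => L (Φ x), hU, hM, L.contDiff.comp_contDiffOn hΦ, fun Y => by simp only [he]⟩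

theorem IsCkOn.bilin {k : ℕ∞} {φ : M → F} {ψ : M → G} (h : IsCkOn k φ) (h' : IsCkOn k ψ)
    (B : F →L[ℝ] G →L[ℝ] H) : IsCkOn k (fun Y => B (φ Y) (ψ Y)) := by
  obtain ⟨U, Φ, hU, hM, hΦ, he⟩ := h
  obtain ⟨V, Ψ, hV, hM', hΨ, he'⟩ := h'
  refine ⟨U ∩ V, fun x => B (Φ x) (Ψ x), hU.inter hV, Set.subset_inter hM hM', ?_,
    fun Y => by simp only [he, he']⟩
  exact B.isBoundedBilinearMap.contDiff.comp_contDiffOn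
    ((hΦ.mono Set.inter_subset_left).prodMk (hΨ.mono Set.inter_subset_right))

theorem IsCkOn.add {k : ℕ∞} {φ ψ : M → F} (h : IsCkOn k φ) (h' : IsCkOn k ψ) :
    IsCkOn k (fun Y => φ Y + ψ Y) := by
  obtain ⟨U, Φ, hU, hM, hΦ, he⟩ := h
  obtain ⟨V, Ψ, hV, hM', hΨ, he'⟩ := h'
  exact ⟨U ∩ V, fun x => Φ x + Ψ x, hU.inter hV, Set.subset_inter hM hM',
    (hΦ.mono Set.inter_subset_left).add (hΨ.mono Set.inter_subset_right),
    fun Y => by simp only [he, he']⟩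

theorem IsCkOn.const_smul {k : ℕ∞} {φ : M → F} (h : IsCkOn k φ) (c : ℝ) :
    IsCkOn k (fun Y => c • φ Y) :=
  h.clm (c • ContinuousLinearMap.id ℝ F)

theorem IsCkOn.sub {k : ℕ∞} {φ ψ : M → F} (h : IsCkOn k φ) (h' : IsCkOn k ψ) :
    IsCkOn k (fun Y => φ Y - ψ Y) :=
  (h.add (h'.const_smul (-1))).congr fun Y => by simp [sub_eq_add_neg]

theorem IsCkOn.smul {k : ℕ∞} {φ : M → ℝ} {ψ : M → F} (h : IsCkOn k φ) (h' : IsCkOn k ψ) :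
    IsCkOn k (fun Y => φ Y • ψ Y) :=
  h.bilin h' (ContinuousLinearMap.lsmul ℝ ℝ)

theorem IsCkOn.sum {ι : Type*} {k : ℕ∞} {φ : ι → M → F} (s : Finset ι)
    (h : ∀ i, IsCkOn k (φ i)) : IsCkOn k (fun Y => ∑ i ∈ s, φ i Y) := by
  classical
  induction s using Finset.induction_on with
  | empty => simpa using isCkOn_const k (0 : F)
  | insert a s ha ih =>
    refine ((h a).add ih).congr fun Y => ?_
    rw [Finset.sum_insert ha]

/-- The directional derivative is the derivative along any smooth curve. -/
theorem IsCkOn.hasDerivAt_curve {φ : M → F} (h : IsCkOn 1 φ) {γ : ℝ → E}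
    (hγ : ContDiff ℝ (⊤ : ℕ∞) γ) (hM : ∀ t, γ t ∈ M) (Y : M) (hY : γ 0 = Y) :
    HasDerivAt (fun t => φ ⟨γ t, hM t⟩) (dirDeriv φ Y (deriv γ 0)) 0 := by
  obtain ⟨U, Φ, hU, hMU, hΦ, he⟩ := h
  have hext : ∀ Z (hZ : Z ∈ M), Function.extend Subtype.val φ 0 Z = φ ⟨Z, hZ⟩ := fun Z hZ =>
    Subtype.val_injective.extend_apply φ 0 ⟨Z, hZ⟩
  -- On `M` the extension by zero agrees with `Φ`, so a derivative within `M` exists. It need not be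
  -- unique, but whichever one `fderivWithin` selects must obey the chain rule along `γ`.
  have hdiff : DifferentiableWithinAt ℝ (Function.extend Subtype.val φ 0) M (Y : E) := by
    have h1 : DifferentiableAt ℝ Φ Y :=
      ((hΦ.contDiffAt (hU.mem_nhds (hMU Y.2))).differentiableAt (by simp))
    refine h1.differentiableWithinAt.congr (fun Z hZ => ?_) ?_
    · rw [hext Z hZ, he]
    · rw [hext Y Y.2, he]
  have h2 := hdiff.hasFDerivWithinAt
  rw [← hY] at h2
  have h3 : HasDerivAt γ (deriv γ 0) 0 :=
    (hγ.differentiable (by simp)).differentiableAt.hasDerivAt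
  have h4 := h2.comp_hasDerivAt (0 : ℝ) h3 (Filter.Eventually.of_forall hM)
  have h5 : (Function.extend Subtype.val φ 0) ∘ γ = fun t => φ ⟨γ t, hM t⟩ :=
    funext fun t => hext _ (hM t)
  rw [h5, hY] at h4
  exact h4

/-- Both sides are the derivative of `φ` along a curve with velocity `v`. This trades the intrinsic
derivative for that of an ambient extension, to which smoothness and second-order results apply. -/
theorem IsCkOn.dirDeriv_eq_fderiv {φ : M → F} {U : Set E} {Φ : E → F} (hU : IsOpen U)
    (hMU : M ⊆ U) (hΦ : ContDiffOn ℝ 1 Φ U) (he : ∀ Y : M, φ Y = Φ Y) (Y : M) {v : E}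
    (hv : v ∈ tangentVectors M (Y : E)) : dirDeriv φ Y v = fderiv ℝ Φ Y v := by
  obtain ⟨γ, hγ, hM, hY, rfl⟩ := hv
  have h1 := IsCkOn.hasDerivAt_curve ⟨U, Φ, hU, hMU, by simpa using hΦ, he⟩ hγ hM Y hY
  have h2 : HasFDerivAt Φ (fderiv ℝ Φ Y) (γ 0) := by
    rw [hY]
    exact ((hΦ.contDiffAt (hU.mem_nhds (hMU Y.2))).differentiableAt (by simp)).hasFDerivAt
  have h3 : HasDerivAt γ (deriv γ 0) 0 :=
    (hγ.differentiable (by simp)).differentiableAt.hasDerivAt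
  have h4 := h2.comp_hasDerivAt (0 : ℝ) h3
  refine (h1.congr_deriv ?_ |>.unique ?_ : _) <;> try rfl
  refine h4.congr_of_eventuallyEq (Filter.Eventually.of_forall fun t => ?_)
  simp [he]

/-! ### Linearity, product and chain rules for directional derivatives -/

theorem dirDeriv_add (φ : M → F) (Y : M) (v w : E) :
    dirDeriv φ Y (v + w) = dirDeriv φ Y v + dirDeriv φ Y w := by simp [dirDeriv]

theorem dirDeriv_sub (φ : M → F) (Y : M) (v w : E) :
    dirDeriv φ Y (v - w) = dirDeriv φ Y v - dirDeriv φ Y w := by simp [dirDeriv]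

theorem dirDeriv_smul (φ : M → F) (Y : M) (c : ℝ) (v : E) :
    dirDeriv φ Y (c • v) = c • dirDeriv φ Y v := by simp [dirDeriv]

theorem dirDeriv_const (c : F) (Y : M) {v : E} (hv : v ∈ tangentVectors M (Y : E)) :
    dirDeriv (fun _ : M => c) Y v = 0 := by
  obtain ⟨γ, hγ, hM, hY, rfl⟩ := hv
  exact ((isCkOn_const 1 c).hasDerivAt_curve hγ hM Y hY).unique (hasDerivAt_const _ _)

theorem dirDeriv_val (Y : M) {v : E} (hv : v ∈ tangentVectors M (Y : E)) :
    dirDeriv (fun Z : M => (Z : E)) Y v = v := by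
  obtain ⟨γ, hγ, hM, hY, rfl⟩ := hv
  exact ((isCkOn_val 1).hasDerivAt_curve hγ hM Y hY).unique
    (hγ.differentiable (by simp)).differentiableAt.hasDerivAt

theorem dirDeriv_clm {φ : M → F} (h : IsCkOn 1 φ) (L : F →L[ℝ] G) (Y : M) {v : E}
    (hv : v ∈ tangentVectors M (Y : E)) :
    dirDeriv (fun Z => L (φ Z)) Y v = L (dirDeriv φ Y v) := by
  obtain ⟨γ, hγ, hM, hY, rfl⟩ := hv
  exact ((h.clm L).hasDerivAt_curve hγ hM Y hY).unique
    (L.hasFDerivAt.comp_hasDerivAt (0 : ℝ) (h.hasDerivAt_curve hγ hM Y hY))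

theorem dirDeriv_bilin {φ : M → F} {ψ : M → G} (h : IsCkOn 1 φ) (h' : IsCkOn 1 ψ)
    (B : F →L[ℝ] G →L[ℝ] H) (Y : M) {v : E} (hv : v ∈ tangentVectors M (Y : E)) :
    dirDeriv (fun Z => B (φ Z) (ψ Z)) Y v
      = B (dirDeriv φ Y v) (ψ Y) + B (φ Y) (dirDeriv ψ Y v) := by
  obtain ⟨γ, hγ, hM, hY, rfl⟩ := hv
  have h1 := h.hasDerivAt_curve hγ hM Y hY
  have h2 := h'.hasDerivAt_curve hγ hM Y hY
  have h3 := (B.hasFDerivAt.comp_hasDerivAt (0 : ℝ) h1).clm_apply h2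
  have hY' : (⟨γ 0, hM 0⟩ : M) = Y := Subtype.ext hY
  simp only [Function.comp, hY'] at h3
  exact ((h.bilin h' B).hasDerivAt_curve hγ hM Y hY).unique h3

theorem dirDeriv_fun_add {φ ψ : M → F} (h : IsCkOn 1 φ) (h' : IsCkOn 1 ψ) (Y : M) {v : E}
    (hv : v ∈ tangentVectors M (Y : E)) :
    dirDeriv (fun Z => φ Z + ψ Z) Y v = dirDeriv φ Y v + dirDeriv ψ Y v := by
  obtain ⟨γ, hγ, hM, hY, rfl⟩ := hv
  exact ((h.add h').hasDerivAt_curve hγ hM Y hY).unique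
    ((h.hasDerivAt_curve hγ hM Y hY).add (h'.hasDerivAt_curve hγ hM Y hY))

theorem dirDeriv_fun_smul {φ : M → ℝ} {ψ : M → F} (h : IsCkOn 1 φ) (h' : IsCkOn 1 ψ) (Y : M)
    {v : E} (hv : v ∈ tangentVectors M (Y : E)) :
    dirDeriv (fun Z => φ Z • ψ Z) Y v
      = dirDeriv φ Y v • ψ Y + φ Y • dirDeriv ψ Y v :=
  dirDeriv_bilin h h' (ContinuousLinearMap.lsmul ℝ ℝ) Y hv

theorem dirDeriv_congr {φ ψ : M → F} (h : ∀ Y, φ Y = ψ Y) (Y : M) (v : E) :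
    dirDeriv φ Y v = dirDeriv ψ Y v := by rw [funext h]

theorem IsCkOn.dirDeriv {φ : M → F} (h : IsCkOn ⊤ φ) {ξ : M → E} (hξ : IsCkOn ⊤ ξ)
    (ht : ∀ Y : M, ξ Y ∈ tangentVectors M (Y : E)) :
    IsCkOn ⊤ (fun Y => dirDeriv φ Y (ξ Y)) := by
  obtain ⟨U, Φ, hU, hM, hΦ, he⟩ := h
  have h1 : IsCkOn ⊤ (fun Y : M => fderiv ℝ Φ Y) :=
    ⟨U, fderiv ℝ Φ, hU, hM, hΦ.fderiv_of_isOpen hU (by simp), fun _ => rfl⟩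
  refine (h1.bilin hξ (ContinuousLinearMap.id ℝ (E →L[ℝ] F))).congr fun Y => ?_
  exact IsCkOn.dirDeriv_eq_fderiv hU hM (hΦ.of_le (by simp)) he Y (ht Y)

/-- Second derivatives commute up to the bracket. -/
theorem dirDeriv_comm {φ : M → F} (h : IsCkOn ⊤ φ) (ξ η : VField M) (Y : M)
    (hb : dirDeriv η Y (ξ Y) - dirDeriv ξ Y (η Y) ∈ tangentVectors M (Y : E)) :
    dirDeriv (fun Z => dirDeriv φ Z (η Z)) Y (ξ Y) - dirDeriv (fun Z => dirDeriv φ Z (ξ Z)) Y (η Y)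
      = dirDeriv φ Y (dirDeriv η Y (ξ Y) - dirDeriv ξ Y (η Y)) := by
  obtain ⟨U, Φ, hU, hM, hΦ, he⟩ := h
  have hd : ∀ (Z : M) {v : E}, v ∈ tangentVectors M (Z : E) → dirDeriv φ Z v = fderiv ℝ Φ Z v :=
    fun Z v hv => IsCkOn.dirDeriv_eq_fderiv hU hM (hΦ.of_le (by simp)) he Z hv
  have hc : ContDiffOn ℝ (⊤ : ℕ∞) (fderiv ℝ Φ) U := hΦ.fderiv_of_isOpen hU (by simp)
  have h1 : IsCkOn ⊤ (fun Y : M => fderiv ℝ Φ Y) := ⟨U, fderiv ℝ Φ, hU, hM, hc, fun _ => rfl⟩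
  -- By the product rule the iterated derivative is a Hessian term of the extension plus a
  -- first-order term. The Hessian terms cancel by symmetry of second derivatives; tangency of the
  -- bracket lets the remainder be read as a `dirDeriv`.
  have key : ∀ (ξ η : VField M), dirDeriv (fun Z => dirDeriv φ Z (η Z)) Y (ξ Y)
      = fderiv ℝ (fderiv ℝ Φ) Y (ξ Y) (η Y) + fderiv ℝ Φ Y (dirDeriv η Y (ξ Y)) := by
    intro ξ η
    rw [dirDeriv_congr (fun Z => hd Z (η.tangent Z))]
    refine (dirDeriv_bilin (h1.mono le_top) (η.smooth.mono le_top)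
        (ContinuousLinearMap.id ℝ (E →L[ℝ] F)) Y (ξ.tangent Y)).trans ?_
    rw [IsCkOn.dirDeriv_eq_fderiv hU hM (hc.of_le (by simp)) (fun _ => rfl) Y (ξ.tangent Y)]
    rfl
  have hsym : IsSymmSndFDerivAt ℝ Φ (Y : E) :=
    (hΦ.contDiffAt (hU.mem_nhds (hM Y.2))).isSymmSndFDerivAt
      (by simpa using WithTop.coe_le_coe.2 (le_top : (2 : ℕ∞) ≤ ⊤))
  rw [key, key, hd Y hb, map_sub, hsym (ξ Y) (η Y)]
  abel

/-- A map to a finite-dimensional space is smooth if its coordinates are. -/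
theorem isCkOn_of_dual [FiniteDimensional ℝ F] {k : ℕ∞} {φ : M → F}
    (h : ∀ L : F →L[ℝ] ℝ, IsCkOn k (fun Y => L (φ Y))) : IsCkOn k φ := by
  let b := Module.finBasis ℝ F
  refine (IsCkOn.sum Finset.univ fun i =>
    (h (LinearMap.toContinuousLinearMap (b.coord i))).smul (isCkOn_const k (b i))).congr fun Y => ?_
  simp [b.sum_repr (φ Y)]

theorem tangentVectors_image {N : Set F} (L : E →L[ℝ] F) (hL : ∀ Z ∈ M, L Z ∈ N) {Y v : E}
    (hv : v ∈ tangentVectors M Y) : L v ∈ tangentVectors N (L Y) := by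
  obtain ⟨γ, hγ, hM, hY, rfl⟩ := hv
  refine ⟨fun t => L (γ t), L.contDiff.comp hγ, fun t => hL _ (hM t), congrArg L hY, ?_⟩
  exact (L.hasFDerivAt.comp_hasDerivAt (0 : ℝ)
    (hγ.differentiable (by simp)).differentiableAt.hasDerivAt).deriv

theorem tangentVectors_mono {N : Set E} (h : N ⊆ M) (Y : E) :
    tangentVectors N Y ⊆ tangentVectors M Y := by
  rintro v ⟨γ, hγ, hM, hY, hv⟩
  exact ⟨γ, hγ, fun t => h (hM t), hY, hv⟩

theorem IsCkOn.comp_map {k : ℕ∞} {φ : M → F} (h : IsCkOn k φ) (L : E →L[ℝ] E)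
    (hL : ∀ Z ∈ M, L Z ∈ M) : IsCkOn k (fun Y : M => φ ⟨L Y, hL Y Y.2⟩) := by
  obtain ⟨U, Φ, hU, hM, hΦ, he⟩ := h
  exact ⟨L ⁻¹' U, fun x => Φ (L x), hU.preimage L.continuous, fun Z hZ => hM (hL Z hZ),
    hΦ.comp L.contDiff.contDiffOn fun _ hx => hx, fun Y => he _⟩

/-- Chain rule for a linear map preserving `M`: `L` carries curves in `M` to curves in `M`. It is
used for right multiplication by a group element. -/
theorem dirDeriv_comp_map {φ : M → F} (h : IsCkOn 1 φ) (L : E →L[ℝ] E)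
    (hL : ∀ Z ∈ M, L Z ∈ M) (Y : M) {v : E} (hv : v ∈ tangentVectors M (Y : E)) :
    dirDeriv (fun Z : M => φ ⟨L Z, hL Z Z.2⟩) Y v = dirDeriv φ ⟨L Y, hL Y Y.2⟩ (L v) := by
  obtain ⟨γ, hγ, hM, hY, rfl⟩ := hv
  have h1 := (h.comp_map L hL).hasDerivAt_curve hγ hM Y hY
  have h2 := h.hasDerivAt_curve (γ := fun t => L (γ t)) (L.contDiff.comp hγ)
    (fun t => hL _ (hM t)) ⟨L Y, hL Y Y.2⟩ (congrArg L hY)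
  have h3 : deriv (fun t => L (γ t)) 0 = L (deriv γ 0) :=
    (L.hasFDerivAt.comp_hasDerivAt (0 : ℝ)
      (hγ.differentiable (by simp)).differentiableAt.hasDerivAt).deriv
  rw [h3] at h2
  exact h1.unique h2

end EmbeddedCalculus

/-! ## Matrix algebra -/

section MatrixTools

/-- Continuous real linear maps, for the topologies given by the norms. -/
abbrev NormedCLM (E F : Type*) [NormedAddCommGroup E] [NormedSpace ℝ E] [NormedAddCommGroup F]
    [NormedSpace ℝ F] := E →L[ℝ] F

variable {𝕜 : Type*} [RCLike 𝕜] {n d m p q : ℕ}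

instance : FiniteDimensional ℝ (Matrix (Fin n) (Fin d) 𝕜) :=
  Module.Finite.matrix

variable (𝕜 n d p) in
/-- Matrix multiplication as a continuous real bilinear map. -/
noncomputable def mulL : NormedCLM (Matrix (Fin n) (Fin d) 𝕜)
    (NormedCLM (Matrix (Fin d) (Fin p) 𝕜) (Matrix (Fin n) (Fin p) 𝕜)) :=
  LinearMap.toContinuousBilinearMap (LinearMap.mk₂ ℝ (fun A B => A * B)
    (fun _ _ _ => Matrix.add_mul _ _ _) (fun _ _ _ => Matrix.smul_mul _ _ _)
    (fun _ _ _ => Matrix.mul_add _ _ _) (fun _ _ _ => Matrix.mul_smul _ _ _))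

@[simp] theorem mulL_apply (A : Matrix (Fin n) (Fin d) 𝕜) (B : Matrix (Fin d) (Fin p) 𝕜) :
    mulL 𝕜 n d p A B = A * B := rfl

variable (𝕜 n d) in
/-- Conjugate transposition as a continuous real linear map. -/
noncomputable def conjTransposeL :
    NormedCLM (Matrix (Fin n) (Fin d) 𝕜) (Matrix (Fin d) (Fin n) 𝕜) :=
  LinearMap.toContinuousLinearMap
    { toFun := fun A => Aᴴ
      map_add' := fun _ _ => Matrix.conjTranspose_add _ _
      map_smul' := fun c A => by rw [Matrix.conjTranspose_smul]; simp }

@[simp] theorem conjTranspose_real_smul (c : ℝ) (A : Matrix (Fin n) (Fin d) 𝕜) :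
    (c • A)ᴴ = c • Aᴴ := by rw [Matrix.conjTranspose_smul]; simp

/-! ### The real trace inner product -/

theorem trR_add (A B : Matrix (Fin d) (Fin d) 𝕜) : trR (A + B) = trR A + trR B := by
  simp [trR, Matrix.trace_add]

theorem trR_smul (c : ℝ) (A : Matrix (Fin d) (Fin d) 𝕜) : trR (c • A) = c * trR A := by
  simp [trR, Matrix.trace_smul, RCLike.smul_re]

theorem trR_mul_comm (A : Matrix (Fin n) (Fin d) 𝕜) (B : Matrix (Fin d) (Fin n) 𝕜) :
    trR (A * B) = trR (B * A) := by simp [trR, Matrix.trace_mul_comm A B]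

theorem trR_conjTranspose (A : Matrix (Fin d) (Fin d) 𝕜) : trR Aᴴ = trR A := by
  simp [trR, Matrix.trace_conjTranspose]

variable (𝕜 n d) in
/-- The real trace inner product as a continuous bilinear map. -/
noncomputable def frobL : NormedCLM (Matrix (Fin n) (Fin d) 𝕜)
    (NormedCLM (Matrix (Fin n) (Fin d) 𝕜) ℝ) :=
  LinearMap.toContinuousBilinearMap (LinearMap.mk₂ ℝ (fun A B => frobInner A B)
    (fun _ _ _ => by simp only [frobInner, Matrix.add_mul, trR_add])
    (fun _ _ _ => by simp only [frobInner, Matrix.smul_mul, trR_smul, smul_eq_mul])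
    (fun _ _ _ => by simp only [frobInner, Matrix.conjTranspose_add, Matrix.mul_add, trR_add])
    (fun _ _ _ => by
      simp only [frobInner, conjTranspose_real_smul, Matrix.mul_smul, trR_smul, smul_eq_mul]))

theorem frobL_apply (A B : Matrix (Fin n) (Fin d) 𝕜) : frobL 𝕜 n d A B = frobInner A B := rfl

theorem frobInner_comm (A B : Matrix (Fin n) (Fin d) 𝕜) : frobInner A B = frobInner B A := by
  rw [frobInner, frobInner, ← trR_conjTranspose, Matrix.conjTranspose_mul,
    Matrix.conjTranspose_conjTranspose]

theorem frobInner_conjTranspose (A B : Matrix (Fin n) (Fin d) 𝕜) :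
    frobInner Aᴴ Bᴴ = frobInner A B := by
  rw [frobInner_comm A B, frobInner, frobInner, Matrix.conjTranspose_conjTranspose, trR_mul_comm]

theorem frobInner_mul_left (X : Matrix (Fin n) (Fin m) 𝕜) (A : Matrix (Fin m) (Fin d) 𝕜)
    (B : Matrix (Fin n) (Fin d) 𝕜) : frobInner (X * A) B = frobInner A (Xᴴ * B) := by
  rw [frobInner, frobInner, Matrix.mul_assoc, trR_mul_comm, Matrix.conjTranspose_mul,
    Matrix.conjTranspose_conjTranspose, Matrix.mul_assoc]

theorem frobInner_mul_right (A : Matrix (Fin n) (Fin m) 𝕜) (X : Matrix (Fin m) (Fin d) 𝕜)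
    (B : Matrix (Fin n) (Fin d) 𝕜) : frobInner (A * X) B = frobInner A (B * Xᴴ) := by
  rw [frobInner, frobInner, Matrix.conjTranspose_mul, Matrix.conjTranspose_conjTranspose,
    Matrix.mul_assoc]

theorem frobInner_add_left (A B C : Matrix (Fin n) (Fin d) 𝕜) :
    frobInner (A + B) C = frobInner A C + frobInner B C := by simp [← frobL_apply]

theorem frobInner_add_right (A B C : Matrix (Fin n) (Fin d) 𝕜) :
    frobInner A (B + C) = frobInner A B + frobInner A C := by simp [← frobL_apply]

theorem frobInner_sub_left (A B C : Matrix (Fin n) (Fin d) 𝕜) :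
    frobInner (A - B) C = frobInner A C - frobInner B C := by simp [← frobL_apply]

theorem frobInner_sub_right (A B C : Matrix (Fin n) (Fin d) 𝕜) :
    frobInner A (B - C) = frobInner A B - frobInner A C := by simp [← frobL_apply]

theorem frobInner_smul_left (c : ℝ) (A C : Matrix (Fin n) (Fin d) 𝕜) :
    frobInner (c • A) C = c * frobInner A C := by simp [← frobL_apply]

theorem frobInner_smul_right (c : ℝ) (A C : Matrix (Fin n) (Fin d) 𝕜) :
    frobInner A (c • C) = c * frobInner A C := by simp [← frobL_apply]

theorem frobInner_neg_left (A C : Matrix (Fin n) (Fin d) 𝕜) :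
    frobInner (-A) C = -frobInner A C := by simp [← frobL_apply]

theorem frobInner_neg_right (A C : Matrix (Fin n) (Fin d) 𝕜) :
    frobInner A (-C) = -frobInner A C := by simp [← frobL_apply]

theorem frobInner_zero_left (C : Matrix (Fin n) (Fin d) 𝕜) : frobInner 0 C = 0 := by
  simp [← frobL_apply]

theorem frobInner_zero_right (C : Matrix (Fin n) (Fin d) 𝕜) : frobInner C 0 = 0 := by
  simp [← frobL_apply]

theorem frobInner_eq_sum (A B : Matrix (Fin n) (Fin d) 𝕜) :
    frobInner A B = ∑ a, ∑ b, RCLike.re (A a b * star (B a b)) := by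
  simp only [frobInner, trR, Matrix.trace, Matrix.diag_apply, Matrix.mul_apply,
    Matrix.conjTranspose_apply, map_sum]

theorem frobInner_self_nonneg (A : Matrix (Fin n) (Fin d) 𝕜) : 0 ≤ frobInner A A := by
  rw [frobInner_eq_sum]
  refine Finset.sum_nonneg fun a _ => Finset.sum_nonneg fun b _ => ?_
  rw [RCLike.star_def, RCLike.mul_conj]
  norm_cast
  positivity

theorem frobInner_self_eq_zero {A : Matrix (Fin n) (Fin d) 𝕜} (h : frobInner A A = 0) :
    A = 0 := by
  have h0 : ∀ a b, 0 ≤ RCLike.re (A a b * star (A a b)) := fun a b => by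
    rw [RCLike.star_def, RCLike.mul_conj]
    norm_cast
    positivity
  rw [frobInner_eq_sum, Finset.sum_eq_zero_iff_of_nonneg
    fun a _ => Finset.sum_nonneg fun b _ => h0 a b] at h
  ext a b
  have h1 := (Finset.sum_eq_zero_iff_of_nonneg fun b _ => h0 a b).1 (h a (Finset.mem_univ a)) b
    (Finset.mem_univ b)
  rw [RCLike.star_def, RCLike.mul_conj] at h1
  norm_cast at h1
  simpa using h1

theorem frobInner_eq_zero_of_herm_skew {A B : Matrix (Fin d) (Fin d) 𝕜} (hA : Aᴴ = A)
    (hB : Bᴴ = -B) : frobInner A B = 0 := by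
  have h := frobInner_conjTranspose A B
  rw [hA, hB, frobInner_neg_right] at h
  linarith

variable (𝕜 n d) in
/-- The representation of real functionals by the real trace inner product. -/
noncomputable def rieszL :
    NormedCLM (NormedCLM (Matrix (Fin n) (Fin d) 𝕜) ℝ) (Matrix (Fin n) (Fin d) 𝕜) :=
  LinearMap.toContinuousLinearMap
    -- Definiteness of the pairing makes the map to the dual injective, and equality of dimensions
    -- makes it bijective.
    ((LinearEquiv.ofInjectiveOfFinrankEq
      ((LinearMap.toContinuousLinearMap : _ ≃ₗ[ℝ] NormedCLM (Matrix (Fin n) (Fin d) 𝕜) ℝ).symm.toLinearMap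
        ∘ₗ (frobL 𝕜 n d).toLinearMap) (by
          rw [← LinearMap.ker_eq_bot, LinearMap.ker_eq_bot']
          intro A hA
          have := LinearMap.congr_fun hA A
          exact frobInner_self_eq_zero this) (Subspace.dual_finrank_eq).symm).symm.toLinearMap ∘ₗ
      (LinearMap.toContinuousLinearMap : _ ≃ₗ[ℝ] NormedCLM (Matrix (Fin n) (Fin d) 𝕜) ℝ).symm.toLinearMap)

theorem frobInner_rieszL (L : NormedCLM (Matrix (Fin n) (Fin d) 𝕜) ℝ) (v : Matrix (Fin n) (Fin d) 𝕜) :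
    frobInner v (rieszL 𝕜 n d L) = L v := by
  set e := (LinearMap.toContinuousLinearMap : _ ≃ₗ[ℝ] NormedCLM (Matrix (Fin n) (Fin d) 𝕜) ℝ)
  set f := LinearEquiv.ofInjectiveOfFinrankEq
      (e.symm.toLinearMap ∘ₗ (frobL 𝕜 n d).toLinearMap) (by
          rw [← LinearMap.ker_eq_bot, LinearMap.ker_eq_bot']
          intro A hA
          have := LinearMap.congr_fun hA A
          exact frobInner_self_eq_zero this) (Subspace.dual_finrank_eq).symm with hf
  have h1 : rieszL 𝕜 n d L = f.symm (e.symm L) := rfl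
  have h2 : f (f.symm (e.symm L)) = e.symm L := f.apply_symm_apply _
  rw [h1, frobInner_comm]
  exact LinearMap.congr_fun h2 v

/-! ### The operator `symf` -/

variable (dhat : Fin q → ℕ)

variable (𝕜 d) in
/-- The coordinate projection onto the block number `k`. -/
def blkProj (k : ℕ) : Matrix (Fin d) (Fin d) 𝕜 :=
  Matrix.diagonal fun a => if blk dhat a = k then 1 else 0

theorem blk_le (a : Fin d) : blk dhat a ≤ q := by
  simpa [blk] using Finset.card_filter_le (Finset.univ : Finset (Fin q)) _

theorem blkProj_conjTranspose (k : ℕ) : (blkProj 𝕜 d dhat k)ᴴ = blkProj 𝕜 d dhat k := by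
  rw [blkProj, Matrix.diagonal_conjTranspose]
  congr 1
  ext a
  by_cases h : blk dhat a = k <;> simp [h]

theorem blkProj_mul_self (k : ℕ) :
    blkProj 𝕜 d dhat k * blkProj 𝕜 d dhat k = blkProj 𝕜 d dhat k := by
  simp [blkProj, Matrix.diagonal_mul_diagonal]

theorem blkProj_mul_mul_apply (k : ℕ) (A : Matrix (Fin d) (Fin d) 𝕜) (a b : Fin d) :
    (blkProj 𝕜 d dhat k * A * blkProj 𝕜 d dhat k) a b
      = if blk dhat a = k ∧ blk dhat b = k then A a b else 0 := by
  rw [blkProj, Matrix.mul_diagonal, Matrix.diagonal_mul]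
  by_cases h : blk dhat a = k <;> by_cases h' : blk dhat b = k <;> simp [h, h']

theorem sum_blkProj :
    ∑ k ∈ Finset.range q, blkProj 𝕜 d dhat k + blkProj 𝕜 d dhat q = 1 := by
  rw [← Finset.sum_range_succ]
  ext a b
  rw [Matrix.sum_apply]
  have := blk_le dhat a
  by_cases h : a = b
  · subst h
    simp only [blkProj, Matrix.diagonal_apply_eq, Finset.sum_ite_eq, Finset.mem_range,
      Matrix.one_apply_eq]
    rw [if_pos (by omega)]
  · simp [blkProj, h]

/-- Split `A` into its Hermitian and skew parts: the first is kept whole, the second only on the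
diagonal blocks `k < q`. In this form self-adjointness and compatibility with conjugation by the
group can be checked term by term. -/
theorem symf_eq (A : Matrix (Fin d) (Fin d) 𝕜) :
    symf dhat A = (1 / 2 : ℝ) • (A + Aᴴ) + ∑ k ∈ Finset.range q,
      blkProj 𝕜 d dhat k * ((1 / 2 : ℝ) • (A - Aᴴ)) * blkProj 𝕜 d dhat k := by
  ext a b
  rw [Matrix.add_apply, Matrix.sum_apply]
  simp only [blkProj_mul_mul_apply, symf]
  by_cases h : blk dhat a = blk dhat b ∧ blk dhat a < q
  · rw [if_pos h, Finset.sum_eq_single (blk dhat a), if_pos ⟨rfl, h.1.symm⟩]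
    · simp only [Matrix.smul_apply, Matrix.add_apply, Matrix.sub_apply]
      module
    · intro k _ hk
      rw [if_neg fun hh => hk hh.1.symm]
    · intro hh
      exact absurd (Finset.mem_range.2 h.2) hh
  · rw [if_neg h, Finset.sum_eq_zero]
    · simp
    · intro k hk
      rw [if_neg]
      rintro ⟨h1, h2⟩
      exact h ⟨h1.trans h2.symm, h1 ▸ Finset.mem_range.1 hk⟩

variable (𝕜 d) in
/-- `symf` as a continuous real linear map. -/
noncomputable def symfL : NormedCLM (Matrix (Fin d) (Fin d) 𝕜) (Matrix (Fin d) (Fin d) 𝕜) :=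
  LinearMap.toContinuousLinearMap
    { toFun := symf dhat
      map_add' := fun A B => by
        ext a b
        simp only [symf, Matrix.add_apply, Matrix.conjTranspose_add]
        split_ifs
        · rfl
        · module
      map_smul' := fun c A => by
        ext a b
        simp only [symf, conjTranspose_real_smul, Matrix.smul_apply, RingHom.id_apply]
        split_ifs
        · rfl
        · module }

theorem symfL_apply (A : Matrix (Fin d) (Fin d) 𝕜) : symfL 𝕜 d dhat A = symf dhat A := rfl

theorem symf_add (A B : Matrix (Fin d) (Fin d) 𝕜) :
    symf dhat (A + B) = symf dhat A + symf dhat B := by simp [← symfL_apply]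

theorem symf_sub (A B : Matrix (Fin d) (Fin d) 𝕜) :
    symf dhat (A - B) = symf dhat A - symf dhat B := by simp [← symfL_apply]

theorem symf_smul (c : ℝ) (A : Matrix (Fin d) (Fin d) 𝕜) :
    symf dhat (c • A) = c • symf dhat A := by simp [← symfL_apply]

theorem symf_zero : symf dhat (0 : Matrix (Fin d) (Fin d) 𝕜) = 0 := by simp [← symfL_apply]

theorem symf_symf (A : Matrix (Fin d) (Fin d) 𝕜) : symf dhat (symf dhat A) = symf dhat A := by
  ext a b
  simp only [symf, Matrix.conjTranspose_apply]
  by_cases h : blk dhat a = blk dhat b ∧ blk dhat a < q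
  · rw [if_pos h, if_pos h]
  · have h' : ¬(blk dhat b = blk dhat a ∧ blk dhat b < q) := fun hh => h ⟨hh.1.symm, hh.1 ▸ hh.2⟩
    rw [if_neg h, if_neg h, if_neg h']
    simp only [star_smul, star_add, star_star, star_trivial]
    module

theorem symf_of_hermitian {A : Matrix (Fin d) (Fin d) 𝕜} (h : Aᴴ = A) : symf dhat A = A := by
  ext a b
  simp only [symf, h]
  split_ifs
  · rfl
  · module

theorem symf_eq_zero_iff (A : Matrix (Fin d) (Fin d) 𝕜) : symf dhat A = 0 ↔
    Aᴴ = -A ∧ ∀ a b, blk dhat a = blk dhat b → blk dhat a < q → A a b = 0 := by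
  constructor
  · intro h
    have h1 : ∀ a b, blk dhat a = blk dhat b → blk dhat a < q → A a b = 0 := fun a b h1 h2 => by
      have h3 := congrFun (congrFun h a) b
      simpa only [symf, h1 ▸ h2, h1, and_self, if_true, Matrix.zero_apply] using h3
    refine ⟨?_, h1⟩
    ext a b
    by_cases hc : blk dhat a = blk dhat b ∧ blk dhat a < q
    · rw [Matrix.conjTranspose_apply, Matrix.neg_apply, h1 a b hc.1 hc.2,
        h1 b a hc.1.symm (hc.1 ▸ hc.2)]
      simp
    · have h3 := congrFun (congrFun h a) b
      rw [symf, if_neg hc, Matrix.zero_apply, smul_eq_zero] at h3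
      have h4 := h3.resolve_left (by norm_num)
      rw [Matrix.neg_apply]
      exact (neg_eq_of_add_eq_zero_right h4).symm
  · rintro ⟨h, h1⟩
    ext a b
    rw [symf]
    split_ifs with hc
    · exact h1 a b hc.1 hc.2
    · rw [h]
      simp

/-- Taking Hermitian or skew parts and compressing to a block are all self-adjoint for the real
trace form. Together with `symf_symf` this makes `symf` an orthogonal projection. -/
theorem frobInner_symf (A B : Matrix (Fin d) (Fin d) 𝕜) :
    frobInner (symf dhat A) B = frobInner A (symf dhat B) := by
  have hs : ∀ A B : Matrix (Fin d) (Fin d) 𝕜, frobInner Aᴴ B = frobInner A Bᴴ := fun A B => by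
    rw [← frobInner_conjTranspose A, Matrix.conjTranspose_conjTranspose]
  have hE : ∀ k, frobInner (blkProj 𝕜 d dhat k * ((1 / 2 : ℝ) • (A - Aᴴ)) * blkProj 𝕜 d dhat k) B
      = frobInner A (blkProj 𝕜 d dhat k * ((1 / 2 : ℝ) • (B - Bᴴ)) * blkProj 𝕜 d dhat k) := by
    intro k
    rw [frobInner_mul_right, frobInner_mul_left, blkProj_conjTranspose, frobInner_smul_left,
      frobInner_sub_left, hs, Matrix.mul_smul, Matrix.smul_mul, frobInner_smul_right,
      ← frobInner_sub_right]
    simp only [Matrix.conjTranspose_mul, blkProj_conjTranspose, Matrix.mul_sub, Matrix.sub_mul,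
      Matrix.mul_assoc]
  rw [symf_eq, symf_eq, frobInner_add_left, frobInner_add_right, frobInner_smul_left,
    frobInner_smul_right, frobInner_add_left, frobInner_add_right, hs,
    frobInner_comm (Finset.sum _ _), ← frobL_apply B, ← frobL_apply A (Finset.sum _ _)]
  simp only [map_sum, frobL_apply, ← hE, frobInner_comm B]

theorem commute_blkProj {U : Matrix (Fin d) (Fin d) 𝕜}
    (hU : ∀ a b, blk dhat a ≠ blk dhat b → U a b = 0) (k : ℕ) :
    blkProj 𝕜 d dhat k * U = U * blkProj 𝕜 d dhat k := by
  ext a b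
  rw [blkProj, Matrix.mul_diagonal, Matrix.diagonal_mul]
  by_cases h : blk dhat a = blk dhat b
  · rw [h, mul_comm]
  · rw [hU a b h]; simp

/-- Conjugation by a unitary respects Hermitian and skew parts, and a block-diagonal one commutes
with the block projections. All equivariance statements on the quotient rest on this. -/
theorem symf_conj {U : Matrix (Fin d) (Fin d) 𝕜} (hU : U ∈ blockGroup 𝕜 d dhat)
    (A : Matrix (Fin d) (Fin d) 𝕜) : symf dhat (Uᴴ * A * U) = Uᴴ * symf dhat A * U := by
  have h1 := commute_blkProj dhat hU.2.1
  have h2 := commute_blkProj dhat (conjTranspose_mem_blockGroup dhat hU).2.1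
  have h3 : (Uᴴ * A * U)ᴴ = Uᴴ * Aᴴ * U := by
    simp only [Matrix.conjTranspose_mul, Matrix.conjTranspose_conjTranspose, Matrix.mul_assoc]
  rw [symf_eq, symf_eq, h3, Matrix.mul_add, Matrix.add_mul, Matrix.mul_sum, Matrix.sum_mul]
  congr 1
  · simp only [Matrix.mul_smul, Matrix.smul_mul, Matrix.mul_add, Matrix.add_mul]
  · refine Finset.sum_congr rfl fun k _ => ?_
    calc blkProj 𝕜 d dhat k * ((1 / 2 : ℝ) • (Uᴴ * A * U - Uᴴ * Aᴴ * U)) * blkProj 𝕜 d dhat k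
        = (blkProj 𝕜 d dhat k * Uᴴ) * ((1 / 2 : ℝ) • (A - Aᴴ)) * (U * blkProj 𝕜 d dhat k) := by
          simp only [Matrix.mul_smul, Matrix.smul_mul, Matrix.mul_sub, Matrix.sub_mul,
            Matrix.mul_assoc]
      _ = _ := by
          rw [h2, ← h1]
          simp only [Matrix.mul_assoc]

/-! ### The metric -/

theorem stMetric_eq (α₀ α₁ : ℝ) (Y v w : Matrix (Fin n) (Fin d) 𝕜) :
    stMetric α₀ α₁ Y v w = α₀ * frobInner v w + (α₁ - α₀) * frobInner (Yᴴ * v) (Yᴴ * w) := by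
  rw [stMetric, metricOp, frobInner_add_right, frobInner_smul_right, frobInner_smul_right,
    frobInner_mul_left, Matrix.conjTranspose_conjTranspose, Matrix.mul_assoc]

theorem stMetric_comm (α₀ α₁ : ℝ) (Y v w : Matrix (Fin n) (Fin d) 𝕜) :
    stMetric α₀ α₁ Y v w = stMetric α₀ α₁ Y w v := by
  rw [stMetric_eq, stMetric_eq, frobInner_comm v, frobInner_comm (Yᴴ * v)]

theorem stMetric_add_left (α₀ α₁ : ℝ) (Y v v' w : Matrix (Fin n) (Fin d) 𝕜) :
    stMetric α₀ α₁ Y (v + v') w = stMetric α₀ α₁ Y v w + stMetric α₀ α₁ Y v' w :=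
  frobInner_add_left _ _ _

theorem stMetric_sub_left (α₀ α₁ : ℝ) (Y v v' w : Matrix (Fin n) (Fin d) 𝕜) :
    stMetric α₀ α₁ Y (v - v') w = stMetric α₀ α₁ Y v w - stMetric α₀ α₁ Y v' w :=
  frobInner_sub_left _ _ _

theorem stMetric_mul_right (α₀ α₁ : ℝ) {U : Matrix (Fin d) (Fin d) 𝕜} (hU : Uᴴ * U = 1)
    (Y v w : Matrix (Fin n) (Fin d) 𝕜) :
    stMetric α₀ α₁ (Y * U) (v * U) (w * U) = stMetric α₀ α₁ Y v w := by
  have hU' : U * Uᴴ = 1 := mul_eq_one_comm.mp hU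
  have h1 : (Y * U)ᴴ * (v * U) = Uᴴ * (Yᴴ * v * U) := by
    simp only [Matrix.conjTranspose_mul, Matrix.mul_assoc]
  have h2 : (Y * U)ᴴ * (w * U) = Uᴴ * (Yᴴ * w * U) := by
    simp only [Matrix.conjTranspose_mul, Matrix.mul_assoc]
  rw [stMetric_eq, stMetric_eq, h1, h2, frobInner_mul_left Uᴴ, Matrix.conjTranspose_conjTranspose,
    ← Matrix.mul_assoc U, hU', Matrix.one_mul, frobInner_mul_right v, frobInner_mul_right (Yᴴ * v),
    Matrix.mul_assoc, Matrix.mul_assoc (Yᴴ * w), hU', Matrix.mul_one, Matrix.mul_one]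

variable {α₀ α₁ : ℝ}

/-- By Pythagoras the quadratic form is `α₀` times the squared norm of `v - Y * (Yᴴ * v)` plus `α₁`
times that of `Yᴴ * v`, so both pieces vanish. -/
theorem stMetric_self_eq_zero (hα₀ : 0 < α₀) (hα₁ : 0 < α₁) {Y v : Matrix (Fin n) (Fin d) 𝕜}
    (hY : Yᴴ * Y = 1) (h : stMetric α₀ α₁ Y v v = 0) : v = 0 := by
  have h1 : frobInner (v - Y * (Yᴴ * v)) (v - Y * (Yᴴ * v))
      = frobInner v v - frobInner (Yᴴ * v) (Yᴴ * v) := by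
    simp only [frobInner_sub_left, frobInner_sub_right, frobInner_mul_left]
    rw [← Matrix.mul_assoc Yᴴ Y, hY, Matrix.one_mul]
    simp
  rw [stMetric_eq] at h
  have h2 := frobInner_self_nonneg (v - Y * (Yᴴ * v))
  have h3 := frobInner_self_nonneg (Yᴴ * v)
  have h4 : α₀ * frobInner (v - Y * (Yᴴ * v)) (v - Y * (Yᴴ * v))
      + α₁ * frobInner (Yᴴ * v) (Yᴴ * v) = 0 := by rw [h1]; linarith
  have h5 := mul_nonneg hα₀.le h2
  have h6 := mul_nonneg hα₁.le h3
  have h7 : frobInner (Yᴴ * v) (Yᴴ * v) = 0 := by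
    have : α₁ * frobInner (Yᴴ * v) (Yᴴ * v) = 0 := by linarith
    exact (mul_eq_zero.1 this).resolve_left hα₁.ne'
  have h8 : frobInner (v - Y * (Yᴴ * v)) (v - Y * (Yᴴ * v)) = 0 := by
    have : α₀ * frobInner (v - Y * (Yᴴ * v)) (v - Y * (Yᴴ * v)) = 0 := by linarith
    exact (mul_eq_zero.1 this).resolve_left hα₀.ne'
  have h9 := frobInner_self_eq_zero h8
  rw [frobInner_self_eq_zero h7] at h9
  simpa using h9

theorem metricOp_metricOpInv (hα₀ : 0 < α₀) (hα₁ : 0 < α₁) {Y : Matrix (Fin n) (Fin d) 𝕜}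
    (hY : Yᴴ * Y = 1) (ω : Matrix (Fin n) (Fin d) 𝕜) :
    metricOp α₀ α₁ Y (metricOpInv α₀ α₁ Y ω) = ω ∧
      metricOpInv α₀ α₁ Y (metricOp α₀ α₁ Y ω) = ω := by
  have hP : ∀ A : Matrix (Fin d) (Fin d) 𝕜, Yᴴ * (Y * A) = A := fun A => by
    rw [← Matrix.mul_assoc, hY, Matrix.one_mul]
  constructor <;>
  · simp only [metricOp, metricOpInv, Matrix.mul_add, Matrix.sub_mul, Matrix.mul_sub,
      Matrix.mul_smul, Matrix.one_mul, Matrix.mul_assoc, hP]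
    match_scalars <;> field_simp <;> ring

/-- The metric operator represents the metric. -/
theorem stMetric_metricOpInv (hα₀ : 0 < α₀) (hα₁ : 0 < α₁) {Y : Matrix (Fin n) (Fin d) 𝕜}
    (hY : Yᴴ * Y = 1) (v w : Matrix (Fin n) (Fin d) 𝕜) :
    stMetric α₀ α₁ Y (metricOpInv α₀ α₁ Y v) w = frobInner v w := by
  rw [stMetric_comm, stMetric, (metricOp_metricOpInv hα₀ hα₁ hY v).1, frobInner_comm]

end MatrixTools

/-! ## Tangent, vertical and horizontal spaces of the Stiefel manifold -/

section StiefelSpaces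

variable {𝕜 : Type*} [RCLike 𝕜] {n d m p q : ℕ}

section Rules

variable {E : Type*} [NormedAddCommGroup E] [NormedSpace ℝ E] {M : Set E} {k : ℕ∞}

/-- Turns linear constraints on the points of a set into linear constraints on its velocities, such
as prescribed matrix entries. -/
theorem tangentVectors_clm_eq_zero {F : Type*} [NormedAddCommGroup F] [NormedSpace ℝ F] {Y v : E}
    (hv : v ∈ tangentVectors M Y) (L : E →L[ℝ] F) (c : F) (hL : ∀ Z ∈ M, L Z = c) : L v = 0 := by
  have hY : Y ∈ M := by
    obtain ⟨γ, -, hM, rfl, -⟩ := hv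
    exact hM 0
  rw [← dirDeriv_const (M := M) c ⟨Y, hY⟩ hv, ← dirDeriv_val (M := M) ⟨Y, hY⟩ hv,
    ← dirDeriv_clm (isCkOn_val 1) L ⟨Y, hY⟩ hv, dirDeriv_val (M := M) ⟨Y, hY⟩ hv]
  exact dirDeriv_congr (fun Z : M => hL Z Z.2) _ _

theorem IsCkOn.matMul {φ : M → Matrix (Fin n) (Fin d) 𝕜} {ψ : M → Matrix (Fin d) (Fin p) 𝕜}
    (h : IsCkOn k φ) (h' : IsCkOn k ψ) : IsCkOn k (fun Y => φ Y * ψ Y) :=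
  h.bilin h' (mulL 𝕜 n d p)

theorem IsCkOn.conjTranspose {φ : M → Matrix (Fin n) (Fin d) 𝕜} (h : IsCkOn k φ) :
    IsCkOn k (fun Y => (φ Y)ᴴ) := h.clm (conjTransposeL 𝕜 n d)

theorem IsCkOn.symf {φ : M → Matrix (Fin d) (Fin d) 𝕜} (h : IsCkOn k φ) (dhat : Fin q → ℕ) :
    IsCkOn k (fun Y => symf dhat (φ Y)) := h.clm (symfL 𝕜 d dhat)

theorem IsCkOn.frobInner {φ ψ : M → Matrix (Fin n) (Fin d) 𝕜} (h : IsCkOn k φ)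
    (h' : IsCkOn k ψ) : IsCkOn k (fun Y => frobInner (φ Y) (ψ Y)) := h.bilin h' (frobL 𝕜 n d)

theorem dirDeriv_matMul {φ : M → Matrix (Fin n) (Fin d) 𝕜} {ψ : M → Matrix (Fin d) (Fin p) 𝕜}
    (h : IsCkOn 1 φ) (h' : IsCkOn 1 ψ) (Y : M) {v : E} (hv : v ∈ tangentVectors M (Y : E)) :
    dirDeriv (fun Z => φ Z * ψ Z) Y v = dirDeriv φ Y v * ψ Y + φ Y * dirDeriv ψ Y v :=
  dirDeriv_bilin h h' (mulL 𝕜 n d p) Y hv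

theorem dirDeriv_conjTranspose {φ : M → Matrix (Fin n) (Fin d) 𝕜} (h : IsCkOn 1 φ) (Y : M)
    {v : E} (hv : v ∈ tangentVectors M (Y : E)) :
    dirDeriv (fun Z => (φ Z)ᴴ) Y v = (dirDeriv φ Y v)ᴴ :=
  dirDeriv_clm h (conjTransposeL 𝕜 n d) Y hv

theorem dirDeriv_symf {φ : M → Matrix (Fin d) (Fin d) 𝕜} (h : IsCkOn 1 φ) (dhat : Fin q → ℕ)
    (Y : M) {v : E} (hv : v ∈ tangentVectors M (Y : E)) :
    dirDeriv (fun Z => symf dhat (φ Z)) Y v = symf dhat (dirDeriv φ Y v) :=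
  dirDeriv_clm h (symfL 𝕜 d dhat) Y hv

theorem dirDeriv_frobInner {φ ψ : M → Matrix (Fin n) (Fin d) 𝕜} (h : IsCkOn 1 φ)
    (h' : IsCkOn 1 ψ) (Y : M) {v : E} (hv : v ∈ tangentVectors M (Y : E)) :
    dirDeriv (fun Z => frobInner (φ Z) (ψ Z)) Y v
      = frobInner (dirDeriv φ Y v) (ψ Y) + frobInner (φ Y) (dirDeriv ψ Y v) :=
  dirDeriv_bilin h h' (frobL 𝕜 n d) Y hv

end Rules

/-! ### Matrix exponentials and the tangent, vertical and horizontal spaces -/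

theorem exp_skew_unitary {Ω : Matrix (Fin d) (Fin d) 𝕜} (h : Ωᴴ = -Ω) (t : ℝ) :
    (NormedSpace.exp (t • Ω))ᴴ * NormedSpace.exp (t • Ω) = 1 := by
  rw [← Matrix.exp_conjTranspose, conjTranspose_real_smul, h, smul_neg,
    ← Matrix.exp_add_of_commute _ _ ((Commute.refl (t • Ω)).neg_left), neg_add_cancel,
    NormedSpace.exp_zero]

theorem contDiff_exp_smul (Ω : Matrix (Fin d) (Fin d) 𝕜) :
    ContDiff ℝ (⊤ : ℕ∞) (fun t : ℝ => NormedSpace.exp (t • Ω)) := by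
  have h : ContDiff ℝ (⊤ : ℕ∞) (NormedSpace.exp : Matrix (Fin d) (Fin d) 𝕜 → _) :=
    contDiff_iff_contDiffAt.2 fun x => (NormedSpace.exp_analytic (𝕂 := ℝ) x).contDiffAt
  exact h.comp (contDiff_id.smul contDiff_const)

/-- The curve `exp (t • Ω) * Y` has velocity `Ω * Y` at `0`. Such curves realize all tangent vectors
needed, both for the Stiefel manifold and for the block group at `1`. -/
theorem exp_skew_mul_mem_tangentVectors {Ω : Matrix (Fin n) (Fin n) 𝕜}
    {M : Set (Matrix (Fin n) (Fin d) 𝕜)} {Y : Matrix (Fin n) (Fin d) 𝕜}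
    (h : ∀ t : ℝ, NormedSpace.exp (t • Ω) * Y ∈ M) : Ω * Y ∈ tangentVectors M Y := by
  refine ⟨fun t => (mulL 𝕜 n n d).flip Y (NormedSpace.exp (t • Ω)),
    ((mulL 𝕜 n n d).flip Y).contDiff.comp (contDiff_exp_smul Ω), h, ?_, ?_⟩
  · show NormedSpace.exp ((0 : ℝ) • Ω) * Y = Y
    rw [zero_smul, NormedSpace.exp_zero, Matrix.one_mul]
  have h1 : HasDerivAt (fun t : ℝ => NormedSpace.exp (t • Ω)) Ω 0 := by
    have h := hasDerivAt_exp_smul_const (𝕂 := ℝ) Ω 0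
    rw [zero_smul, NormedSpace.exp_zero, one_mul] at h
    exact h
  exact (((mulL 𝕜 n n d).flip Y).hasFDerivAt.comp_hasDerivAt (0 : ℝ) h1).deriv

/-- Necessity is the derivative of `Yᴴ * Y = 1`. For sufficiency, `v` is written as `Ω * Y` with `Ω`
skew, so that left multiplication by a one-parameter unitary group gives the curve. -/
theorem mem_tangentVectors_stiefel {Y : Matrix (Fin n) (Fin d) 𝕜} (hY : Y ∈ stiefel 𝕜 n d)
    (v : Matrix (Fin n) (Fin d) 𝕜) :
    v ∈ tangentVectors (stiefel 𝕜 n d) Y ↔ (Yᴴ * v)ᴴ = -(Yᴴ * v) := by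
  have hY' : Yᴴ * Y = 1 := hY
  constructor
  · intro hv
    have h1 := dirDeriv_matMul (isCkOn_val 1).conjTranspose (isCkOn_val 1)
      (⟨Y, hY⟩ : stiefel 𝕜 n d) hv
    rw [dirDeriv_conjTranspose (isCkOn_val 1) _ hv, dirDeriv_val _ hv,
      dirDeriv_congr (ψ := fun _ => 1) (fun Z => Z.2), dirDeriv_const _ _ hv] at h1
    rw [Matrix.conjTranspose_mul, Matrix.conjTranspose_conjTranspose]
    exact eq_neg_of_add_eq_zero_left h1.symm
  · intro h
    have h' : vᴴ * Y = -(Yᴴ * v) := by simpa using h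
    -- The first two terms form a skew matrix sending `Y` to `v + Y * (Yᴴ * v)`; the last term, skew
    -- because `Yᴴ * v` is, removes the excess.
    set Ω := v * Yᴴ - Y * vᴴ - Y * (Yᴴ * v) * Yᴴ with hΩ
    have h1 : Ωᴴ = -Ω := by
      simp only [hΩ, Matrix.conjTranspose_sub, Matrix.conjTranspose_mul,
        Matrix.conjTranspose_conjTranspose, h', Matrix.mul_assoc, Matrix.neg_mul, Matrix.mul_neg]
      abel
    have h2 : Ω * Y = v := by
      simp only [hΩ, Matrix.sub_mul, Matrix.mul_assoc, h', hY', Matrix.mul_one, Matrix.mul_neg]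
      abel
    rw [← h2]
    refine exp_skew_mul_mem_tangentVectors fun t => ?_
    show _ * _ = _
    rw [Matrix.conjTranspose_mul, Matrix.mul_assoc, ← Matrix.mul_assoc _ _ Y,
      exp_skew_unitary h1, Matrix.one_mul, hY']

variable (dhat : Fin q → ℕ)

theorem symf_eq_self_of_skew_iff {A : Matrix (Fin d) (Fin d) 𝕜} (h : Aᴴ = -A) :
    symf dhat A = A ↔ ∀ a b, ¬(blk dhat a = blk dhat b ∧ blk dhat a < q) → A a b = 0 := by
  constructor
  · intro hA a b hab
    rw [← hA, symf, if_neg hab, h]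
    simp
  · intro hA
    ext a b
    rw [symf]
    split_ifs with hab
    · rfl
    · rw [h, hA a b hab]
      simp [hA a b hab]

theorem exp_mem_blockGroup {A : Matrix (Fin d) (Fin d) 𝕜} (h : Aᴴ = -A) (hA : symf dhat A = A)
    (t : ℝ) : NormedSpace.exp (t • A) ∈ blockGroup 𝕜 d dhat := by
  have h0 := (symf_eq_self_of_skew_iff dhat h).1 hA
  refine ⟨exp_skew_unitary h t, fun a b hab => ?_, fun a b ha hb => ?_⟩
  -- `A` is block-diagonal, so it commutes with the block projections, and hence so does its
  -- exponential.
  · have h1 : Commute (blkProj 𝕜 d dhat (blk dhat a)) (t • A) :=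
      Commute.smul_right (commute_blkProj dhat (fun a b hab => h0 a b fun hh => hab hh.1) _) t
    have h2 := congrFun (congrFun h1.exp_right.eq a) b
    rw [blkProj, Matrix.mul_diagonal, Matrix.diagonal_mul] at h2
    simpa [Ne.symm hab] using h2
  · have h1 : blkProj 𝕜 d dhat q * A = 0 := by
      ext a b
      rw [blkProj, Matrix.diagonal_mul]
      by_cases hc : blk dhat a = q
      · rw [h0 a b fun hh => hh.2.ne hc]
        simp
      · simp [hc]
    -- The rows of `A` in the last block vanish. Reading this as a semiconjugation of `t • A` to `0`
    -- shows that the exponential has identity rows there.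
    have h2 : SemiconjBy (blkProj 𝕜 d dhat q) (t • A) 0 := by
      rw [SemiconjBy, Matrix.mul_smul, h1, smul_zero, Matrix.zero_mul]
    have h3 := congrFun (congrFun h2.exp_right.eq a) b
    rw [NormedSpace.exp_zero, Matrix.one_mul, blkProj, Matrix.diagonal_mul,
      Matrix.diagonal_apply] at h3
    rw [if_pos ha, one_mul] at h3
    exact h3

/-- Skewness comes from tangency to the unitary group, viewed as the square Stiefel manifold.
Outside the first `q` diagonal blocks the entries of group elements are constant, so the entries of
a velocity vanish there. -/
theorem skew_of_mem_tangentVectors_blockGroup {A : Matrix (Fin d) (Fin d) 𝕜}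
    (hA : A ∈ tangentVectors (blockGroup 𝕜 d dhat) 1) : Aᴴ = -A ∧ symf dhat A = A := by
  have h1 : Aᴴ = -A := by
    have h1 := tangentVectors_mono (M := stiefel 𝕜 d d) (fun U hU => hU.1) 1 hA
    have h2 := (mem_tangentVectors_stiefel (by simp [stiefel]) A).1 h1
    simpa using h2
  refine ⟨h1, (symf_eq_self_of_skew_iff dhat h1).2 fun a b hab => ?_⟩
  refine tangentVectors_clm_eq_zero hA
    (LinearMap.toContinuousLinearMap (Matrix.entryLinearMap ℝ 𝕜 a b))
    (if blk dhat a = blk dhat b then if a = b then 1 else 0 else 0) fun U hU => ?_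
  show U a b = _
  split_ifs with hc hd
  · have := blk_le dhat a
    have ha : blk dhat a = q := by
      by_contra hne
      exact hab ⟨hc, by omega⟩
    rw [hU.2.2 a b ha (hc ▸ ha), if_pos hd]
  · have := blk_le dhat a
    have ha : blk dhat a = q := by
      by_contra hne
      exact hab ⟨hc, by omega⟩
    rw [hU.2.2 a b ha (hc ▸ ha), if_neg hd]
  · exact hU.2.1 a b hc

/-- Left multiplication by `Yᴴ` identifies the orbit with the group, while `1 - Y * Yᴴ` kills the
whole orbit; together they give `v = Y * (Yᴴ * v)` with `Yᴴ * v` tangent to the group at `1`. -/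
theorem mem_verticalSpace {Y : Matrix (Fin n) (Fin d) 𝕜} (hY : Yᴴ * Y = 1)
    (v : Matrix (Fin n) (Fin d) 𝕜) :
    v ∈ verticalSpace dhat Y ↔ ∃ A : Matrix (Fin d) (Fin d) 𝕜, Aᴴ = -A ∧ symf dhat A = A ∧ v = Y * A := by
  constructor
  · intro hv
    refine ⟨Yᴴ * v, ?_⟩
    have h1 := tangentVectors_image (N := blockGroup 𝕜 d dhat) (mulL 𝕜 d n d Yᴴ) (by
      rintro _ ⟨U, hU, rfl⟩
      rw [mulL_apply, ← Matrix.mul_assoc, hY, Matrix.one_mul]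
      exact hU) hv
    rw [mulL_apply, mulL_apply, hY] at h1
    refine ⟨(skew_of_mem_tangentVectors_blockGroup dhat h1).1, (skew_of_mem_tangentVectors_blockGroup dhat h1).2,
      ?_⟩
    have h2 := tangentVectors_clm_eq_zero hv
      (mulL 𝕜 n n d (1 - Y * Yᴴ)) 0 (by
      rintro _ ⟨U, hU, rfl⟩
      rw [mulL_apply, Matrix.sub_mul, Matrix.one_mul, Matrix.mul_assoc, ← Matrix.mul_assoc _ Y, hY,
        Matrix.one_mul, sub_self])
    rw [mulL_apply, Matrix.sub_mul, Matrix.one_mul, Matrix.mul_assoc, sub_eq_zero] at h2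
    exact h2
  · rintro ⟨A, h, hA, rfl⟩
    have h1 : A ∈ tangentVectors (blockGroup 𝕜 d dhat) 1 := by
      rw [← Matrix.mul_one A]
      refine exp_skew_mul_mem_tangentVectors fun t => ?_
      rw [Matrix.mul_one]
      exact exp_mem_blockGroup dhat h hA t
    have h2 := tangentVectors_image (N := {Z | ∃ U ∈ blockGroup 𝕜 d dhat, Z = Y * U})
      (mulL 𝕜 n d d Y) (fun U hU => ⟨U, hU, rfl⟩) h1
    rwa [mulL_apply, mulL_apply, Matrix.mul_one] at h2

theorem symf_conjTranspose (A : Matrix (Fin d) (Fin d) 𝕜) :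
    (symf dhat A)ᴴ = symf dhat Aᴴ := by
  ext a b
  simp only [symf, Matrix.conjTranspose_apply]
  by_cases h : blk dhat a = blk dhat b ∧ blk dhat a < q
  · rw [if_pos h, if_pos ⟨h.1.symm, h.1 ▸ h.2⟩]
  · rw [if_neg h, if_neg fun hh : blk dhat b = blk dhat a ∧ _ => h ⟨hh.1.symm, hh.1 ▸ hh.2⟩]
    simp only [star_smul, star_add, star_star, star_trivial]

variable {α₀ α₁ : ℝ}

theorem mem_horizontalSpace (hα₁ : 0 < α₁) {Y : Matrix (Fin n) (Fin d) 𝕜} (hY : Yᴴ * Y = 1)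
    (ω : Matrix (Fin n) (Fin d) 𝕜) :
    ω ∈ horizontalSpace α₀ α₁ dhat Y ↔ symf dhat (Yᴴ * ω) = 0 := by
  have hm : ∀ A, stMetric α₀ α₁ Y ω (Y * A) = α₁ * frobInner (Yᴴ * ω) A := fun A => by
    rw [stMetric_eq, ← Matrix.mul_assoc, hY, Matrix.one_mul, frobInner_comm ω, frobInner_mul_left,
      frobInner_comm A]
    ring
  have hT := mem_tangentVectors_stiefel (𝕜 := 𝕜) (show Y ∈ stiefel 𝕜 n d from hY) ω
  constructor
  · rintro ⟨h1, h2⟩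
    rw [hT] at h1
    -- Testing against this vertical vector turns the orthogonality condition, by self-adjointness
    -- and idempotence, into the vanishing of the squared norm of `symf dhat (Yᴴ * ω)`.
    have h3 := h2 (Y * symf dhat (Yᴴ * ω)) ((mem_verticalSpace dhat hY _).2
      ⟨_, by rw [symf_conjTranspose, h1, ← zero_sub, symf_sub, symf_zero,
        zero_sub], symf_symf dhat _, rfl⟩)
    rw [hm, ← symf_symf, ← frobInner_symf] at h3
    exact frobInner_self_eq_zero ((mul_eq_zero.1 h3).resolve_left hα₁.ne')
  · intro h
    refine ⟨hT.2 ((symf_eq_zero_iff dhat _).1 h).1, fun v hv => ?_⟩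
    obtain ⟨A, -, hA, rfl⟩ := (mem_verticalSpace dhat hY _).1 hv
    rw [hm, ← hA, ← frobInner_symf, h, frobInner_zero_left, mul_zero]

/-- The explicit horizontal projection is horizontal. -/
theorem symf_sub_proj {Y : Matrix (Fin n) (Fin d) 𝕜} (hY : Yᴴ * Y = 1)
    (ω : Matrix (Fin n) (Fin d) 𝕜) :
    symf dhat (Yᴴ * (ω - Y * symf dhat (Yᴴ * ω))) = 0 := by
  rw [Matrix.mul_sub, ← Matrix.mul_assoc Yᴴ Y, hY, Matrix.one_mul, symf_sub, symf_symf, sub_self]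

theorem stMetric_sub_proj {Y : Matrix (Fin n) (Fin d) 𝕜} (hY : Yᴴ * Y = 1)
    (ω : Matrix (Fin n) (Fin d) 𝕜) {w : Matrix (Fin n) (Fin d) 𝕜} (hw : symf dhat (Yᴴ * w) = 0) :
    stMetric α₀ α₁ Y (ω - Y * symf dhat (Yᴴ * ω)) w = stMetric α₀ α₁ Y ω w := by
  rw [stMetric_sub_left, sub_eq_self, stMetric_eq, ← Matrix.mul_assoc, hY, Matrix.one_mul,
    frobInner_mul_left, frobInner_symf, hw, frobInner_zero_right]
  ring

theorem eq_of_stMetric_eq (hα₀ : 0 < α₀) (hα₁ : 0 < α₁) {Y : Matrix (Fin n) (Fin d) 𝕜}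
    (hY : Yᴴ * Y = 1) {v w : Matrix (Fin n) (Fin d) 𝕜} (hv : symf dhat (Yᴴ * v) = 0)
    (hw : symf dhat (Yᴴ * w) = 0)
    (h : ∀ u, symf dhat (Yᴴ * u) = 0 → stMetric α₀ α₁ Y v u = stMetric α₀ α₁ Y w u) : v = w := by
  refine sub_eq_zero.1 (stMetric_self_eq_zero hα₀ hα₁ hY ?_)
  rw [stMetric_sub_left, sub_eq_zero]
  exact h _ (by rw [Matrix.mul_sub, symf_sub, hv, hw, sub_zero])

theorem isHorizProj_iff (hα₀ : 0 < α₀) (hα₁ : 0 < α₁) {Y : Matrix (Fin n) (Fin d) 𝕜}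
    (hY : Yᴴ * Y = 1) (ω p : Matrix (Fin n) (Fin d) 𝕜) :
    IsHorizProj α₀ α₁ dhat Y ω p ↔ p = ω - Y * symf dhat (Yᴴ * ω) := by
  simp only [IsHorizProj, mem_horizontalSpace dhat hα₁ hY]
  constructor
  · rintro ⟨h1, h2⟩
    refine eq_of_stMetric_eq dhat hα₀ hα₁ hY h1 (symf_sub_proj dhat hY ω) fun u hu => ?_
    rw [h2 u hu, stMetric_sub_proj dhat hY ω hu]
  · rintro rfl
    exact ⟨symf_sub_proj dhat hY ω, fun w hw => stMetric_sub_proj dhat hY ω hw⟩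

theorem horizProj_eq (hα₀ : 0 < α₀) (hα₁ : 0 < α₁) {Y : Matrix (Fin n) (Fin d) 𝕜}
    (hY : Yᴴ * Y = 1) (ω : Matrix (Fin n) (Fin d) 𝕜) :
    horizProj α₀ α₁ dhat Y ω = ω - Y * symf dhat (Yᴴ * ω) :=
  (isHorizProj_iff dhat hα₀ hα₁ hY ω _).1
    (Classical.epsilon_spec ⟨_, (isHorizProj_iff dhat hα₀ hα₁ hY ω _).2 rfl⟩)

end StiefelSpaces

/-! ## Gradients and the Levi-Civita connection of the Stiefel manifold -/

section StiefelGeometry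

variable {𝕜 : Type*} [RCLike 𝕜] {n d q : ℕ} (dhat : Fin q → ℕ) {α₀ α₁ : ℝ}

theorem horizontal_tangent {Y ω : Matrix (Fin n) (Fin d) 𝕜} (hY : Y ∈ stiefel 𝕜 n d)
    (h : symf dhat (Yᴴ * ω) = 0) : ω ∈ tangentVectors (stiefel 𝕜 n d) Y :=
  (mem_tangentVectors_stiefel hY ω).2 ((symf_eq_zero_iff dhat _).1 h).1

theorem IsHorizontal.symf_eq_zero (hα₁ : 0 < α₁) {ξ : VField (stiefel 𝕜 n d)}
    (h : IsHorizontal α₀ α₁ dhat ξ) (Y : stiefel 𝕜 n d) : symf dhat (Y.1ᴴ * ξ Y) = 0 :=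
  (mem_horizontalSpace dhat hα₁ Y.2 _).1 (h Y)

theorem isHorizontal_iff (hα₁ : 0 < α₁) (ξ : VField (stiefel 𝕜 n d)) :
    IsHorizontal α₀ α₁ dhat ξ ↔ ∀ Y : stiefel 𝕜 n d, symf dhat (Y.1ᴴ * ξ Y) = 0 :=
  forall_congr' fun Y => mem_horizontalSpace dhat hα₁ Y.2 _

/-- The smooth vector field whose values are horizontal vectors. -/
def VField.ofHorizontal (φ : stiefel 𝕜 n d → Matrix (Fin n) (Fin d) 𝕜) (h : IsCkOn ⊤ φ)
    (hh : ∀ Y, symf dhat (Y.1ᴴ * φ Y) = 0) : VField (stiefel 𝕜 n d) :=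
  ⟨φ, fun Y => horizontal_tangent dhat Y.2 (hh Y), h⟩

theorem VField.ofHorizontal_isHorizontal (hα₁ : 0 < α₁)
    (φ : stiefel 𝕜 n d → Matrix (Fin n) (Fin d) 𝕜) (h : IsCkOn ⊤ φ)
    (hh : ∀ Y, symf dhat (Y.1ᴴ * φ Y) = 0) :
    IsHorizontal α₀ α₁ dhat (VField.ofHorizontal dhat φ h hh) :=
  (isHorizontal_iff dhat hα₁ _).2 hh

theorem isCkOn_horizProj {k : ℕ∞} {φ : stiefel 𝕜 n d → Matrix (Fin n) (Fin d) 𝕜}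
    (h : IsCkOn k φ) : IsCkOn k (fun Y => φ Y - Y.1 * symf dhat (Y.1ᴴ * φ Y)) :=
  h.sub ((isCkOn_val k).matMul (((isCkOn_val k).conjTranspose.matMul h).symf dhat))

/-- Project the constant field `w` onto each horizontal space. Identities tested on horizontal
fields thereby become identities tested on horizontal vectors at one point. -/
theorem exists_isHorizontal_through (hα₁ : 0 < α₁) (Y : stiefel 𝕜 n d)
    {w : Matrix (Fin n) (Fin d) 𝕜} (hw : symf dhat (Y.1ᴴ * w) = 0) :
    ∃ ξ : VField (stiefel 𝕜 n d), IsHorizontal α₀ α₁ dhat ξ ∧ ξ Y = w :=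
  ⟨_, VField.ofHorizontal_isHorizontal dhat hα₁ _ (isCkOn_horizProj dhat (isCkOn_const ⊤ w))
    (fun Z => symf_sub_proj dhat Z.2 w), by
      show w - Y.1 * symf dhat (Y.1ᴴ * w) = w
      rw [hw, Matrix.mul_zero, sub_zero]⟩

theorem IsCkOn.metricOpInv {k : ℕ∞} {φ : stiefel 𝕜 n d → Matrix (Fin n) (Fin d) 𝕜}
    (h : IsCkOn k φ) (α₀ α₁ : ℝ) : IsCkOn k (fun Y => metricOpInv α₀ α₁ Y.1 (φ Y)) := by
  have h1 : IsCkOn k fun Y : stiefel 𝕜 n d => Y.1 * Y.1ᴴ :=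
    (isCkOn_val k).matMul (isCkOn_val k).conjTranspose
  exact ((((isCkOn_const k 1).sub h1).matMul h).const_smul _).add ((h1.matMul h).const_smul _)

theorem IsCkOn.stMetric {k : ℕ∞} {φ ψ : stiefel 𝕜 n d → Matrix (Fin n) (Fin d) 𝕜}
    (h : IsCkOn k φ) (h' : IsCkOn k ψ) (α₀ α₁ : ℝ) :
    IsCkOn k (fun Y => stMetric α₀ α₁ Y.1 (φ Y) (ψ Y)) := by
  have h1 : IsCkOn k fun Y : stiefel 𝕜 n d => Y.1ᴴ := (isCkOn_val k).conjTranspose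
  exact (((h.frobInner h').const_smul α₀).add
    (((h1.matMul h).frobInner (h1.matMul h')).const_smul (α₁ - α₀))).congr
    fun Y => stMetric_eq _ _ _ _ _

/-! ### Gradients -/

/-- Represent the differential of any smooth extension by the trace form. Since an arbitrary ambient
gradient need not be smooth, this one is what makes the horizontal gradient a smooth field. -/
theorem exists_smooth_ambientGradient {f : stiefel 𝕜 n d → ℝ} (hf : IsCkOn ⊤ f) :
    ∃ fY : stiefel 𝕜 n d → Matrix (Fin n) (Fin d) 𝕜, IsCkOn ⊤ fY ∧ IsAmbientGradient f fY := by
  obtain ⟨U, Φ, hU, hM, hΦ, he⟩ := hf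
  refine ⟨fun Y => rieszL 𝕜 n d (fderiv ℝ Φ Y), ?_, fun Y v hv => ?_⟩
  · have h1 : IsCkOn (F := NormedCLM (Matrix (Fin n) (Fin d) 𝕜) ℝ) ⊤
        (fun Y : stiefel 𝕜 n d => fderiv ℝ Φ Y) :=
      ⟨U, fderiv ℝ Φ, hU, hM, hΦ.fderiv_of_isOpen hU (by simp), fun _ => rfl⟩
    exact h1.clm (rieszL 𝕜 n d)
  · rw [frobInner_rieszL, IsCkOn.dirDeriv_eq_fderiv hU hM (hΦ.of_le (by simp)) he Y hv]

theorem stMetric_proj_metricOpInv (hα₀ : 0 < α₀) (hα₁ : 0 < α₁) {Y : Matrix (Fin n) (Fin d) 𝕜}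
    (hY : Yᴴ * Y = 1) (v : Matrix (Fin n) (Fin d) 𝕜) {w : Matrix (Fin n) (Fin d) 𝕜}
    (hw : symf dhat (Yᴴ * w) = 0) :
    stMetric α₀ α₁ Y (horizProj α₀ α₁ dhat Y (metricOpInv α₀ α₁ Y v)) w = frobInner v w := by
  rw [horizProj_eq dhat hα₀ hα₁ hY, stMetric_sub_proj dhat hY _ hw,
    stMetric_metricOpInv hα₀ hα₁ hY]

theorem symf_horizProj (hα₀ : 0 < α₀) (hα₁ : 0 < α₁) {Y : Matrix (Fin n) (Fin d) 𝕜}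
    (hY : Yᴴ * Y = 1) (ω : Matrix (Fin n) (Fin d) 𝕜) :
    symf dhat (Yᴴ * horizProj α₀ α₁ dhat Y ω) = 0 := by
  rw [horizProj_eq dhat hα₀ hα₁ hY]
  exact symf_sub_proj dhat hY ω

theorem horizProj_metricOpInv (hα₀ : 0 < α₀) (hα₁ : 0 < α₁) {Y : Matrix (Fin n) (Fin d) 𝕜}
    (hY : Yᴴ * Y = 1) (v : Matrix (Fin n) (Fin d) 𝕜) :
    horizProj α₀ α₁ dhat Y (metricOpInv α₀ α₁ Y v) =
      α₀⁻¹ • v + (α₁⁻¹ - α₀⁻¹) • (Y * Yᴴ * v) - α₁⁻¹ • (Y * symf dhat (Yᴴ * v)) := by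
  have h1 : Yᴴ * metricOpInv α₀ α₁ Y v = α₁⁻¹ • (Yᴴ * v) := by
    rw [metricOpInv, Matrix.mul_add, Matrix.mul_smul, Matrix.mul_smul, Matrix.sub_mul,
      Matrix.one_mul, Matrix.mul_sub, Matrix.mul_assoc Y, ← Matrix.mul_assoc Yᴴ Y, hY,
      Matrix.one_mul, sub_self, smul_zero, zero_add]
  rw [horizProj_eq dhat hα₀ hα₁ hY, h1, symf_smul, Matrix.mul_smul, metricOpInv, Matrix.sub_mul,
    Matrix.one_mul]
  module

theorem isHorizGradient_iff (hα₀ : 0 < α₀) (hα₁ : 0 < α₁) {f : stiefel 𝕜 n d → ℝ}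
    {fY : stiefel 𝕜 n d → Matrix (Fin n) (Fin d) 𝕜} (hf : IsAmbientGradient f fY)
    (R : VField (stiefel 𝕜 n d)) : IsHorizGradient α₀ α₁ dhat f R ↔
      ∀ Y, R Y = horizProj α₀ α₁ dhat Y.1 (metricOpInv α₀ α₁ Y.1 (fY Y)) := by
  constructor
  · rintro ⟨h1, h2⟩ Y
    refine eq_of_stMetric_eq dhat hα₀ hα₁ Y.2 (h1.symf_eq_zero dhat hα₁ Y)
      (symf_horizProj dhat hα₀ hα₁ Y.2 _) fun w hw => ?_
    obtain ⟨ξ, hξ, rfl⟩ := exists_isHorizontal_through (α₀ := α₀) dhat hα₁ Y hw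
    rw [h2 ξ hξ, stMetric_proj_metricOpInv dhat hα₀ hα₁ Y.2 _ hw, frobInner_comm,
      hf Y _ (ξ.tangent Y)]
  · intro h
    refine ⟨(isHorizontal_iff dhat hα₁ _).2 fun Y => ?_, fun ξ hξ Y => ?_⟩
    · rw [h]
      exact symf_horizProj dhat hα₀ hα₁ Y.2 _
    · rw [h, stMetric_proj_metricOpInv dhat hα₀ hα₁ Y.2 _ (hξ.symf_eq_zero dhat hα₁ Y),
        frobInner_comm, hf Y _ (ξ.tangent Y)]

theorem existsUnique_isHorizGradient (hα₀ : 0 < α₀) (hα₁ : 0 < α₁) {f : stiefel 𝕜 n d → ℝ}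
    (hf : IsCkOn ⊤ f) : ∃! R : VField (stiefel 𝕜 n d), IsHorizGradient α₀ α₁ dhat f R := by
  obtain ⟨fY, h1, h2⟩ := exists_smooth_ambientGradient hf
  refine ⟨VField.ofHorizontal dhat
    (fun Y => horizProj α₀ α₁ dhat Y.1 (metricOpInv α₀ α₁ Y.1 (fY Y)))
    ((isCkOn_horizProj dhat (h1.metricOpInv α₀ α₁)).congr fun Y => horizProj_eq dhat hα₀ hα₁ Y.2 _)
    (fun Y => symf_horizProj dhat hα₀ hα₁ Y.2 _),
    (isHorizGradient_iff dhat hα₀ hα₁ h2 _).2 fun Y => rfl, fun R hR => ?_⟩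
  ext1
  funext Y
  exact (isHorizGradient_iff dhat hα₀ hα₁ h2 R).1 hR Y

/-! ### The Levi-Civita connection -/

/-- The Christoffel term of the Levi-Civita connection of the Stiefel manifold. -/
noncomputable def lcChristoffel (α₀ α₁ : ℝ) (Y v w : Matrix (Fin n) (Fin d) 𝕜) :
    Matrix (Fin n) (Fin d) 𝕜 :=
  (1 / 2 : ℝ) • (Y * (vᴴ * w + wᴴ * v))
    + ((α₀ - α₁) / α₀) • ((1 - Y * Yᴴ) * (v * wᴴ + w * vᴴ) * Y)

theorem conjTranspose_mul_lcChristoffel {Y : Matrix (Fin n) (Fin d) 𝕜} (hY : Yᴴ * Y = 1)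
    (v w : Matrix (Fin n) (Fin d) 𝕜) :
    Yᴴ * lcChristoffel α₀ α₁ Y v w = (1 / 2 : ℝ) • (vᴴ * w + wᴴ * v) := by
  rw [lcChristoffel, Matrix.mul_add, Matrix.mul_smul, ← Matrix.mul_assoc, hY, Matrix.one_mul,
    Matrix.mul_smul, ← Matrix.mul_assoc, ← Matrix.mul_assoc, Matrix.mul_sub, Matrix.mul_one,
    ← Matrix.mul_assoc, hY, Matrix.one_mul, sub_self, Matrix.zero_mul, Matrix.zero_mul, smul_zero,
    add_zero]

theorem lcChristoffel_comm (Y v w : Matrix (Fin n) (Fin d) 𝕜) :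
    lcChristoffel α₀ α₁ Y v w = lcChristoffel α₀ α₁ Y w v := by
  rw [lcChristoffel, lcChristoffel, add_comm (vᴴ * w), add_comm (v * wᴴ)]

theorem lcChristoffel_add_left (Y v v' w : Matrix (Fin n) (Fin d) 𝕜) :
    lcChristoffel α₀ α₁ Y (v + v') w = lcChristoffel α₀ α₁ Y v w + lcChristoffel α₀ α₁ Y v' w := by
  simp only [lcChristoffel, Matrix.conjTranspose_add, Matrix.mul_add, Matrix.add_mul]
  module

theorem lcChristoffel_smul_left (c : ℝ) (Y v w : Matrix (Fin n) (Fin d) 𝕜) :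
    lcChristoffel α₀ α₁ Y (c • v) w = c • lcChristoffel α₀ α₁ Y v w := by
  simp only [lcChristoffel, conjTranspose_real_smul, Matrix.mul_add, Matrix.add_mul,
    Matrix.smul_mul, Matrix.mul_smul]
  module

/-- Terms pairing a Hermitian matrix with the skew `Yᴴ * u` drop out: `vᴴ * w + wᴴ * v` is
Hermitian, and so is the anticommutator of the skew matrices `Yᴴ * v` and `Yᴴ * w`. Only the term
with coefficient `(α₀ - α₁) / α₀` survives, and the factor `α₀` of the metric clears its
denominator. -/
theorem stMetric_lcChristoffel (hα₀ : 0 < α₀) {Y v w u : Matrix (Fin n) (Fin d) 𝕜}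
    (hY : Yᴴ * Y = 1) (hv : (Yᴴ * v)ᴴ = -(Yᴴ * v)) (hw : (Yᴴ * w)ᴴ = -(Yᴴ * w))
    (hu : (Yᴴ * u)ᴴ = -(Yᴴ * u)) :
    stMetric α₀ α₁ Y (lcChristoffel α₀ α₁ Y v w) u
      = (α₁ - α₀) * (frobInner (Yᴴ * w) (vᴴ * u) + frobInner (w * (Yᴴ * v)) u) := by
  have h1 : frobInner (vᴴ * w + wᴴ * v) (Yᴴ * u) = 0 := by
    refine frobInner_eq_zero_of_herm_skew ?_ hu
    simp only [Matrix.conjTranspose_add, Matrix.conjTranspose_mul,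
      Matrix.conjTranspose_conjTranspose, add_comm]
  have h2 : frobInner ((Yᴴ * v) * (Yᴴ * w) + (Yᴴ * w) * (Yᴴ * v)) (Yᴴ * u) = 0 := by
    refine frobInner_eq_zero_of_herm_skew ?_ hu
    rw [Matrix.conjTranspose_add, Matrix.conjTranspose_mul, Matrix.conjTranspose_mul _ (Yᴴ * v), hv,
      hw]
    simp only [neg_mul_neg, add_comm]
  have hv' : vᴴ * Y = -(Yᴴ * v) := by simpa using hv
  have hw' : wᴴ * Y = -(Yᴴ * w) := by simpa using hw
  have h3 : (1 - Y * Yᴴ)ᴴ = 1 - Y * Yᴴ := by simp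
  have h4 : frobInner ((1 - Y * Yᴴ) * (v * wᴴ + w * vᴴ) * Y) u
      = -(frobInner (Yᴴ * w) (vᴴ * u) + frobInner (w * (Yᴴ * v)) u) := by
    rw [Matrix.mul_assoc, frobInner_mul_left, h3, Matrix.add_mul, Matrix.mul_assoc, hw',
      Matrix.mul_assoc, hv', Matrix.sub_mul, Matrix.one_mul, Matrix.mul_assoc, frobInner_sub_right,
      frobInner_comm _ (Y * _), frobInner_mul_left, frobInner_comm (Yᴴ * u)]
    have h5 : Yᴴ * (v * -(Yᴴ * w) + w * -(Yᴴ * v))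
        = -((Yᴴ * v) * (Yᴴ * w) + (Yᴴ * w) * (Yᴴ * v)) := by
      simp only [Matrix.mul_add, Matrix.mul_neg, Matrix.mul_assoc, neg_add]
    rw [h5, frobInner_neg_left, h2, frobInner_add_left, Matrix.mul_neg, Matrix.mul_neg,
      frobInner_neg_left, frobInner_neg_left, frobInner_mul_left v]
    ring
  rw [stMetric_eq, conjTranspose_mul_lcChristoffel hY, frobInner_smul_left, h1, lcChristoffel,
    frobInner_add_left, frobInner_smul_left, frobInner_smul_left, frobInner_mul_left, h1, h4]
  field_simp
  ring

/-- The right-hand side is exactly the contribution in `dirDeriv_stMetric` of the dependence of the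
metric on `Y`, so this is metric compatibility. The terms containing `Yᴴ * v` cancel because that
matrix is skew. -/
theorem stMetric_lcChristoffel_add (hα₀ : 0 < α₀) {Y v w u : Matrix (Fin n) (Fin d) 𝕜}
    (hY : Yᴴ * Y = 1) (hv : (Yᴴ * v)ᴴ = -(Yᴴ * v)) (hw : (Yᴴ * w)ᴴ = -(Yᴴ * w))
    (hu : (Yᴴ * u)ᴴ = -(Yᴴ * u)) :
    stMetric α₀ α₁ Y (lcChristoffel α₀ α₁ Y v w) u + stMetric α₀ α₁ Y w (lcChristoffel α₀ α₁ Y v u)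
      = (α₁ - α₀) * (frobInner (vᴴ * w) (Yᴴ * u) + frobInner (Yᴴ * w) (vᴴ * u)) := by
  rw [stMetric_comm α₀ α₁ Y w, stMetric_lcChristoffel hα₀ hY hv hw hu,
    stMetric_lcChristoffel hα₀ hY hv hu hw, frobInner_mul_right u, hv, Matrix.mul_neg,
    frobInner_neg_right, frobInner_comm u, frobInner_comm (Yᴴ * u)]
  ring

theorem dirDeriv_stMetric {η ζ : stiefel 𝕜 n d → Matrix (Fin n) (Fin d) 𝕜} (hη : IsCkOn 1 η)
    (hζ : IsCkOn 1 ζ) (Y : stiefel 𝕜 n d) {v : Matrix (Fin n) (Fin d) 𝕜}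
    (hv : v ∈ tangentVectors (stiefel 𝕜 n d) Y.1) :
    dirDeriv (fun Z => stMetric α₀ α₁ Z.1 (η Z) (ζ Z)) Y v
      = stMetric α₀ α₁ Y.1 (dirDeriv η Y v) (ζ Y) + stMetric α₀ α₁ Y.1 (η Y) (dirDeriv ζ Y v)
        + (α₁ - α₀) * (frobInner (vᴴ * η Y) (Y.1ᴴ * ζ Y) + frobInner (Y.1ᴴ * η Y) (vᴴ * ζ Y)) := by
  have h1 : IsCkOn 1 fun Y : stiefel 𝕜 n d => Y.1ᴴ := (isCkOn_val 1).conjTranspose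
  have hD : dirDeriv (fun Y : stiefel 𝕜 n d => Y.1ᴴ) Y v = vᴴ := by
    rw [dirDeriv_conjTranspose (isCkOn_val 1) Y hv, dirDeriv_val Y hv]
  have hb := (h1.matMul hη).frobInner (h1.matMul hζ)
  have hadd := dirDeriv_fun_add ((hη.frobInner hζ).const_smul α₀) (hb.const_smul (α₁ - α₀)) Y hv
  simp only [smul_eq_mul] at hadd
  rw [dirDeriv_congr (fun Z : stiefel 𝕜 n d => stMetric_eq α₀ α₁ Z.1 (η Z) (ζ Z)), hadd]
  have e1 : dirDeriv (fun Z => α₀ * frobInner (η Z) (ζ Z)) Y v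
      = α₀ * dirDeriv (fun Z => frobInner (η Z) (ζ Z)) Y v :=
    dirDeriv_clm (hη.frobInner hζ) (α₀ • ContinuousLinearMap.id ℝ ℝ) Y hv
  have e2 : dirDeriv (fun Z => (α₁ - α₀) * frobInner (Z.1ᴴ * η Z) (Z.1ᴴ * ζ Z)) Y v
      = (α₁ - α₀) * dirDeriv (fun Z => frobInner (Z.1ᴴ * η Z) (Z.1ᴴ * ζ Z)) Y v :=
    dirDeriv_clm hb ((α₁ - α₀) • ContinuousLinearMap.id ℝ ℝ) Y hv
  rw [e1, e2, dirDeriv_frobInner hη hζ Y hv, dirDeriv_frobInner (h1.matMul hη) (h1.matMul hζ) Y hv,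
    dirDeriv_matMul h1 hη Y hv, dirDeriv_matMul h1 hζ Y hv, hD, stMetric_eq, stMetric_eq,
    frobInner_add_left, frobInner_add_right]
  ring

theorem VField.skew (ξ : VField (stiefel 𝕜 n d)) (Y : stiefel 𝕜 n d) :
    (Y.1ᴴ * ξ Y)ᴴ = -(Y.1ᴴ * ξ Y) := (mem_tangentVectors_stiefel Y.2 _).1 (ξ.tangent Y)

theorem dirDeriv_conjTranspose_mul {η : stiefel 𝕜 n d → Matrix (Fin n) (Fin d) 𝕜}
    (hη : IsCkOn 1 η) (Y : stiefel 𝕜 n d) {v : Matrix (Fin n) (Fin d) 𝕜}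
    (hv : v ∈ tangentVectors (stiefel 𝕜 n d) Y.1) :
    dirDeriv (fun Z => Z.1ᴴ * η Z) Y v = vᴴ * η Y + Y.1ᴴ * dirDeriv η Y v := by
  rw [dirDeriv_matMul (isCkOn_val 1).conjTranspose hη Y hv,
    dirDeriv_conjTranspose (isCkOn_val 1) Y hv, dirDeriv_val Y hv]

theorem VField.dirDeriv_skew (η : VField (stiefel 𝕜 n d)) (Y : stiefel 𝕜 n d)
    {v : Matrix (Fin n) (Fin d) 𝕜} (hv : v ∈ tangentVectors (stiefel 𝕜 n d) Y.1) :
    (vᴴ * η Y + Y.1ᴴ * dirDeriv η Y v)ᴴ = -(vᴴ * η Y + Y.1ᴴ * dirDeriv η Y v) := by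
  have hη := η.smooth.mono (l := 1) le_top
  have h1 : IsCkOn 1 fun Z : stiefel 𝕜 n d => Z.1ᴴ * η Z := (isCkOn_val 1).conjTranspose.matMul hη
  rw [← dirDeriv_conjTranspose_mul hη Y hv, ← dirDeriv_conjTranspose h1 Y hv,
    dirDeriv_congr (fun Z => η.skew Z)]
  exact dirDeriv_clm h1 (-ContinuousLinearMap.id ℝ (Matrix (Fin d) (Fin d) 𝕜)) Y hv

theorem IsCkOn.lcChristoffel {k : ℕ∞} {φ ψ : stiefel 𝕜 n d → Matrix (Fin n) (Fin d) 𝕜}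
    (h : IsCkOn k φ) (h' : IsCkOn k ψ) (α₀ α₁ : ℝ) :
    IsCkOn k (fun Y => lcChristoffel α₀ α₁ Y.1 (φ Y) (ψ Y)) := by
  have h0 : IsCkOn k fun Y : stiefel 𝕜 n d => Y.1 := isCkOn_val k
  exact ((h0.matMul ((h.conjTranspose.matMul h').add (h'.conjTranspose.matMul h))).const_smul _).add
    (((((isCkOn_const k 1).sub (h0.matMul h0.conjTranspose)).matMul
      ((h.matMul h'.conjTranspose).add (h'.matMul h.conjTranspose))).matMul h0).const_smul _)

/-- The Levi-Civita connection of the Stiefel manifold. -/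
noncomputable def lcConn (α₀ α₁ : ℝ) (ξ η : VField (stiefel 𝕜 n d)) : VField (stiefel 𝕜 n d) where
  toFun := fun Y => dirDeriv η Y (ξ Y) + lcChristoffel α₀ α₁ Y.1 (ξ Y) (η Y)
  tangent := fun Y => by
    rw [mem_tangentVectors_stiefel Y.2, Matrix.mul_add, conjTranspose_mul_lcChristoffel Y.2]
    have h := η.dirDeriv_skew Y (ξ.tangent Y)
    -- The first summand is skew, being the derivative of the skew-valued `Zᴴ * η Z`. Replacing its
    -- `(ξ Y)ᴴ * η Y` by the Hermitian part costs only a skew matrix.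
    have h1 : Y.1ᴴ * dirDeriv η Y (ξ Y) + (1 / 2 : ℝ) • ((ξ Y)ᴴ * η Y + (η Y)ᴴ * ξ Y)
        = ((ξ Y)ᴴ * η Y + Y.1ᴴ * dirDeriv η Y (ξ Y))
          + (1 / 2 : ℝ) • ((η Y)ᴴ * ξ Y - (ξ Y)ᴴ * η Y) := by module
    rw [h1, Matrix.conjTranspose_add, h]
    simp only [conjTranspose_real_smul, Matrix.conjTranspose_sub, Matrix.conjTranspose_mul,
      Matrix.conjTranspose_conjTranspose]
    module
  smooth := (η.smooth.dirDeriv ξ.smooth ξ.tangent).add (ξ.smooth.lcChristoffel η.smooth α₀ α₁)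

theorem lcConn_apply (ξ η : VField (stiefel 𝕜 n d)) (Y : stiefel 𝕜 n d) :
    lcConn α₀ α₁ ξ η Y = dirDeriv η Y (ξ Y) + lcChristoffel α₀ α₁ Y.1 (ξ Y) (η Y) := rfl

theorem lcConn_metric (hα₀ : 0 < α₀) (ξ η ζ : VField (stiefel 𝕜 n d)) (Y : stiefel 𝕜 n d) :
    dirDeriv (fun Z => stMetric α₀ α₁ Z.1 (η Z) (ζ Z)) Y (ξ Y)
      = stMetric α₀ α₁ Y.1 (lcConn α₀ α₁ ξ η Y) (ζ Y)
        + stMetric α₀ α₁ Y.1 (η Y) (lcConn α₀ α₁ ξ ζ Y) := by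
  rw [dirDeriv_stMetric (η.smooth.mono le_top) (ζ.smooth.mono le_top) Y (ξ.tangent Y),
    ← stMetric_lcChristoffel_add hα₀ Y.2 (ξ.skew Y) (η.skew Y) (ζ.skew Y),
    lcConn_apply, lcConn_apply, stMetric_add_left, stMetric_comm α₀ α₁ Y.1 (η Y) (_ + _),
    stMetric_add_left, stMetric_comm α₀ α₁ Y.1 (η Y), stMetric_comm α₀ α₁ Y.1 (η Y)]
  ring

theorem lcConn_isLeviCivita (hα₀ : 0 < α₀) :
    IsLeviCivita (fun Y : stiefel 𝕜 n d => stMetric α₀ α₁ Y.1) (lcConn α₀ α₁) where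
  add_left := fun ξ₁ ξ₂ ξ η h Y => by
    simp only [lcConn_apply, h, dirDeriv_add, lcChristoffel_add_left]
    abel
  smul_left := fun φ ξ₁ ξ η _ h Y => by
    simp only [lcConn_apply, h, dirDeriv_smul, lcChristoffel_smul_left, smul_add]
  add_right := fun ξ η₁ η₂ η h Y => by
    simp only [lcConn_apply, h, lcChristoffel_comm _ (ξ Y), lcChristoffel_add_left]
    rw [dirDeriv_congr h, dirDeriv_fun_add (η₁.smooth.mono le_top) (η₂.smooth.mono le_top) Y
      (ξ.tangent Y)]
    abel
  leibniz := fun φ ξ η₁ η hφ h Y => by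
    simp only [lcConn_apply, h, lcChristoffel_comm _ (ξ Y), lcChristoffel_smul_left]
    rw [dirDeriv_congr h, dirDeriv_fun_smul (hφ.mono le_top) (η₁.smooth.mono le_top) Y
      (ξ.tangent Y), smul_add]
    abel
  torsion_free := fun ξ η Y => by
    simp only [lcConn_apply, lcChristoffel_comm _ (ξ Y)]
    abel
  metric := fun ξ η ζ Y => lcConn_metric hα₀ ξ η ζ Y

/-- The difference of two vector fields. -/
def VField.sub (ξ η : VField (stiefel 𝕜 n d)) : VField (stiefel 𝕜 n d) :=
  ⟨fun Y => ξ Y - η Y, fun Y => by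
    rw [mem_tangentVectors_stiefel Y.2, Matrix.mul_sub, Matrix.conjTranspose_sub, ξ.skew, η.skew]
    abel, ξ.smooth.sub η.smooth⟩

theorem VField.sub_apply (ξ η : VField (stiefel 𝕜 n d)) (Y : stiefel 𝕜 n d) :
    ξ.sub η Y = ξ Y - η Y := rfl

/-- A trilinear form symmetric in the first two and skew in the last two arguments vanishes. -/
theorem eq_zero_of_symm_of_skew {ι : Type*} {S : ι → ι → ι → ℝ} (h1 : ∀ a b c, S a b c = S b a c)
    (h2 : ∀ a b c, S a b c = -S a c b) (a b c : ι) : S a b c = 0 := by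
  have e1 := h2 a b c
  have e2 := h1 a c b
  have e3 := h2 c a b
  have e4 := h1 c b a
  have e5 := h2 b c a
  have e6 := h1 b a c
  linarith

/-- The difference, paired with a third field, is symmetric in the first two arguments by vanishing
of relative torsion and skew in the last two by metricity, hence zero. Testing it on itself
concludes by definiteness; tensoriality is not needed. -/
theorem IsLeviCivita.eq_lcConn (hα₀ : 0 < α₀) (hα₁ : 0 < α₁)
    {conn : VField (stiefel 𝕜 n d) → VField (stiefel 𝕜 n d) → VField (stiefel 𝕜 n d)}
    (h : IsLeviCivita (fun Y => stMetric α₀ α₁ Y.1) conn) : conn = lcConn α₀ α₁ := by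
  have h' := lcConn_isLeviCivita (𝕜 := 𝕜) (n := n) (d := d) (α₁ := α₁) hα₀
  funext ξ η
  ext1
  funext Y
  have key := eq_zero_of_symm_of_skew
    (S := fun ξ η ζ => stMetric α₀ α₁ Y.1 ((conn ξ η).sub (lcConn α₀ α₁ ξ η) Y) (ζ Y))
    (fun ξ η ζ => by
      congr 1
      rw [VField.sub_apply, VField.sub_apply, sub_eq_sub_iff_sub_eq_sub, h.torsion_free,
        h'.torsion_free])
    (fun ξ η ζ => by
      have e1 := h.metric ξ η ζ Y
      have e2 := h'.metric ξ η ζ Y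
      simp only [VField.sub_apply, stMetric_sub_left]
      rw [stMetric_comm α₀ α₁ Y.1 (conn ξ ζ Y), stMetric_comm α₀ α₁ Y.1 (lcConn α₀ α₁ ξ ζ Y)]
      linarith)
    ξ η ((conn ξ η).sub (lcConn α₀ α₁ ξ η))
  exact sub_eq_zero.1 (stMetric_self_eq_zero hα₀ hα₁ Y.2 key)

theorem existsUnique_isLeviCivita (hα₀ : 0 < α₀) (hα₁ : 0 < α₁) :
    ∃! conn : VField (stiefel 𝕜 n d) → VField (stiefel 𝕜 n d) → VField (stiefel 𝕜 n d),
      IsLeviCivita (fun Y => stMetric α₀ α₁ Y.1) conn :=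
  ⟨_, lcConn_isLeviCivita hα₀, fun _ h => h.eq_lcConn hα₀ hα₁⟩

/-! ### The horizontal part of the connection, and Hessians -/

/-- The horizontal part of the Levi-Civita connection, for horizontal fields. -/
noncomputable def horizConn (α₀ α₁ : ℝ) (ξ η : VField (stiefel 𝕜 n d)) (Y : stiefel 𝕜 n d) :
    Matrix (Fin n) (Fin d) 𝕜 :=
  dirDeriv η Y (ξ Y) + Y.1 * symf dhat ((ξ Y)ᴴ * η Y)
    + ((α₀ - α₁) / α₀) • ((1 - Y.1 * Y.1ᴴ) * (ξ Y * (η Y)ᴴ + η Y * (ξ Y)ᴴ) * Y.1)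

/-- Differentiating `symf dhat (Zᴴ * η Z) = 0` along `ξ` expresses `symf` of `Yᴴ * D_ξ η` through
`(ξ Y)ᴴ * η Y`. The Hermitian part of the Christoffel term is fixed by `symf`, so the projection
cancels it and leaves `Y * symf dhat ((ξ Y)ᴴ * η Y)` in its place. -/
theorem horizProj_lcConn (hα₀ : 0 < α₀) (hα₁ : 0 < α₁) (ξ : VField (stiefel 𝕜 n d))
    {η : VField (stiefel 𝕜 n d)} (hη : IsHorizontal α₀ α₁ dhat η) (Y : stiefel 𝕜 n d) :
    horizProj α₀ α₁ dhat Y.1 (lcConn α₀ α₁ ξ η Y) = horizConn dhat α₀ α₁ ξ η Y := by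
  have hη1 := η.smooth.mono (l := 1) le_top
  have h0 := dirDeriv_symf ((isCkOn_val 1).conjTranspose.matMul hη1) dhat Y (ξ.tangent Y)
  rw [dirDeriv_conjTranspose_mul hη1 Y (ξ.tangent Y),
    dirDeriv_congr (fun Z => hη.symf_eq_zero dhat hα₁ Z), dirDeriv_const _ _ (ξ.tangent Y),
    symf_add] at h0
  have h1 : symf dhat (Y.1ᴴ * dirDeriv η Y (ξ Y)) = -symf dhat ((ξ Y)ᴴ * η Y) :=
    (neg_eq_of_add_eq_zero_right h0.symm).symm
  have h2 : symf dhat ((ξ Y)ᴴ * η Y + (η Y)ᴴ * ξ Y) = (ξ Y)ᴴ * η Y + (η Y)ᴴ * ξ Y :=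
    symf_of_hermitian dhat (by simp only [Matrix.conjTranspose_add, Matrix.conjTranspose_mul,
      Matrix.conjTranspose_conjTranspose, add_comm])
  rw [horizProj_eq dhat hα₀ hα₁ Y.2, lcConn_apply, Matrix.mul_add Y.1ᴴ,
    conjTranspose_mul_lcChristoffel Y.2, symf_add, h1, symf_smul, h2, lcChristoffel, horizConn]
  simp only [Matrix.mul_add, Matrix.mul_neg, Matrix.mul_smul]
  module

theorem symf_horizConn (hα₀ : 0 < α₀) (hα₁ : 0 < α₁) (ξ : VField (stiefel 𝕜 n d))
    {η : VField (stiefel 𝕜 n d)} (hη : IsHorizontal α₀ α₁ dhat η) (Y : stiefel 𝕜 n d) :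
    symf dhat (Y.1ᴴ * horizConn dhat α₀ α₁ ξ η Y) = 0 := by
  rw [← horizProj_lcConn dhat hα₀ hα₁ ξ hη]
  exact symf_horizProj dhat hα₀ hα₁ Y.2 _

/-- Metricity survives the projection, since replacing a vector by its horizontal part does not
alter its pairing with a horizontal one. -/
theorem horizConn_metric (hα₀ : 0 < α₀) (hα₁ : 0 < α₁) (ξ : VField (stiefel 𝕜 n d))
    {η ζ : VField (stiefel 𝕜 n d)} (hη : IsHorizontal α₀ α₁ dhat η)
    (hζ : IsHorizontal α₀ α₁ dhat ζ) (Y : stiefel 𝕜 n d) :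
    dirDeriv (fun Z => stMetric α₀ α₁ Z.1 (η Z) (ζ Z)) Y (ξ Y)
      = stMetric α₀ α₁ Y.1 (horizConn dhat α₀ α₁ ξ η Y) (ζ Y)
        + stMetric α₀ α₁ Y.1 (η Y) (horizConn dhat α₀ α₁ ξ ζ Y) := by
  rw [lcConn_metric hα₀, ← horizProj_lcConn dhat hα₀ hα₁ ξ hη, ← horizProj_lcConn dhat hα₀ hα₁ ξ hζ,
    horizProj_eq dhat hα₀ hα₁ Y.2, horizProj_eq dhat hα₀ hα₁ Y.2,
    stMetric_sub_proj dhat Y.2 _ (hζ.symf_eq_zero dhat hα₁ Y), stMetric_comm α₀ α₁ Y.1 (η Y) (_ - _),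
    stMetric_sub_proj dhat Y.2 _ (hη.symf_eq_zero dhat hα₁ Y), stMetric_comm α₀ α₁ Y.1 (η Y)]

/-- Differentiate along `ξ` the identity that the metric pairing of `R` with `η` is the trace
pairing of `fY` with `η`. By metricity, the Hessian is the derivative of `fY` paired with `η` minus
`fY` paired with the correction `horizConn - D_ξ η`. -/
theorem horizHessian_form (hα₀ : 0 < α₀) (hα₁ : 0 < α₁) {f : stiefel 𝕜 n d → ℝ}
    {fY : stiefel 𝕜 n d → Matrix (Fin n) (Fin d) 𝕜} (hf : IsAmbientGradient f fY)
    (hfY : IsCkOn 1 fY) {R : VField (stiefel 𝕜 n d)} (hR : IsHorizGradient α₀ α₁ dhat f R)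
    (ξ : VField (stiefel 𝕜 n d)) {η : VField (stiefel 𝕜 n d)} (hη : IsHorizontal α₀ α₁ dhat η)
    (Y : stiefel 𝕜 n d) :
    stMetric α₀ α₁ Y.1 (horizConn dhat α₀ α₁ ξ R Y) (η Y) =
      frobInner (dirDeriv fY Y (ξ Y)) (η Y)
        - trR ((fY Y)ᴴ * (Y.1 * symf dhat ((ξ Y)ᴴ * η Y) + ((α₀ - α₁) / α₀) •
          ((1 - Y.1 * Y.1ᴴ) * (ξ Y * (η Y)ᴴ + η Y * (ξ Y)ᴴ) * Y.1))) := by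
  have hR' := (isHorizGradient_iff dhat hα₀ hα₁ hf R).1 hR
  have h1 : ∀ (Z : stiefel 𝕜 n d) {w}, symf dhat (Z.1ᴴ * w) = 0 →
      stMetric α₀ α₁ Z.1 (R Z) w = frobInner (fY Z) w := fun Z w hw => by
    rw [hR', stMetric_proj_metricOpInv dhat hα₀ hα₁ Z.2 _ hw]
  have h2 := horizConn_metric dhat hα₀ hα₁ ξ hR.1 hη Y
  rw [dirDeriv_congr (fun Z => h1 Z (hη.symf_eq_zero dhat hα₁ Z)),
    dirDeriv_frobInner hfY (η.smooth.mono le_top) Y (ξ.tangent Y),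
    h1 Y (symf_horizConn dhat hα₀ hα₁ ξ hη Y)] at h2
  have h3 : ∀ X, trR ((fY Y)ᴴ * X) = frobInner (fY Y) X := fun X => by
    rw [frobInner_comm, frobInner, trR_mul_comm]
  rw [h3, eq_sub_of_add_eq h2.symm, horizConn, add_assoc, frobInner_add_right]
  ring

/-- Both sides are horizontal, so it suffices to pair them with horizontal vectors. In the form
version, each term is moved onto `η` by an adjoint: `e1` for the `symf` term, `e2` and `e3` for the
two projected ones. -/
theorem horizHessian_operator (hα₀ : 0 < α₀) (hα₁ : 0 < α₁) {f : stiefel 𝕜 n d → ℝ}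
    {fY : stiefel 𝕜 n d → Matrix (Fin n) (Fin d) 𝕜} (hf : IsAmbientGradient f fY)
    (hfY : IsCkOn 1 fY) {R : VField (stiefel 𝕜 n d)} (hR : IsHorizGradient α₀ α₁ dhat f R)
    (ξ : VField (stiefel 𝕜 n d)) (Y : stiefel 𝕜 n d) :
    horizConn dhat α₀ α₁ ξ R Y = horizProj α₀ α₁ dhat Y.1 (metricOpInv α₀ α₁ Y.1
      (dirDeriv fY Y (ξ Y) - ξ Y * symf dhat (Y.1ᴴ * fY Y) - ((α₀ - α₁) / α₀) •
        (((1 - Y.1 * Y.1ᴴ) * fY Y * Y.1ᴴ + Y.1 * (fY Y)ᴴ * (1 - Y.1 * Y.1ᴴ)) * ξ Y))) := by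
  refine eq_of_stMetric_eq dhat hα₀ hα₁ Y.2 (symf_horizConn dhat hα₀ hα₁ ξ hR.1 Y)
    (symf_horizProj dhat hα₀ hα₁ Y.2 _) fun w hw => ?_
  obtain ⟨η, hη, rfl⟩ := exists_isHorizontal_through (α₀ := α₀) dhat hα₁ Y hw
  rw [horizHessian_form dhat hα₀ hα₁ hf hfY hR ξ hη, stMetric_proj_metricOpInv dhat hα₀ hα₁ Y.2 _ hw]
  have h3 : ∀ X, trR ((fY Y)ᴴ * X) = frobInner (fY Y) X := fun X => by
    rw [frobInner_comm, frobInner, trR_mul_comm]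
  have h4 : (1 - Y.1 * Y.1ᴴ)ᴴ = 1 - Y.1 * Y.1ᴴ := by simp
  have e1 : frobInner (fY Y) (Y.1 * symf dhat ((ξ Y)ᴴ * η Y))
      = frobInner (ξ Y * symf dhat (Y.1ᴴ * fY Y)) (η Y) := by
    rw [frobInner_comm, frobInner_mul_left, frobInner_symf, frobInner_comm, frobInner_mul_left]
  have e2 : frobInner (fY Y) ((1 - Y.1 * Y.1ᴴ) * (ξ Y * (η Y)ᴴ) * Y.1)
      = frobInner (Y.1 * (fY Y)ᴴ * (1 - Y.1 * Y.1ᴴ) * ξ Y) (η Y) := by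
    rw [frobInner_comm, frobInner_mul_right, Matrix.mul_assoc, frobInner_mul_left, h4,
      frobInner_mul_left, ← frobInner_conjTranspose, frobInner_comm]
    simp only [Matrix.conjTranspose_mul, Matrix.conjTranspose_conjTranspose, h4, Matrix.mul_assoc]
  have e3 : frobInner (fY Y) ((1 - Y.1 * Y.1ᴴ) * (η Y * (ξ Y)ᴴ) * Y.1)
      = frobInner ((1 - Y.1 * Y.1ᴴ) * fY Y * Y.1ᴴ * ξ Y) (η Y) := by
    rw [Matrix.mul_assoc, frobInner_comm, frobInner_mul_left, h4, Matrix.mul_assoc,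
      frobInner_mul_right, frobInner_comm]
    simp only [Matrix.conjTranspose_mul, Matrix.conjTranspose_conjTranspose, Matrix.mul_assoc]
  rw [h3, frobInner_add_right, frobInner_smul_right, Matrix.mul_add (1 - Y.1 * Y.1ᴴ),
    Matrix.add_mul _ _ Y.1, frobInner_add_right, e1, e2, e3, frobInner_sub_left, frobInner_sub_left,
    frobInner_smul_left, Matrix.add_mul, frobInner_add_left]
  ring

end StiefelGeometry

/-! ## The quotient of the Stiefel manifold -/

section StiefelQuotient

variable {𝕜 : Type*} [RCLike 𝕜] {n d q : ℕ} {dhat : Fin q → ℕ} {α₀ α₁ : ℝ}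

/-! ### The group action and pullbacks of functions on the quotient -/

theorem mul_mem_stiefel {Y : Matrix (Fin n) (Fin d) 𝕜} (hY : Y ∈ stiefel 𝕜 n d)
    {U : Matrix (Fin d) (Fin d) 𝕜} (hU : U ∈ blockGroup 𝕜 d dhat) : Y * U ∈ stiefel 𝕜 n d := by
  have hY' : Yᴴ * Y = 1 := hY
  show _ * _ = _
  rw [Matrix.conjTranspose_mul, Matrix.mul_assoc, ← Matrix.mul_assoc _ Y, hY', Matrix.one_mul, hU.1]

/-- The action of the block-diagonal group on the Stiefel manifold. -/
def stMul (Y : stiefel 𝕜 n d) {U : Matrix (Fin d) (Fin d) 𝕜} (hU : U ∈ blockGroup 𝕜 d dhat) :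
    stiefel 𝕜 n d := ⟨Y.1 * U, mul_mem_stiefel Y.2 hU⟩

theorem mk_stMul (Y : stiefel 𝕜 n d) {U : Matrix (Fin d) (Fin d) 𝕜}
    (hU : U ∈ blockGroup 𝕜 d dhat) :
    Quotient.mk (orbitRel 𝕜 n d dhat) (stMul Y hU) = Quotient.mk (orbitRel 𝕜 n d dhat) Y :=
  (Quotient.sound (s := orbitRel 𝕜 n d dhat) ⟨U, hU, rfl⟩).symm

theorem exists_stMul_of_mk_eq {Y Z : stiefel 𝕜 n d}
    (h : Quotient.mk (orbitRel 𝕜 n d dhat) Y = Quotient.mk (orbitRel 𝕜 n d dhat) Z) :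
    ∃ (U : Matrix (Fin d) (Fin d) 𝕜) (hU : U ∈ blockGroup 𝕜 d dhat), Z = stMul Y hU := by
  obtain ⟨U, hU, hh⟩ := Quotient.exact (s := orbitRel 𝕜 n d dhat) h
  exact ⟨U, hU, Subtype.ext hh⟩

variable (n) in
/-- Right multiplication by a matrix. -/
noncomputable def rightMulL (U : Matrix (Fin d) (Fin d) 𝕜) :
    NormedCLM (Matrix (Fin n) (Fin d) 𝕜) (Matrix (Fin n) (Fin d) 𝕜) := (mulL 𝕜 n d d).flip U

theorem tangent_mul_right {Y : stiefel 𝕜 n d} {U : Matrix (Fin d) (Fin d) 𝕜}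
    (hU : U ∈ blockGroup 𝕜 d dhat) {v : Matrix (Fin n) (Fin d) 𝕜}
    (hv : v ∈ tangentVectors (stiefel 𝕜 n d) Y.1) :
    v * U ∈ tangentVectors (stiefel 𝕜 n d) (stMul Y hU).1 :=
  tangentVectors_image (rightMulL n U) (fun _ hZ => mul_mem_stiefel hZ hU) hv

theorem symf_mul_right {Y w : Matrix (Fin n) (Fin d) 𝕜} {U : Matrix (Fin d) (Fin d) 𝕜}
    (hU : U ∈ blockGroup 𝕜 d dhat) (hw : symf dhat (Yᴴ * w) = 0) :
    symf dhat ((Y * U)ᴴ * (w * U)) = 0 := by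
  have h : (Y * U)ᴴ * (w * U) = Uᴴ * (Yᴴ * w) * U := by
    simp only [Matrix.conjTranspose_mul, Matrix.mul_assoc]
  rw [h, symf_conj dhat hU, hw, Matrix.mul_zero, Matrix.zero_mul]

theorem dirDeriv_stMul {F : Type*} [NormedAddCommGroup F] [NormedSpace ℝ F]
    {φ : stiefel 𝕜 n d → F} (hφ : IsCkOn 1 φ) {U : Matrix (Fin d) (Fin d) 𝕜}
    (hU : U ∈ blockGroup 𝕜 d dhat) (Y : stiefel 𝕜 n d) {v : Matrix (Fin n) (Fin d) 𝕜}
    (hv : v ∈ tangentVectors (stiefel 𝕜 n d) Y.1) :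
    dirDeriv φ (stMul Y hU) (v * U) = dirDeriv (fun Z => φ (stMul Z hU)) Y v :=
  (dirDeriv_comp_map hφ (rightMulL n U) (fun _ hZ => mul_mem_stiefel hZ hU) Y hv).symm

/-- The smooth function on the quotient given by an invariant smooth function. -/
def QFun.ofInvariant (g : stiefel 𝕜 n d → ℝ) (hg : IsCkOn ⊤ g)
    (hinv : ∀ (Y : stiefel 𝕜 n d) {U : Matrix (Fin d) (Fin d) 𝕜} (hU : U ∈ blockGroup 𝕜 d dhat),
      g (stMul Y hU) = g Y) : QFun (orbitRel 𝕜 n d dhat) :=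
  ⟨Quotient.lift g fun Y Z h => by
    obtain ⟨U, hU, rfl⟩ := exists_stMul_of_mk_eq (Quotient.sound h)
    exact (hinv Y hU).symm, hg⟩

theorem QFun.pullback_stMul (f : QFun (orbitRel 𝕜 n d dhat)) (Y : stiefel 𝕜 n d)
    {U : Matrix (Fin d) (Fin d) 𝕜} (hU : U ∈ blockGroup 𝕜 d dhat) :
    f.pullback (stMul Y hU) = f.pullback Y := congrArg f.1 (mk_stMul Y hU)

theorem QFun.pullback_smooth (f : QFun (orbitRel 𝕜 n d dhat)) : IsCkOn ⊤ f.pullback := f.2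

theorem QFun.dirDeriv_pullback_stMul (f : QFun (orbitRel 𝕜 n d dhat)) (Y : stiefel 𝕜 n d)
    {U : Matrix (Fin d) (Fin d) 𝕜} (hU : U ∈ blockGroup 𝕜 d dhat)
    {v : Matrix (Fin n) (Fin d) 𝕜} (hv : v ∈ tangentVectors (stiefel 𝕜 n d) Y.1) :
    dirDeriv f.pullback (stMul Y hU) (v * U) = dirDeriv f.pullback Y v := by
  rw [dirDeriv_stMul (f.pullback_smooth.mono le_top) hU Y hv]
  exact dirDeriv_congr (fun Z => f.pullback_stMul Z hU) _ _

/-- A vertical vector is the velocity of a curve inside one orbit, where the pullback is constant.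
-/
theorem QFun.dirDeriv_pullback_vertical (f : QFun (orbitRel 𝕜 n d dhat)) (Y : stiefel 𝕜 n d)
    {A : Matrix (Fin d) (Fin d) 𝕜} (h : Aᴴ = -A) (hA : symf dhat A = A) :
    dirDeriv f.pullback Y (Y.1 * A) = 0 := by
  obtain ⟨γ, hγ, hM, hY, hv⟩ := (mem_verticalSpace dhat Y.2 _).2 ⟨A, h, hA, rfl⟩
  have hM' : ∀ t, γ t ∈ stiefel 𝕜 n d := fun t => by
    obtain ⟨U, hU, hh⟩ := hM t
    rw [hh]
    exact mul_mem_stiefel Y.2 hU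
  have h1 := (f.pullback_smooth.mono (l := 1) le_top).hasDerivAt_curve hγ hM' Y hY
  rw [hv] at h1
  refine h1.unique ((hasDerivAt_const (0 : ℝ) (f.pullback Y)).congr_of_eventuallyEq
    (Filter.Eventually.of_forall fun t => ?_))
  obtain ⟨U, hU, hh⟩ := hM t
  rw [← f.pullback_stMul Y hU]
  exact congrArg f.pullback (Subtype.ext hh)

theorem QFun.dirDeriv_pullback_proj (f : QFun (orbitRel 𝕜 n d dhat)) (Y : stiefel 𝕜 n d)
    {v : Matrix (Fin n) (Fin d) 𝕜} (hv : v ∈ tangentVectors (stiefel 𝕜 n d) Y.1) :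
    dirDeriv f.pullback Y (v - Y.1 * symf dhat (Y.1ᴴ * v)) = dirDeriv f.pullback Y v := by
  have h := (mem_tangentVectors_stiefel Y.2 v).1 hv
  rw [dirDeriv_sub, f.dirDeriv_pullback_vertical Y _ (symf_symf dhat _), sub_zero]
  rw [symf_conjTranspose, h, ← zero_sub, symf_sub, symf_zero, zero_sub]

/-! ### Invariant functions determine horizontal vectors -/

theorem isCkOn_mul_blkProj (k : ℕ) :
    IsCkOn ⊤ fun Z : stiefel 𝕜 n d => Z.1 * blkProj 𝕜 d dhat k :=
  (isCkOn_val ⊤).matMul (isCkOn_const ⊤ _)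

theorem isCkOn_mul_blkProj_mul (k : ℕ) :
    IsCkOn ⊤ fun Z : stiefel 𝕜 n d => Z.1 * blkProj 𝕜 d dhat k * Z.1ᴴ :=
  (isCkOn_mul_blkProj k).matMul (isCkOn_val ⊤).conjTranspose

/-- With `P k` the block projections, the derivative of `Z * P k * Zᴴ` along `w`, applied to `Y * P
k`, is `w * P k + Y * P k * (wᴴ * Y) * P k`. For `k < q` the second term vanishes, as a horizontal
`w` has zero diagonal blocks in `Yᴴ * w`. The last block is fixed pointwise by the group, so `Z * P
q` itself is invariant and yields `w * P q`; summing recovers `w`. -/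
theorem horizontal_eq_sum (Y : stiefel 𝕜 n d) {w : Matrix (Fin n) (Fin d) 𝕜}
    (hw : symf dhat (Y.1ᴴ * w) = 0) :
    w = ∑ k ∈ Finset.range q,
        dirDeriv (fun Z : stiefel 𝕜 n d => Z.1 * blkProj 𝕜 d dhat k * Z.1ᴴ) Y w
          * (Y.1 * blkProj 𝕜 d dhat k)
      + dirDeriv (fun Z : stiefel 𝕜 n d => Z.1 * blkProj 𝕜 d dhat q) Y w := by
  have hT := horizontal_tangent dhat Y.2 hw
  have hd : ∀ k, dirDeriv (fun Z : stiefel 𝕜 n d => Z.1 * blkProj 𝕜 d dhat k) Y w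
      = w * blkProj 𝕜 d dhat k := fun k => by
    rw [dirDeriv_matMul (isCkOn_val 1) (isCkOn_const 1 _) Y hT, dirDeriv_val Y hT,
      dirDeriv_const _ Y hT, Matrix.mul_zero, add_zero]
  have hP : ∀ k ∈ Finset.range q,
      dirDeriv (fun Z : stiefel 𝕜 n d => Z.1 * blkProj 𝕜 d dhat k * Z.1ᴴ) Y w
          * (Y.1 * blkProj 𝕜 d dhat k) = w * blkProj 𝕜 d dhat k := fun k hk => by
    have h1 : wᴴ * Y.1 = -(Y.1ᴴ * w) := by
      simpa using (mem_tangentVectors_stiefel Y.2 w).1 hT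
    have h2 : blkProj 𝕜 d dhat k * (Y.1ᴴ * w) * blkProj 𝕜 d dhat k = 0 := by
      ext a b
      rw [blkProj_mul_mul_apply, Matrix.zero_apply]
      split_ifs with h
      · exact ((symf_eq_zero_iff dhat _).1 hw).2 a b (h.1.trans h.2.symm)
          (h.1 ▸ Finset.mem_range.1 hk)
      · rfl
    rw [dirDeriv_matMul ((isCkOn_mul_blkProj k).mono le_top) (isCkOn_val 1).conjTranspose Y hT,
      hd, dirDeriv_conjTranspose (isCkOn_val 1) Y hT, dirDeriv_val Y hT, Matrix.add_mul]
    have e1 : w * blkProj 𝕜 d dhat k * Y.1ᴴ * (Y.1 * blkProj 𝕜 d dhat k)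
        = w * (blkProj 𝕜 d dhat k * (Y.1ᴴ * Y.1) * blkProj 𝕜 d dhat k) := by
      simp only [Matrix.mul_assoc]
    have e2 : Y.1 * blkProj 𝕜 d dhat k * wᴴ * (Y.1 * blkProj 𝕜 d dhat k)
        = Y.1 * (blkProj 𝕜 d dhat k * (wᴴ * Y.1) * blkProj 𝕜 d dhat k) := by
      simp only [Matrix.mul_assoc]
    have hY : Y.1ᴴ * Y.1 = 1 := Y.2
    rw [e1, e2, h1, hY, Matrix.mul_one, blkProj_mul_self, Matrix.mul_neg, Matrix.neg_mul, h2,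
      neg_zero, Matrix.mul_zero, add_zero]
  rw [Finset.sum_congr rfl hP, hd, ← Matrix.mul_sum, ← Matrix.mul_add, sum_blkProj, Matrix.mul_one]

theorem stMul_mul_blkProj_mul (k : ℕ) (Y : stiefel 𝕜 n d) {U : Matrix (Fin d) (Fin d) 𝕜}
    (hU : U ∈ blockGroup 𝕜 d dhat) :
    (stMul Y hU).1 * blkProj 𝕜 d dhat k * (stMul Y hU).1ᴴ
      = Y.1 * blkProj 𝕜 d dhat k * Y.1ᴴ := by
  show Y.1 * U * blkProj 𝕜 d dhat k * (Y.1 * U)ᴴ = _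
  rw [Matrix.conjTranspose_mul, Matrix.mul_assoc Y.1, ← commute_blkProj dhat hU.2.1,
    Matrix.mul_assoc, Matrix.mul_assoc _ U, ← Matrix.mul_assoc U, mul_eq_one_comm.mp hU.1,
    Matrix.one_mul, Matrix.mul_assoc]

theorem stMul_mul_blkProj_last (Y : stiefel 𝕜 n d) {U : Matrix (Fin d) (Fin d) 𝕜}
    (hU : U ∈ blockGroup 𝕜 d dhat) :
    (stMul Y hU).1 * blkProj 𝕜 d dhat q = Y.1 * blkProj 𝕜 d dhat q := by
  have h : U * blkProj 𝕜 d dhat q = blkProj 𝕜 d dhat q := by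
    ext a b
    rw [blkProj, Matrix.mul_diagonal, Matrix.diagonal_apply]
    by_cases hb : blk dhat b = q
    · by_cases ha : blk dhat a = q
      · rw [hU.2.2 a b ha hb, if_pos hb, mul_one, if_pos ha]
      · rw [hU.2.1 a b (fun h => ha (h.trans hb)), if_neg ha]
        simp
    · rw [if_neg hb, mul_zero]
      split_ifs with h1 h2
      · exact absurd (h1 ▸ h2) hb
      · rfl
      · rfl
  show Y.1 * U * _ = _
  rw [Matrix.mul_assoc, h]

section TestFunctions

variable {F : Type*} [NormedAddCommGroup F] [NormedSpace ℝ F] {φ : stiefel 𝕜 n d → F}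

/-- Composing an invariant vector-valued map with real functionals gives functions on the quotient,
and functionals separate points. -/
theorem dirDeriv_eq_of_forall_qfun (hφ : IsCkOn ⊤ φ)
    (hinv : ∀ (Y : stiefel 𝕜 n d) {U : Matrix (Fin d) (Fin d) 𝕜} (hU : U ∈ blockGroup 𝕜 d dhat),
      φ (stMul Y hU) = φ Y) {Y : stiefel 𝕜 n d} {v w : Matrix (Fin n) (Fin d) 𝕜}
    (hv : v ∈ tangentVectors (stiefel 𝕜 n d) Y.1) (hw : w ∈ tangentVectors (stiefel 𝕜 n d) Y.1)
    (h : ∀ f : QFun (orbitRel 𝕜 n d dhat), dirDeriv f.pullback Y v = dirDeriv f.pullback Y w) :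
    dirDeriv φ Y v = dirDeriv φ Y w := by
  refine sub_eq_zero.1 (SeparatingDual.eq_zero_of_forall_dual_eq_zero (R := ℝ) fun L => ?_)
  have h1 := h (QFun.ofInvariant (fun Z => L (φ Z)) (hφ.clm L) fun Z U hU => by rw [hinv Z hU])
  have h2 : ∀ {v}, v ∈ tangentVectors (stiefel 𝕜 n d) Y.1 →
      dirDeriv (fun Z => L (φ Z)) Y v = L (dirDeriv φ Y v) :=
    fun hv => dirDeriv_clm (hφ.mono le_top) L Y hv
  rw [map_sub, sub_eq_zero, ← h2 hv, ← h2 hw]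
  exact h1

theorem isCkOn_dirDeriv_of_forall_qfun [FiniteDimensional ℝ F] (hφ : IsCkOn ⊤ φ)
    (hinv : ∀ (Y : stiefel 𝕜 n d) {U : Matrix (Fin d) (Fin d) 𝕜} (hU : U ∈ blockGroup 𝕜 d dhat),
      φ (stMul Y hU) = φ Y) {ξ : stiefel 𝕜 n d → Matrix (Fin n) (Fin d) 𝕜}
    (hξ : ∀ Y : stiefel 𝕜 n d, ξ Y ∈ tangentVectors (stiefel 𝕜 n d) Y.1)
    (X : QFun (orbitRel 𝕜 n d dhat) → QFun (orbitRel 𝕜 n d dhat))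
    (h : ∀ f Y, dirDeriv f.pullback Y (ξ Y) = X f (Quotient.mk _ Y)) :
    IsCkOn ⊤ fun Y => dirDeriv φ Y (ξ Y) := by
  refine isCkOn_of_dual fun L => ?_
  let f : QFun (orbitRel 𝕜 n d dhat) :=
    QFun.ofInvariant (fun Z => L (φ Z)) (hφ.clm L) fun Z U hU => by rw [hinv Z hU]
  refine (X f).2.congr fun Y => ?_
  rw [← h f Y]
  exact (dirDeriv_clm (hφ.mono le_top) L Y (hξ Y)).symm

end TestFunctions

/-- Horizontal vectors with the same projection to the quotient are equal. -/
theorem horizontal_ext {Y : stiefel 𝕜 n d} {v w : Matrix (Fin n) (Fin d) 𝕜}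
    (hv : symf dhat (Y.1ᴴ * v) = 0) (hw : symf dhat (Y.1ᴴ * w) = 0)
    (h : ∀ f : QFun (orbitRel 𝕜 n d dhat), dirDeriv f.pullback Y v = dirDeriv f.pullback Y w) :
    v = w := by
  have hv' := horizontal_tangent dhat Y.2 hv
  have hw' := horizontal_tangent dhat Y.2 hw
  rw [horizontal_eq_sum Y hv, horizontal_eq_sum Y hw,
    dirDeriv_eq_of_forall_qfun (isCkOn_mul_blkProj q) stMul_mul_blkProj_last hv' hw' h,
    Finset.sum_congr rfl fun k _ => by
      rw [dirDeriv_eq_of_forall_qfun (isCkOn_mul_blkProj_mul k) (stMul_mul_blkProj_mul k) hv' hw' h]]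

/-! ### Horizontal lifts -/

theorem exists_horizontal_vector (X : QVField (orbitRel 𝕜 n d dhat)) (Y : stiefel 𝕜 n d) :
    ∃ w : Matrix (Fin n) (Fin d) 𝕜, symf dhat (Y.1ᴴ * w) = 0 ∧
      ∀ f, dirDeriv f.pullback Y w = X f (Quotient.mk _ Y) := by
  obtain ⟨γ, hM, hγ, hb, hX⟩ := X.kinematic (Quotient.mk _ Y)
  -- The given curve starts only at some point of the orbit of `Y`. Its velocity is translated by
  -- `U` and then projected; neither operation changes derivatives of pullbacks.
  obtain ⟨U, hU, rfl⟩ := exists_stMul_of_mk_eq hb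
  have hv : deriv γ 0 ∈ tangentVectors (stiefel 𝕜 n d) (⟨γ 0, hM 0⟩ : stiefel 𝕜 n d).1 :=
    ⟨γ, hγ, hM, rfl, rfl⟩
  refine ⟨_, symf_sub_proj dhat (stMul ⟨γ 0, hM 0⟩ hU).2 (deriv γ 0 * U), fun f => ?_⟩
  rw [f.dirDeriv_pullback_proj _ (tangent_mul_right hU hv), f.dirDeriv_pullback_stMul _ hU hv, hX]
  exact ((f.pullback_smooth.mono le_top).hasDerivAt_curve hγ hM ⟨γ 0, hM 0⟩ rfl).deriv.symm

theorem isHorizLift_iff (hα₁ : 0 < α₁) {X : QVField (orbitRel 𝕜 n d dhat)}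
    {ξ : VField (stiefel 𝕜 n d)} : IsHorizLift α₀ α₁ dhat X ξ ↔
      ∀ Y : stiefel 𝕜 n d, symf dhat (Y.1ᴴ * ξ Y) = 0 ∧
        ∀ f, dirDeriv f.pullback Y (ξ Y) = X f (Quotient.mk _ Y) := by
  rw [IsHorizLift, isHorizontal_iff dhat hα₁]
  exact ⟨fun h Y => ⟨h.1 Y, fun f => h.2 f Y⟩, fun h => ⟨fun Y => (h Y).1, fun f Y => (h Y).2 f⟩⟩

theorem existsUnique_isHorizLift (hα₁ : 0 < α₁) (X : QVField (orbitRel 𝕜 n d dhat)) :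
    ∃! ξ : VField (stiefel 𝕜 n d), IsHorizLift α₀ α₁ dhat X ξ := by
  choose w hw hX using exists_horizontal_vector X
  have hT : ∀ Y : stiefel 𝕜 n d, w Y ∈ tangentVectors (stiefel 𝕜 n d) Y.1 :=
    fun Y => horizontal_tangent dhat Y.2 (hw Y)
  -- The pointwise choice is smooth because `horizontal_eq_sum` writes it through derivatives of
  -- invariant maps, whose components are the smooth functions `X f`.
  have hs : IsCkOn ⊤ w := by
    refine ((IsCkOn.sum (Finset.range q) fun k =>
      (isCkOn_dirDeriv_of_forall_qfun (isCkOn_mul_blkProj_mul k) (stMul_mul_blkProj_mul k) hT X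
        fun f Y => hX Y f).matMul (isCkOn_mul_blkProj (dhat := dhat) k)).add
      (isCkOn_dirDeriv_of_forall_qfun (isCkOn_mul_blkProj q) stMul_mul_blkProj_last hT X
        fun f Y => hX Y f)).congr fun Y => ?_
    exact horizontal_eq_sum Y (hw Y)
  refine ⟨VField.ofHorizontal dhat w hs hw, (isHorizLift_iff hα₁).2 fun Y => ⟨hw Y, hX Y⟩,
    fun ξ hξ => ?_⟩
  have hξ' := (isHorizLift_iff hα₁).1 hξ
  ext1
  funext Y
  exact horizontal_ext (hξ' Y).1 (hw Y) fun f => ((hξ' Y).2 f).trans (hX Y f).symm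

/-- Vector fields compatible with the group action. -/
def IsEquivariant (dhat : Fin q → ℕ) (ξ : stiefel 𝕜 n d → Matrix (Fin n) (Fin d) 𝕜) : Prop :=
  ∀ (Y : stiefel 𝕜 n d) {U : Matrix (Fin d) (Fin d) 𝕜} (hU : U ∈ blockGroup 𝕜 d dhat),
    ξ (stMul Y hU) = ξ Y * U

/-- The lift at `Y * U` and the translate of the lift at `Y` are both horizontal over the same
quotient vector, so `horizontal_ext` identifies them. -/
theorem IsHorizLift.isEquivariant (hα₁ : 0 < α₁) {X : QVField (orbitRel 𝕜 n d dhat)}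
    {ξ : VField (stiefel 𝕜 n d)} (h : IsHorizLift α₀ α₁ dhat X ξ) : IsEquivariant dhat ξ := by
  intro Y U hU
  have h' := (isHorizLift_iff hα₁).1 h
  refine horizontal_ext (h' _).1 (symf_mul_right hU (h' Y).1) fun f => ?_
  rw [(h' _).2, f.dirDeriv_pullback_stMul Y hU (ξ.tangent Y), (h' Y).2, mk_stMul]

/-- The vector field on the quotient given by an equivariant vector field. -/
noncomputable def QVField.ofEquivariant (ξ : VField (stiefel 𝕜 n d)) (hξ : IsEquivariant dhat ξ) :
    QVField (orbitRel 𝕜 n d dhat) where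
  toFun := fun f => QFun.ofInvariant (fun Y => dirDeriv f.pullback Y (ξ Y))
    (f.pullback_smooth.dirDeriv ξ.smooth ξ.tangent) fun Y U hU => by
      rw [hξ, f.dirDeriv_pullback_stMul Y hU (ξ.tangent Y)]
  kinematic := by
    refine Quotient.ind fun Y => ?_
    obtain ⟨γ, hγ, hM, hY, hv⟩ := ξ.tangent Y
    refine ⟨γ, hM, hγ, congrArg _ (Subtype.ext hY), fun f => ?_⟩
    have h := ((f.pullback_smooth.mono le_top).hasDerivAt_curve hγ hM Y hY).deriv
    rw [hv] at h
    exact h.symm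

theorem isHorizLift_ofEquivariant {ξ : VField (stiefel 𝕜 n d)} (hξ : IsEquivariant dhat ξ)
    (h : IsHorizontal α₀ α₁ dhat ξ) : IsHorizLift α₀ α₁ dhat (QVField.ofEquivariant ξ hξ) ξ :=
  ⟨h, fun _ _ => rfl⟩

theorem QVField.ext_of_forall {X Z : QVField (orbitRel 𝕜 n d dhat)}
    (h : ∀ f Y, X f (Quotient.mk _ Y) = Z f (Quotient.mk _ Y)) : X = Z := by
  refine QVField.ext (funext fun f => Subtype.ext (funext (Quotient.ind fun Y => h f Y)))

theorem IsHorizLift.qvField_eq {X Z : QVField (orbitRel 𝕜 n d dhat)}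
    {ξ : VField (stiefel 𝕜 n d)} (h : IsHorizLift α₀ α₁ dhat X ξ)
    (h' : IsHorizLift α₀ α₁ dhat Z ξ) : X = Z :=
  QVField.ext_of_forall fun f Y => (h.2 f Y).symm.trans (h'.2 f Y)

/-! ### The quotient metric and gradients -/

theorem existsUnique_isQuotientMetric (hα₁ : 0 < α₁) :
    ∃! h : QVField (orbitRel 𝕜 n d dhat) → QVField (orbitRel 𝕜 n d dhat) →
      QFun (orbitRel 𝕜 n d dhat), IsQuotientMetric α₀ α₁ dhat h := by
  choose l hl hu using existsUnique_isHorizLift (𝕜 := 𝕜) (n := n) (d := d) (dhat := dhat)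
    (α₀ := α₀) hα₁
  refine ⟨fun X Z => QFun.ofInvariant (fun Y => stMetric α₀ α₁ Y.1 (l X Y) (l Z Y))
    ((l X).smooth.stMetric (l Z).smooth α₀ α₁) fun Y U hU => ?_, fun X Z ξ ζ hξ hζ Y => ?_,
    fun h hh => ?_⟩
  · rw [(hl X).isEquivariant hα₁, (hl Z).isEquivariant hα₁]
    exact stMetric_mul_right α₀ α₁ hU.1 _ _ _
  · rw [hu X ξ hξ, hu Z ζ hζ]
    rfl
  · funext X Z
    exact Subtype.ext (funext (Quotient.ind fun Y => hh X Z _ _ (hl X) (hl Z) Y))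

theorem IsHorizGradient.stMetric_eq (hα₁ : 0 < α₁) {f : stiefel 𝕜 n d → ℝ}
    {R : VField (stiefel 𝕜 n d)} (hR : IsHorizGradient α₀ α₁ dhat f R) (Y : stiefel 𝕜 n d)
    {w : Matrix (Fin n) (Fin d) 𝕜} (hw : symf dhat (Y.1ᴴ * w) = 0) :
    stMetric α₀ α₁ Y.1 (R Y) w = dirDeriv f Y w := by
  obtain ⟨ξ, hξ, rfl⟩ := exists_isHorizontal_through (α₀ := α₀) dhat hα₁ Y hw
  exact hR.2 ξ hξ Y

theorem IsHorizGradient.isEquivariant (hα₀ : 0 < α₀) (hα₁ : 0 < α₁)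
    {f : QFun (orbitRel 𝕜 n d dhat)} {R : VField (stiefel 𝕜 n d)}
    (hR : IsHorizGradient α₀ α₁ dhat f.pullback R) : IsEquivariant dhat R := by
  intro Y U hU
  refine eq_of_stMetric_eq dhat hα₀ hα₁ (stMul Y hU).2 (hR.1.symf_eq_zero dhat hα₁ _)
    (symf_mul_right hU (hR.1.symf_eq_zero dhat hα₁ Y)) fun w hw => ?_
  have hUU : U * Uᴴ = 1 := mul_eq_one_comm.mp hU.1
  obtain ⟨u, rfl, hu⟩ : ∃ u : Matrix (Fin n) (Fin d) 𝕜, w = u * U ∧ symf dhat (Y.1ᴴ * u) = 0 := by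
    refine ⟨w * Uᴴ, by rw [Matrix.mul_assoc, hU.1, Matrix.mul_one], ?_⟩
    have h := symf_mul_right (conjTranspose_mem_blockGroup dhat hU) hw
    have h' : (stMul Y hU).1 * Uᴴ = Y.1 := by
      show Y.1 * U * Uᴴ = Y.1
      rw [Matrix.mul_assoc, hUU, Matrix.mul_one]
    rwa [h'] at h
  rw [hR.stMetric_eq hα₁ _ hw, f.dirDeriv_pullback_stMul Y hU (horizontal_tangent dhat Y.2 hu),
    ← hR.stMetric_eq hα₁ Y hu]
  exact (stMetric_mul_right α₀ α₁ hU.1 _ _ _).symm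

theorem IsEquivariant.sub {ξ η : VField (stiefel 𝕜 n d)} (h : IsEquivariant dhat ξ)
    (h' : IsEquivariant dhat η) : IsEquivariant dhat (ξ.sub η) := fun Y U hU => by
  rw [VField.sub_apply, VField.sub_apply, h, h', Matrix.sub_mul]

theorem IsHorizontal.sub (hα₁ : 0 < α₁) {ξ η : VField (stiefel 𝕜 n d)}
    (h : IsHorizontal α₀ α₁ dhat ξ) (h' : IsHorizontal α₀ α₁ dhat η) :
    IsHorizontal α₀ α₁ dhat (ξ.sub η) := (isHorizontal_iff dhat hα₁ _).2 fun Y => by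
  rw [VField.sub_apply, Matrix.mul_sub, symf_sub, h.symf_eq_zero dhat hα₁,
    h'.symf_eq_zero dhat hα₁, sub_zero]

section WithMetric

variable {h : QVField (orbitRel 𝕜 n d dhat) → QVField (orbitRel 𝕜 n d dhat) →
  QFun (orbitRel 𝕜 n d dhat)}

/-- Two vector fields on the quotient with the same inner products agree. -/
theorem IsQuotientMetric.ext (hh : IsQuotientMetric α₀ α₁ dhat h) (hα₀ : 0 < α₀) (hα₁ : 0 < α₁)
    {X Z : QVField (orbitRel 𝕜 n d dhat)} (he : ∀ W b, h X W b = h Z W b) : X = Z := by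
  obtain ⟨ξ, hξ, -⟩ := existsUnique_isHorizLift (α₀ := α₀) hα₁ X
  obtain ⟨ζ, hζ, -⟩ := existsUnique_isHorizLift (α₀ := α₀) hα₁ Z
  -- The difference of the two lifts is horizontal and equivariant, so it descends to a field
  -- against which `X` and `Z` can be tested.
  have hl := isHorizLift_ofEquivariant ((hξ.isEquivariant hα₁).sub (hζ.isEquivariant hα₁))
    (hξ.1.sub hα₁ hζ.1)
  have hx : ξ = ζ := by
    ext1
    funext Y
    refine sub_eq_zero.1 (stMetric_self_eq_zero hα₀ hα₁ Y.2 ?_)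
    have h1 := he (QVField.ofEquivariant (ξ.sub ζ) ((hξ.isEquivariant hα₁).sub
      (hζ.isEquivariant hα₁))) (Quotient.mk _ Y)
    rw [hh _ _ _ _ hξ hl, hh _ _ _ _ hζ hl] at h1
    rw [stMetric_sub_left, sub_eq_zero]
    exact h1
  subst hx
  exact hξ.qvField_eq hζ

theorem IsQuotientMetric.exists_isQGradient (hh : IsQuotientMetric α₀ α₁ dhat h) (hα₀ : 0 < α₀)
    (hα₁ : 0 < α₁) (f : QFun (orbitRel 𝕜 n d dhat)) :
    ∃ (R : QVField (orbitRel 𝕜 n d dhat)) (ρ : VField (stiefel 𝕜 n d)),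
      IsQGradient h f R ∧ IsHorizLift α₀ α₁ dhat R ρ ∧
        IsHorizGradient α₀ α₁ dhat f.pullback ρ := by
  obtain ⟨ρ, hρ, -⟩ := existsUnique_isHorizGradient dhat hα₀ hα₁ f.pullback_smooth
  have hl := isHorizLift_ofEquivariant (hρ.isEquivariant hα₀ hα₁) hρ.1
  refine ⟨_, ρ, fun X => Quotient.ind fun Y => ?_, hl, hρ⟩
  obtain ⟨ξ, hξ, -⟩ := existsUnique_isHorizLift (α₀ := α₀) hα₁ X
  rw [hh _ _ _ _ hl hξ, hρ.2 ξ hξ.1 Y, hξ.2]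

theorem IsQuotientMetric.existsUnique_isQGradient (hh : IsQuotientMetric α₀ α₁ dhat h)
    (hα₀ : 0 < α₀) (hα₁ : 0 < α₁) (f : QFun (orbitRel 𝕜 n d dhat)) :
    ∃! R : QVField (orbitRel 𝕜 n d dhat), IsQGradient h f R := by
  obtain ⟨R, -, hR, -⟩ := hh.exists_isQGradient hα₀ hα₁ f
  exact ⟨R, hR, fun R' hR' => hh.ext hα₀ hα₁ fun W b => (hR' W b).trans (hR W b).symm⟩

/-- The horizontal gradient of the pullback descends to a gradient, and uniqueness of gradients and
of lifts matches it with the given pair. -/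
theorem IsQGradient.isHorizGradient (hh : IsQuotientMetric α₀ α₁ dhat h) (hα₀ : 0 < α₀)
    (hα₁ : 0 < α₁) {f : QFun (orbitRel 𝕜 n d dhat)} {R : QVField (orbitRel 𝕜 n d dhat)}
    {ρ : VField (stiefel 𝕜 n d)} (hR : IsQGradient h f R) (hρ : IsHorizLift α₀ α₁ dhat R ρ) :
    IsHorizGradient α₀ α₁ dhat f.pullback ρ := by
  obtain ⟨R', ρ', h1, h2, h3⟩ := hh.exists_isQGradient hα₀ hα₁ f
  rw [(hh.existsUnique_isQGradient hα₀ hα₁ f).unique hR h1] at hρ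
  rwa [(existsUnique_isHorizLift hα₁ R').unique hρ h2]

/-! ### The Levi-Civita connection of the quotient -/

theorem isEquivariant_horizConn {ξ η : VField (stiefel 𝕜 n d)} (hξ : IsEquivariant dhat ξ)
    (hη : IsEquivariant dhat η) : IsEquivariant dhat (horizConn dhat α₀ α₁ ξ η) := by
  intro Y U hU
  have hUU : ∀ A : Matrix (Fin d) (Fin n) 𝕜, U * (Uᴴ * A) = A := fun A => by
    rw [← Matrix.mul_assoc, mul_eq_one_comm.mp hU.1, Matrix.one_mul]
  have hUU' : ∀ A : Matrix (Fin d) (Fin d) 𝕜, U * (Uᴴ * A) = A := fun A => by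
    rw [← Matrix.mul_assoc, mul_eq_one_comm.mp hU.1, Matrix.one_mul]
  have hY : (stMul Y hU).1 = Y.1 * U := rfl
  have h1 : dirDeriv η (stMul Y hU) (ξ Y * U) = dirDeriv η Y (ξ Y) * U := by
    rw [dirDeriv_stMul (η.smooth.mono le_top) hU Y (ξ.tangent Y),
      dirDeriv_congr (fun Z => hη Z hU)]
    exact dirDeriv_clm (η.smooth.mono le_top) (rightMulL n U) Y (ξ.tangent Y)
  have h2 : (ξ Y * U)ᴴ * (η Y * U) = Uᴴ * ((ξ Y)ᴴ * η Y) * U := by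
    simp only [Matrix.conjTranspose_mul, Matrix.mul_assoc]
  rw [horizConn, horizConn, hξ, hη, h1, h2, symf_conj dhat hU, hY]
  simp only [Matrix.conjTranspose_mul, Matrix.mul_assoc, hUU, hUU', Matrix.add_mul,
    Matrix.smul_mul]

theorem isCkOn_horizConn (hα₀ : 0 < α₀) (hα₁ : 0 < α₁) (ξ : VField (stiefel 𝕜 n d))
    {η : VField (stiefel 𝕜 n d)} (hη : IsHorizontal α₀ α₁ dhat η) :
    IsCkOn ⊤ (horizConn dhat α₀ α₁ ξ η) :=
  (isCkOn_horizProj dhat (lcConn α₀ α₁ ξ η).smooth).congr fun Y => by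
    rw [← horizProj_lcConn dhat hα₀ hα₁ ξ hη Y, horizProj_eq dhat hα₀ hα₁ Y.2]

theorem exists_qConn (hα₀ : 0 < α₀) (hα₁ : 0 < α₁) :
    ∃ conn : QVField (orbitRel 𝕜 n d dhat) → QVField (orbitRel 𝕜 n d dhat) →
        QVField (orbitRel 𝕜 n d dhat),
      ∀ (X Z : QVField (orbitRel 𝕜 n d dhat)) (ξ η : VField (stiefel 𝕜 n d)),
        IsHorizLift α₀ α₁ dhat X ξ → IsHorizLift α₀ α₁ dhat Z η →
        ∃ ζ : VField (stiefel 𝕜 n d), IsHorizLift α₀ α₁ dhat (conn X Z) ζ ∧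
          ∀ Y, ζ Y = horizConn dhat α₀ α₁ ξ η Y := by
  choose l hl hu using existsUnique_isHorizLift (𝕜 := 𝕜) (n := n) (d := d) (dhat := dhat)
    (α₀ := α₀) hα₁
  refine ⟨fun X Z => QVField.ofEquivariant (VField.ofHorizontal dhat
    (horizConn dhat α₀ α₁ (l X) (l Z)) (isCkOn_horizConn hα₀ hα₁ (l X) (hl Z).1)
    (symf_horizConn dhat hα₀ hα₁ (l X) (hl Z).1)) (isEquivariant_horizConn
      ((hl X).isEquivariant hα₁) ((hl Z).isEquivariant hα₁)), fun X Z ξ η hξ hη => ?_⟩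
  rw [hu X ξ hξ, hu Z η hη]
  exact ⟨_, isHorizLift_ofEquivariant _ (VField.ofHorizontal_isHorizontal dhat hα₁ _ _ _),
    fun Y => rfl⟩

theorem horizConn_eq (hα₀ : 0 < α₀) (hα₁ : 0 < α₁) (ξ : VField (stiefel 𝕜 n d))
    {η : VField (stiefel 𝕜 n d)} (hη : IsHorizontal α₀ α₁ dhat η) (Y : stiefel 𝕜 n d) :
    horizConn dhat α₀ α₁ ξ η Y = lcConn α₀ α₁ ξ η Y
      - Y.1 * symf dhat (Y.1ᴴ * lcConn α₀ α₁ ξ η Y) := by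
  rw [← horizProj_lcConn dhat hα₀ hα₁ ξ hη Y, horizProj_eq dhat hα₀ hα₁ Y.2]

/-- The terms with `1 - Y * Yᴴ` are symmetric in `ξ` and `η`, so the difference is the bracket plus
`Y` times `symf` of a skew matrix. The latter is vertical, hence invisible to pullbacks, and the
bracket acts as the commutator of derivations. -/
theorem horizConn_torsion (hα₀ : 0 < α₀) (f : QFun (orbitRel 𝕜 n d dhat))
    (ξ η : VField (stiefel 𝕜 n d)) (Y : stiefel 𝕜 n d) :
    dirDeriv f.pullback Y (horizConn dhat α₀ α₁ ξ η Y)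
        - dirDeriv f.pullback Y (horizConn dhat α₀ α₁ η ξ Y)
      = dirDeriv (fun Z => dirDeriv f.pullback Z (η Z)) Y (ξ Y)
        - dirDeriv (fun Z => dirDeriv f.pullback Z (ξ Z)) Y (η Y) := by
  have hb : dirDeriv η Y (ξ Y) - dirDeriv ξ Y (η Y) ∈ tangentVectors (stiefel 𝕜 n d) Y.1 := by
    rw [← (lcConn_isLeviCivita (α₁ := α₁) hα₀).torsion_free ξ η Y, ← VField.sub_apply]
    exact VField.tangent _ Y
  rw [dirDeriv_comm f.pullback_smooth ξ η Y hb, ← dirDeriv_sub]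
  have hc : ((ξ Y)ᴴ * η Y)ᴴ = (η Y)ᴴ * ξ Y := by simp
  have hc' : ((η Y)ᴴ * ξ Y)ᴴ = (ξ Y)ᴴ * η Y := by simp
  have e : horizConn dhat α₀ α₁ ξ η Y - horizConn dhat α₀ α₁ η ξ Y
      = (dirDeriv η Y (ξ Y) - dirDeriv ξ Y (η Y))
        + Y.1 * (symf dhat ((ξ Y)ᴴ * η Y) - symf dhat ((η Y)ᴴ * ξ Y)) := by
    rw [horizConn, horizConn, add_comm (η Y * _), Matrix.mul_sub]
    abel
  rw [e, dirDeriv_add, f.dirDeriv_pullback_vertical Y, add_zero]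
  · rw [Matrix.conjTranspose_sub, symf_conjTranspose, symf_conjTranspose, hc, hc', neg_sub]
  · rw [symf_sub, symf_symf, symf_symf]

/-- Each axiom is checked upstairs on lifts. The connection rules pass from `lcConn` to `horizConn`
because the latter is its pointwise linear projection, and lifting is additive and linear over
functions by `horizontal_ext`; torsion and metricity are `horizConn_torsion` and `horizConn_metric`.
-/
theorem isQLeviCivita_of_lift (hh : IsQuotientMetric α₀ α₁ dhat h) (hα₀ : 0 < α₀) (hα₁ : 0 < α₁)
    {conn : QVField (orbitRel 𝕜 n d dhat) → QVField (orbitRel 𝕜 n d dhat) →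
        QVField (orbitRel 𝕜 n d dhat)}
    (hc : ∀ (X Z : QVField (orbitRel 𝕜 n d dhat)) (ξ η : VField (stiefel 𝕜 n d)),
        IsHorizLift α₀ α₁ dhat X ξ → IsHorizLift α₀ α₁ dhat Z η →
        ∃ ζ : VField (stiefel 𝕜 n d), IsHorizLift α₀ α₁ dhat (conn X Z) ζ ∧
          ∀ Y, ζ Y = horizConn dhat α₀ α₁ ξ η Y) : IsQLeviCivita h conn := by
  have hL : ∀ X : QVField (orbitRel 𝕜 n d dhat), ∃ ξ : VField (stiefel 𝕜 n d),
    IsHorizLift α₀ α₁ dhat X ξ := fun X => (existsUnique_isHorizLift hα₁ X).exists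
  have hD : ∀ (X Z : QVField (orbitRel 𝕜 n d dhat)) (ξ η : VField (stiefel 𝕜 n d)),
      IsHorizLift α₀ α₁ dhat X ξ → IsHorizLift α₀ α₁ dhat Z η → ∀ f Y,
      conn X Z f (Quotient.mk _ Y) = dirDeriv f.pullback Y (horizConn dhat α₀ α₁ ξ η Y) := by
    intro X Z ξ η hξ hη f Y
    obtain ⟨ζ, hζ, he⟩ := hc X Z ξ η hξ hη
    rw [← he, hζ.2]
  have hs := fun {X : QVField (orbitRel 𝕜 n d dhat)} {ξ : VField (stiefel 𝕜 n d)}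
    (hξ : IsHorizLift α₀ α₁ dhat X ξ) Y => hξ.1.symf_eq_zero dhat hα₁ Y
  have hLC := lcConn_isLeviCivita (𝕜 := 𝕜) (n := n) (d := d) (α₁ := α₁) hα₀
  have hadd : ∀ {X X₁ X₂ : QVField (orbitRel 𝕜 n d dhat)} {ξ ξ₁ ξ₂ : VField (stiefel 𝕜 n d)},
      (∀ f b, X f b = X₁ f b + X₂ f b) → IsHorizLift α₀ α₁ dhat X ξ →
      IsHorizLift α₀ α₁ dhat X₁ ξ₁ → IsHorizLift α₀ α₁ dhat X₂ ξ₂ → ∀ Y, ξ Y = ξ₁ Y + ξ₂ Y := by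
    intro X X₁ X₂ ξ ξ₁ ξ₂ he h1 h2 h3 Y
    refine horizontal_ext (hs h1 Y) ?_ fun f => ?_
    · rw [Matrix.mul_add, symf_add, hs h2, hs h3, add_zero]
    · rw [dirDeriv_add, h1.2, h2.2, h3.2, he]
  have hsmul : ∀ {φ : QFun (orbitRel 𝕜 n d dhat)} {X X₁ : QVField (orbitRel 𝕜 n d dhat)}
      {ξ ξ₁ : VField (stiefel 𝕜 n d)},
      (∀ f b, X f b = φ b * X₁ f b) → IsHorizLift α₀ α₁ dhat X ξ →
      IsHorizLift α₀ α₁ dhat X₁ ξ₁ → ∀ Y, ξ Y = φ.pullback Y • ξ₁ Y := by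
    intro φ X X₁ ξ ξ₁ he h1 h2 Y
    refine horizontal_ext (hs h1 Y) ?_ fun f => ?_
    · rw [Matrix.mul_smul, symf_smul, hs h2, smul_zero]
    · rw [dirDeriv_smul, h1.2, h2.2, he]
      rfl
  refine ⟨?_, ?_, ?_, ?_, ?_, ?_⟩
  · intro X₁ X₂ X Z he f
    refine Quotient.ind fun Y => ?_
    obtain ⟨ξ₁, h1⟩ := hL X₁
    obtain ⟨ξ₂, h2⟩ := hL X₂
    obtain ⟨ξ, h3⟩ := hL X
    obtain ⟨η, h4⟩ := hL Z
    rw [hD _ _ _ _ h1 h4, hD _ _ _ _ h2 h4, hD _ _ _ _ h3 h4, ← dirDeriv_add]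
    congr 1
    simp only [horizConn_eq hα₀ hα₁ _ h4.1,
      hLC.add_left ξ₁ ξ₂ ξ η (hadd he h3 h1 h2) Y, Matrix.mul_add, symf_add]
    abel
  · intro φ X₁ X Z he f
    refine Quotient.ind fun Y => ?_
    obtain ⟨ξ₁, h1⟩ := hL X₁
    obtain ⟨ξ, h3⟩ := hL X
    obtain ⟨η, h4⟩ := hL Z
    rw [hD _ _ _ _ h1 h4, hD _ _ _ _ h3 h4]
    refine Eq.trans ?_ (dirDeriv_smul f.pullback Y (φ.pullback Y) _)
    congr 1
    simp only [horizConn_eq hα₀ hα₁ _ h4.1,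
      hLC.smul_left φ.pullback ξ₁ ξ η φ.pullback_smooth (hsmul he h3 h1) Y, Matrix.mul_smul,
      symf_smul, smul_sub]
  · intro X Z₁ Z₂ Z he f
    refine Quotient.ind fun Y => ?_
    obtain ⟨η₁, h1⟩ := hL Z₁
    obtain ⟨η₂, h2⟩ := hL Z₂
    obtain ⟨η, h3⟩ := hL Z
    obtain ⟨ξ, h4⟩ := hL X
    rw [hD _ _ _ _ h4 h1, hD _ _ _ _ h4 h2, hD _ _ _ _ h4 h3, ← dirDeriv_add]
    congr 1
    simp only [horizConn_eq hα₀ hα₁ _ h1.1, horizConn_eq hα₀ hα₁ _ h2.1,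
      horizConn_eq hα₀ hα₁ _ h3.1,
      hLC.add_right ξ η₁ η₂ η (hadd he h3 h1 h2) Y, Matrix.mul_add, symf_add]
    abel
  · intro φ X Z₁ Z he f
    refine Quotient.ind fun Y => ?_
    obtain ⟨η₁, h1⟩ := hL Z₁
    obtain ⟨η, h3⟩ := hL Z
    obtain ⟨ξ, h4⟩ := hL X
    rw [hD _ _ _ _ h4 h1, hD _ _ _ _ h4 h3, ← h4.2 φ Y, ← h1.2 f Y]
    have e : horizConn dhat α₀ α₁ ξ η Y = φ.pullback Y • horizConn dhat α₀ α₁ ξ η₁ Y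
        + dirDeriv φ.pullback Y (ξ Y) • η₁ Y := by
      simp only [horizConn_eq hα₀ hα₁ _ h1.1, horizConn_eq hα₀ hα₁ _ h3.1,
        hLC.leibniz φ.pullback ξ η₁ η φ.pullback_smooth (hsmul he h3 h1) Y, Matrix.mul_add,
        symf_add, Matrix.mul_smul, symf_smul, hs h1, smul_zero, add_zero, smul_sub]
      abel
    rw [e, dirDeriv_add, dirDeriv_smul, dirDeriv_smul]
    rfl
  · intro X Z f
    refine Quotient.ind fun Y => ?_
    obtain ⟨ξ, h1⟩ := hL X
    obtain ⟨η, h2⟩ := hL Z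
    rw [hD _ _ _ _ h1 h2, hD _ _ _ _ h2 h1, horizConn_torsion hα₀, ← h1.2, ← h2.2]
    congr 1
    · exact dirDeriv_congr (fun Z => h2.2 f Z) Y _
    · exact dirDeriv_congr (fun Z => h1.2 f Z) Y _
  · intro X Z W
    refine Quotient.ind fun Y => ?_
    obtain ⟨ξ, h1⟩ := hL X
    obtain ⟨η, h2⟩ := hL Z
    obtain ⟨ζ, h3⟩ := hL W
    obtain ⟨u, h4, e4⟩ := hc X Z ξ η h1 h2
    obtain ⟨v, h5, e5⟩ := hc X W ξ ζ h1 h3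
    rw [hh _ _ _ _ h4 h3, hh _ _ _ _ h2 h5, e4, e5, ← horizConn_metric dhat hα₀ hα₁ ξ h2.1 h3.1,
      ← h1.2]
    exact dirDeriv_congr (fun Z' => hh _ _ _ _ h2 h3 Z') Y _

/-- The symmetric-and-skew argument again, applied to the lifts of the two covariant derivatives.
Equality of torsions is tested on functions of the quotient, which determine horizontal vectors. -/
theorem IsQLeviCivita.unique (hh : IsQuotientMetric α₀ α₁ dhat h) (hα₀ : 0 < α₀) (hα₁ : 0 < α₁)
    {conn conn' : QVField (orbitRel 𝕜 n d dhat) → QVField (orbitRel 𝕜 n d dhat) →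
        QVField (orbitRel 𝕜 n d dhat)}
    (hc : IsQLeviCivita h conn) (hc' : IsQLeviCivita h conn') : conn = conn' := by
  choose l hl hu using existsUnique_isHorizLift (𝕜 := 𝕜) (n := n) (d := d) (dhat := dhat)
    (α₀ := α₀) hα₁
  have hs := fun (X : QVField (orbitRel 𝕜 n d dhat)) Y => (hl X).1.symf_eq_zero dhat hα₁ Y
  have hm : ∀ X Z Y, h X Z (Quotient.mk _ Y) = stMetric α₀ α₁ Y.1 (l X Y) (l Z Y) :=
    fun X Z Y => hh _ _ _ _ (hl X) (hl Z) Y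
  funext X Z
  refine hh.ext hα₀ hα₁ fun W => Quotient.ind fun Y => ?_
  have key := eq_zero_of_symm_of_skew
    (S := fun X Z W => stMetric α₀ α₁ Y.1 (l (conn X Z) Y - l (conn' X Z) Y) (l W Y))
    (fun X Z W => by
      congr 1
      rw [sub_eq_sub_iff_sub_eq_sub]
      refine horizontal_ext (dhat := dhat) (Y := Y) ?_ ?_ fun f => ?_
      · rw [Matrix.mul_sub, symf_sub, hs, hs, sub_zero]
      · rw [Matrix.mul_sub, symf_sub, hs, hs, sub_zero]
      · rw [dirDeriv_sub, dirDeriv_sub, (hl _).2, (hl _).2, (hl _).2, (hl _).2, hc.torsion_free,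
          hc'.torsion_free])
    (fun X Z W => by
      have e1 := hc.metric X Z W (Quotient.mk _ Y)
      have e2 := hc'.metric X Z W (Quotient.mk _ Y)
      rw [hm, hm] at e1 e2
      rw [stMetric_sub_left, stMetric_sub_left, stMetric_comm α₀ α₁ Y.1 (l (conn X W) Y),
        stMetric_comm α₀ α₁ Y.1 (l (conn' X W) Y)]
      linarith)
    X Z W
  rw [hm, hm, ← sub_eq_zero, ← stMetric_sub_left]
  exact key

theorem IsQuotientMetric.existsUnique_isQLeviCivita (hh : IsQuotientMetric α₀ α₁ dhat h)
    (hα₀ : 0 < α₀) (hα₁ : 0 < α₁) :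
    ∃! conn : QVField (orbitRel 𝕜 n d dhat) → QVField (orbitRel 𝕜 n d dhat) →
        QVField (orbitRel 𝕜 n d dhat), IsQLeviCivita h conn := by
  obtain ⟨conn, hc⟩ := exists_qConn (𝕜 := 𝕜) (n := n) (d := d) (dhat := dhat) hα₀ hα₁
  have hc' := isQLeviCivita_of_lift hh hα₀ hα₁ hc
  exact ⟨conn, hc', fun conn' h' => h'.unique hh hα₀ hα₁ hc'⟩

theorem IsQLeviCivita.lift_eq (hh : IsQuotientMetric α₀ α₁ dhat h) (hα₀ : 0 < α₀) (hα₁ : 0 < α₁)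
    {conn : QVField (orbitRel 𝕜 n d dhat) → QVField (orbitRel 𝕜 n d dhat) →
        QVField (orbitRel 𝕜 n d dhat)} (hconn : IsQLeviCivita h conn)
    {X Z : QVField (orbitRel 𝕜 n d dhat)} {ξ η ζ : VField (stiefel 𝕜 n d)}
    (hξ : IsHorizLift α₀ α₁ dhat X ξ) (hη : IsHorizLift α₀ α₁ dhat Z η)
    (hζ : IsHorizLift α₀ α₁ dhat (conn X Z) ζ) (Y : stiefel 𝕜 n d) :
    ζ Y = horizConn dhat α₀ α₁ ξ η Y := by
  obtain ⟨conn', hc⟩ := exists_qConn (𝕜 := 𝕜) (n := n) (d := d) (dhat := dhat) hα₀ hα₁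
  rw [hconn.unique hh hα₀ hα₁ (isQLeviCivita_of_lift hh hα₀ hα₁ hc)] at hζ
  obtain ⟨ζ', h1, h2⟩ := hc X Z ξ η hξ hη
  rw [(existsUnique_isHorizLift hα₁ _).unique hζ h1, h2]

end WithMetric

end StiefelQuotient

/-! ### Assembly of the full statement -/

theorem mainTheorem3 {𝕜 : Type*} [RCLike 𝕜] (n d q : ℕ) (hd : 0 < d) (hdn : d < n)
    (dhat : Fin q → ℕ) (hpos : ∀ i, 0 < dhat i) (hsum : ∑ i, dhat i ≤ d)
    (α₀ α₁ : ℝ) (hα₀ : 0 < α₀) (hα₁ : 0 < α₁) :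
    -- the metric operator, the horizontal space, and the horizontal projection
    (∀ Y ∈ stiefel 𝕜 n d,
      (∀ ω, metricOp α₀ α₁ Y (metricOpInv α₀ α₁ Y ω) = ω ∧
        metricOpInv α₀ α₁ Y (metricOp α₀ α₁ Y ω) = ω) ∧
      horizontalSpace α₀ α₁ dhat Y = {ω | symf dhat (Yᴴ * ω) = 0} ∧
      horizontalSpace α₀ α₁ dhat Y = {ω | (Yᴴ * ω)ᴴ = -(Yᴴ * ω) ∧
        ∀ a b, blk dhat a = blk dhat b → blk dhat a < q → symf dhat (Yᴴ * ω) a b = 0} ∧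
      (∀ ω p, IsHorizProj α₀ α₁ dhat Y ω p ↔ p = ω - Y * symf dhat (Yᴴ * ω)) ∧
      (∀ ω, horizProj α₀ α₁ dhat Y ω = ω - Y * symf dhat (Yᴴ * ω))) ∧
    -- the Riemannian gradient
    (∀ f : stiefel 𝕜 n d → ℝ, IsCkOn ⊤ f →
      (∃! R : VField (stiefel 𝕜 n d), IsHorizGradient α₀ α₁ dhat f R) ∧
      ∀ (fY : stiefel 𝕜 n d → Matrix (Fin n) (Fin d) 𝕜) (R : VField (stiefel 𝕜 n d)),
        IsAmbientGradient f fY → IsHorizGradient α₀ α₁ dhat f R → ∀ Y : stiefel 𝕜 n d,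
          R Y = horizProj α₀ α₁ dhat Y.1 (metricOpInv α₀ α₁ Y.1 (fY Y)) ∧
          horizProj α₀ α₁ dhat Y.1 (metricOpInv α₀ α₁ Y.1 (fY Y)) =
            α₀⁻¹ • fY Y + (α₁⁻¹ - α₀⁻¹) • (Y.1 * Y.1ᴴ * fY Y)
              - α₁⁻¹ • (Y.1 * symf dhat (Y.1ᴴ * fY Y))) ∧
    -- the projected Levi-Civita connection of the Stiefel manifold and the horizontal Hessians
    (∃! conn : VField (stiefel 𝕜 n d) → VField (stiefel 𝕜 n d) → VField (stiefel 𝕜 n d),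
      IsLeviCivita (fun Y => stMetric α₀ α₁ Y.1) conn) ∧
    (∀ conn : VField (stiefel 𝕜 n d) → VField (stiefel 𝕜 n d) → VField (stiefel 𝕜 n d),
      IsLeviCivita (fun Y => stMetric α₀ α₁ Y.1) conn →
      (∀ ξ η : VField (stiefel 𝕜 n d),
        IsHorizontal α₀ α₁ dhat ξ → IsHorizontal α₀ α₁ dhat η → ∀ Y : stiefel 𝕜 n d,
        horizProj α₀ α₁ dhat Y.1 (conn ξ η Y) =
          dirDeriv η Y (ξ Y) + Y.1 * symf dhat ((ξ Y)ᴴ * η Y)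
            + ((α₀ - α₁) / α₀) •
              ((1 - Y.1 * Y.1ᴴ) * (ξ Y * (η Y)ᴴ + η Y * (ξ Y)ᴴ) * Y.1)) ∧
      (∀ (f : stiefel 𝕜 n d → ℝ) (fY : stiefel 𝕜 n d → Matrix (Fin n) (Fin d) 𝕜)
        (R : VField (stiefel 𝕜 n d)),
        IsCkOn ⊤ f → IsAmbientGradient f fY → IsCkOn 1 fY → IsHorizGradient α₀ α₁ dhat f R →
        ∀ ξ : VField (stiefel 𝕜 n d), IsHorizontal α₀ α₁ dhat ξ → ∀ Y : stiefel 𝕜 n d,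
        (∀ η : VField (stiefel 𝕜 n d), IsHorizontal α₀ α₁ dhat η →
          stMetric α₀ α₁ Y.1 (horizProj α₀ α₁ dhat Y.1 (conn ξ R Y)) (η Y) =
            frobInner (dirDeriv fY Y (ξ Y)) (η Y)
              - trR ((fY Y)ᴴ * (Y.1 * symf dhat ((ξ Y)ᴴ * η Y) + ((α₀ - α₁) / α₀) •
                ((1 - Y.1 * Y.1ᴴ) * (ξ Y * (η Y)ᴴ + η Y * (ξ Y)ᴴ) * Y.1)))) ∧
        horizProj α₀ α₁ dhat Y.1 (conn ξ R Y) =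
          horizProj α₀ α₁ dhat Y.1 (metricOpInv α₀ α₁ Y.1
            (dirDeriv fY Y (ξ Y) - ξ Y * symf dhat (Y.1ᴴ * fY Y)
              - ((α₀ - α₁) / α₀) •
                (((1 - Y.1 * Y.1ᴴ) * fY Y * Y.1ᴴ + Y.1 * (fY Y)ᴴ * (1 - Y.1 * Y.1ᴴ)) * ξ Y))))) ∧
    -- the quotient manifold: lifts of vector fields, the metric, and the Levi-Civita connection
    (∀ X : QVField (orbitRel 𝕜 n d dhat), ∃! ξ : VField (stiefel 𝕜 n d),
      IsHorizLift α₀ α₁ dhat X ξ) ∧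
    (∃! h : QVField (orbitRel 𝕜 n d dhat) → QVField (orbitRel 𝕜 n d dhat) →
      QFun (orbitRel 𝕜 n d dhat), IsQuotientMetric α₀ α₁ dhat h) ∧
    (∀ h : QVField (orbitRel 𝕜 n d dhat) → QVField (orbitRel 𝕜 n d dhat) →
      QFun (orbitRel 𝕜 n d dhat), IsQuotientMetric α₀ α₁ dhat h →
      (∀ f : QFun (orbitRel 𝕜 n d dhat), ∃! R : QVField (orbitRel 𝕜 n d dhat),
        IsQGradient h f R) ∧
      (∃! conn : QVField (orbitRel 𝕜 n d dhat) → QVField (orbitRel 𝕜 n d dhat) →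
        QVField (orbitRel 𝕜 n d dhat), IsQLeviCivita h conn) ∧
      -- lift of the Riemannian gradient
      (∀ (f : QFun (orbitRel 𝕜 n d dhat)) (fY : stiefel 𝕜 n d → Matrix (Fin n) (Fin d) 𝕜)
        (R : QVField (orbitRel 𝕜 n d dhat)) (ρ : VField (stiefel 𝕜 n d)),
        IsAmbientGradient f.pullback fY → IsQGradient h f R → IsHorizLift α₀ α₁ dhat R ρ →
        ∀ Y : stiefel 𝕜 n d,
          ρ Y = horizProj α₀ α₁ dhat Y.1 (metricOpInv α₀ α₁ Y.1 (fY Y)) ∧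
          ρ Y = α₀⁻¹ • fY Y + (α₁⁻¹ - α₀⁻¹) • (Y.1 * Y.1ᴴ * fY Y)
            - α₁⁻¹ • (Y.1 * symf dhat (Y.1ᴴ * fY Y))) ∧
      (∀ conn : QVField (orbitRel 𝕜 n d dhat) → QVField (orbitRel 𝕜 n d dhat) →
        QVField (orbitRel 𝕜 n d dhat), IsQLeviCivita h conn →
        -- lift of the connection
        (∀ (X Z : QVField (orbitRel 𝕜 n d dhat)) (ξ η ζ : VField (stiefel 𝕜 n d)),
          IsHorizLift α₀ α₁ dhat X ξ → IsHorizLift α₀ α₁ dhat Z η →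
          IsHorizLift α₀ α₁ dhat (conn X Z) ζ → ∀ Y : stiefel 𝕜 n d,
          ζ Y = dirDeriv η Y (ξ Y) + Y.1 * symf dhat ((ξ Y)ᴴ * η Y)
            + ((α₀ - α₁) / α₀) •
              ((1 - Y.1 * Y.1ᴴ) * (ξ Y * (η Y)ᴴ + η Y * (ξ Y)ᴴ) * Y.1)) ∧
        -- lifts of the Hessians
        (∀ (f : QFun (orbitRel 𝕜 n d dhat)) (fY : stiefel 𝕜 n d → Matrix (Fin n) (Fin d) 𝕜)
          (R X : QVField (orbitRel 𝕜 n d dhat)) (ξ : VField (stiefel 𝕜 n d)),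
          IsAmbientGradient f.pullback fY → IsCkOn 1 fY → IsQGradient h f R →
          IsHorizLift α₀ α₁ dhat X ξ → ∀ Y : stiefel 𝕜 n d,
          (∀ (Z : QVField (orbitRel 𝕜 n d dhat)) (η : VField (stiefel 𝕜 n d)),
            IsHorizLift α₀ α₁ dhat Z η →
            h (conn X R) Z (Quotient.mk _ Y) =
              frobInner (dirDeriv fY Y (ξ Y)) (η Y)
                - trR ((fY Y)ᴴ * (Y.1 * symf dhat ((ξ Y)ᴴ * η Y) + ((α₀ - α₁) / α₀) •
                  ((1 - Y.1 * Y.1ᴴ) * (ξ Y * (η Y)ᴴ + η Y * (ξ Y)ᴴ) * Y.1)))) ∧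
          (∀ ζ : VField (stiefel 𝕜 n d), IsHorizLift α₀ α₁ dhat (conn X R) ζ →
            ζ Y = horizProj α₀ α₁ dhat Y.1 (metricOpInv α₀ α₁ Y.1
              (dirDeriv fY Y (ξ Y) - ξ Y * symf dhat (Y.1ᴴ * fY Y)
                - ((α₀ - α₁) / α₀) •
                  (((1 - Y.1 * Y.1ᴴ) * fY Y * Y.1ᴴ + Y.1 * (fY Y)ᴴ * (1 - Y.1 * Y.1ᴴ))
                    * ξ Y))))))) := by
  refine ⟨fun Y hY => ⟨fun ω => metricOp_metricOpInv hα₀ hα₁ hY ω, ?_, ?_,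
      fun ω p => isHorizProj_iff dhat hα₀ hα₁ hY ω p, fun ω => horizProj_eq dhat hα₀ hα₁ hY ω⟩,
    fun f hf => ⟨existsUnique_isHorizGradient dhat hα₀ hα₁ hf, fun fY R hfY hR Y =>
      ⟨(isHorizGradient_iff dhat hα₀ hα₁ hfY R).1 hR Y,
        horizProj_metricOpInv dhat hα₀ hα₁ Y.2 _⟩⟩,
    existsUnique_isLeviCivita hα₀ hα₁, fun conn hconn => ?_,
    fun X => existsUnique_isHorizLift hα₁ X, existsUnique_isQuotientMetric hα₁, fun h hh =>
    ⟨fun f => hh.existsUnique_isQGradient hα₀ hα₁ f, hh.existsUnique_isQLeviCivita hα₀ hα₁,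
      fun f fY R ρ hfY hR hρ Y => ?_, fun conn hconn => ⟨?_, ?_⟩⟩⟩
  · ext ω
    exact mem_horizontalSpace dhat hα₁ hY ω
  · ext ω
    rw [mem_horizontalSpace dhat hα₁ hY, symf_eq_zero_iff, Set.mem_ofPred_eq]
    -- On the first `q` diagonal blocks `symf` leaves entries unchanged, so the two vanishing
    -- conditions coincide.
    refine and_congr_right fun _ => forall₂_congr fun a b => forall₂_congr fun h1 h2 => ?_
    rw [symf, if_pos ⟨h1, h2⟩]
  · rw [hconn.eq_lcConn hα₀ hα₁]
    refine ⟨fun ξ η _ hη Y => horizProj_lcConn dhat hα₀ hα₁ ξ hη Y,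
      fun f fY R _ hfY hfY1 hR ξ _ Y => ?_⟩
    rw [horizProj_lcConn dhat hα₀ hα₁ ξ hR.1]
    exact ⟨fun η hη => horizHessian_form dhat hα₀ hα₁ hfY hfY1 hR ξ hη Y,
      horizHessian_operator dhat hα₀ hα₁ hfY hfY1 hR ξ Y⟩
  · have h1 := (isHorizGradient_iff dhat hα₀ hα₁ hfY ρ).1 (hR.isHorizGradient hh hα₀ hα₁ hρ) Y
    exact ⟨h1, h1.trans (horizProj_metricOpInv dhat hα₀ hα₁ Y.2 _)⟩
  · exact fun X Z ξ η ζ hξ hη hζ Y => hconn.lift_eq hh hα₀ hα₁ hξ hη hζ Y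
  · intro f fY R X ξ hfY hfY1 hR hξ Y
    obtain ⟨ρ, hρ, -⟩ := existsUnique_isHorizLift (α₀ := α₀) hα₁ R
    have hg := hR.isHorizGradient hh hα₀ hα₁ hρ
    refine ⟨fun Z η hη => ?_, fun ζ hζ => ?_⟩
    · obtain ⟨ζ, hζ, -⟩ := existsUnique_isHorizLift (α₀ := α₀) hα₁ (conn X R)
      rw [hh _ _ _ _ hζ hη, hconn.lift_eq hh hα₀ hα₁ hξ hρ hζ]
      exact horizHessian_form dhat hα₀ hα₁ hfY hfY1 hg ξ hη.1 Y
    · rw [hconn.lift_eq hh hα₀ hα₁ hξ hρ hζ]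
      exact horizHessian_operator dhat hα₀ hα₁ hfY hfY1 hg ξ Y
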